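/- **Setting.** Let $S=\mathbb R/2\pi\mathbb Z$. A configuration $\hat\eta$ on $\mathbb Z^2$ has at each site $x$ either no particle or one particle, of type $\sigma\in\{a,p\}$ and with an angle $\theta_x\in S$. Write $\eta^\sigma_x\in\{0,1\}$ for the number of type-$\sigma$ particles at $x$, $\eta_x=\eta^a_x+\eta^p_x$, and $\eta^{\sigma,\Phi}_x=\Phi(\theta_x)\eta^\sigma_x$ for $\Phi:S\to\mathbb R$. Let $(\tau_xf)(\hat\eta)=f(\tau_x\hat\eta)$, $(\tau_x\hat\eta)_y=\hat\eta_{x+y}$; let $\hat\eta^{x,y}$ be $\hat\eta$ with the contents of $x,y$ exchanged, $\widetilde\nabla_{x,y}f(\hat\eta)=f(\hat\eta^{x,y})-f(\hat\eta)$, $\nabla_{x,y}=\eta_x(1-\eta_y)\widetilde\nabla_{x,y}$, and $\mathcal L=\sum_x\sum_{|z|=1}\nabla_{x,x+z}$. For $i=1,2$ put $$j_i^{\sigma,\Phi}=\eta_0^{\sigma,\Phi}(1-\eta_{e_i})-\eta_{e_i}^{\sigma,\Phi}(1-\eta_0),\quad j_i^\sigma=j_i^{\sigma,1},\quad \delta_i\eta^{\sigma,\Phi}=\eta^{\sigma,\Phi}_{e_i}-\eta^{\sigma,\Phi}_0,\quad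 \delta_i\eta^\sigma=\eta^\sigma_{e_i}-\eta^\sigma_0,\quad \delta_i\eta=\eta_{e_i}-\eta_0 .$$ Fix $\omega\in C^2(S)$ and $\hat\alpha=(\hat\alpha^a,\hat\alpha^p)$, a pair of non-negative measures on $S$ with masses $\alpha^a,\alpha^p$, $\alpha=\alpha^a+\alpha^p\le1$. $\mathbb E_{\hat\alpha}$ is the expectation for independent sites, each carrying a type-$\sigma$ particle with angle in $d\theta$ with probability $\hat\alpha^\sigma(d\theta)$ and being empty with probability $1-\alpha$. Put $\overline\omega^\sigma=\mathbb E_{\hat\alpha}[\omega(\theta_0)\mid\eta_0^\sigma=1]$ (any value if $\alpha^\sigma=0$), $j_i^{\sigma,\hat\omega}=j_i^{\sigma,\omega}-\overline\omega^\sigma j_i^\sigma$, $\delta_i\eta^{\sigma,\hat\omega}=\delta_i\eta^{\sigma,\omega}-\overline\omega^\sigma\delta_i\eta^\sigma$. **Function classes.** A cylinder function depends on finitely many sites and is $C^2$ in the angles. $\mathcal C_0$ is the space of cylinder functions with mean zero under every canonical measure with at least two empty sites on a box $B_l=\{-l,\dots,l\}^2$ containing their support (the canonical measure is uniform over all arrangements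 in $B_l$ of given particles). $\mathcal S$ is the set of functions of finitely many $\eta_x$. $T^\omega$ is the span of the cylinder functions $\sum_x(a\eta^a_x+b\eta^p_x+c\eta^{a,\omega}_x+d\eta^{p,\omega}_x)F_x$ (finite sums, $F_x\in\mathcal S$), and $\mathcal T_0^\omega=\mathcal C_0\cap T^\omega$. **Semi-norm.** For $j=\sum_{\sigma,i}j_i^{\sigma,\Phi_i^\sigma}$, local $g$ and $\varphi\in\mathcal T_0^\omega$ put, with $\Sigma_g=\sum_x\tau_xg$ (a formal sum), $$\ll j+\mathcal Lg\gg_{\hat\alpha}=\sum_{\sigma,i}\mathbb E_{\hat\alpha}\big[\eta_0^\sigma(1-\eta_{e_i})(\Phi_i^\sigma(\theta_0)+\widetilde\nabla_{0,e_i}\Sigma_g)^2\big],$$ $$\ll\varphi,j+\mathcal Lg\gg_{\hat\alpha}=-\mathbb E_{\hat\alpha}\Big[\varphi\Big(\Sigma_g+\sum_i\sum_xx_i(\eta_x^{a,\Phi_i^a}+\eta_x^{p,\Phi_i^p})\Big)\Big],$$ $$\ll\varphi\gg_{\hat\alpha}=\sup\big\{2\ll\varphi,j+\mathcal Lg\gg_{\hat\alpha}-\ll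 j+\mathcal Lg\gg_{\hat\alpha}\big\}\in[0,\infty],$$ the supremum being over $g\in\mathcal T_0^\omega$ and $\Phi_i^\sigma\in\mathrm{span}\{1,\omega\}$. $\overline{\mathcal L\mathcal T_0^\omega}$ is the closure of $\mathcal L\mathcal T_0^\omega$ in $\mathcal T_0^\omega$ with respect to $\ll\cdot\gg_{\hat\alpha}^{1/2}$ (whose completion is the Hilbert space $\mathcal H^\omega_{\hat\alpha}$). **Self-diffusion.** $d_s(\rho)$ is the self-diffusion coefficient of the symmetric simple exclusion process on $\mathbb Z^2$ at density $\rho\in[0,1]$, given by $x^\top D_s(\rho)x=d_s(\rho)|x|^2$ with $$x^\top D_s(\rho)x=\inf_{f\in\mathcal S}\sum_{i=1,2}\mathbb E_\rho\Big[(1-\eta_{e_i})\big(x_i+(\tau_{e_i}f)(\eta^{0,e_i})-f\big)^2+\sum_{y\ne0,e_i}(\nabla_{0,e_i}\tau_yf)^2\Big],$$ where under $\mathbb E_\rho$ the $\eta_x$ are independent Bernoulli($\rho$). Put $\mathcal D(\rho)=(1-d_s(\rho))/\rho$, extended to $\rho=0$ by its limit, and $\mathfrak d(\hat\alpha)=\mathbb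 E_{\hat\alpha}[\eta_0^{a,\omega}]\,\mathcal D(\alpha)$. **Proposition.** For $i=1,2$ and $\sigma\in\{a,p\}$, $$\inf_{g\in\mathcal T_0^\omega}\ll j_i^\sigma+d_s(\alpha)\delta_i\eta^\sigma+\alpha^\sigma\mathcal D(\alpha)\delta_i\eta+\mathcal Lg\gg_{\hat\alpha}=0,$$ $$\inf_{g\in\mathcal T_0^\omega}\ll j_i^{\sigma,\hat\omega}+d_s(\alpha)\delta_i\eta^{\sigma,\hat\omega}+\mathcal Lg\gg_{\hat\alpha}=0,$$ and consequently $$\inf_{g\in\mathcal T_0^\omega}\ll j_i^{a,\omega}+d_s(\alpha)\delta_i\eta^{a,\omega}+\mathfrak d(\hat\alpha)\delta_i\eta+\mathcal Lg\gg_{\hat\alpha}=0.$$ In other words, $j_i^\sigma+d_s(\alpha)\delta_i\eta^\sigma+\alpha^\sigma\mathcal D(\alpha)\delta_i\eta$, $\;j_i^{\sigma,\hat\omega}+d_s(\alpha)\delta_i\eta^{\sigma,\hat\omega}$ and $\;j_i^{a,\omega}+d_s(\alpha)\delta_i\eta^{a,\omega}+\mathfrak d(\hat\alpha)\delta_i\eta$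 all lie in $\overline{\mathcal L\mathcal T_0^\omega}$. -/

import Mathlib

noncomputable section

open MeasureTheory Filter Topology

namespace APLG

/-! ### Configurations -/

/-- The angular torus `[0, 2π)`. -/
abbrev Angle : Type := AddCircle (2 * Real.pi)

/-- The lattice `ℤ²`. -/
abbrev Lattice : Type := Fin 2 → ℤ

/-- The two particle types. -/
inductive Species : Type
  | active
  | passive
  deriving DecidableEq

instance : Fintype Species := ⟨{.active, .passive}, fun σ => by cases σ <;> decide⟩

/-- The state of a site: empty, or occupied by one particle carrying a type and an angle. -/
inductive Site : Type
  | empty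
  | particle (σ : Species) (θ : Angle)

/-- The σ-algebra of the disjoint union of a point and two circles. -/
instance : MeasurableSpace Site :=
  ⨅ σ : Species, MeasurableSpace.map (Site.particle σ) inferInstance

/-- Infinite configurations. -/
abbrev Config : Type := Lattice → Site

/-- The angle at a site, `0` by default when the site is empty. -/
def Site.angle : Site → Angle
  | .empty => 0
  | .particle _ θ => θ

/-- The number of particles of type `σ` at a site. -/
def Site.num (σ : Species) : Site → ℝ
  | .empty => 0
  | .particle τ _ => if τ = σ then 1 else 0

/-- Replace the angle of the particle at a site, if there is one. -/
def Site.setAngle (θ : Angle) : Site → Site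
  | .empty => .empty
  | .particle σ _ => .particle σ θ

/-- `η^σ_x`. -/
def occ (σ : Species) (x : Lattice) (η : Config) : ℝ := (η x).num σ

/-- `η_x = η^a_x + η^p_x`. -/
def occTot (x : Lattice) (η : Config) : ℝ := ∑ σ, occ σ x η

/-- `η^{σ,Φ}_x = Φ(θ_x) η^σ_x`. -/
def occAng (σ : Species) (Φ : Angle → ℝ) (x : Lattice) (η : Config) : ℝ :=
  Φ (η x).angle * occ σ x η

/-- The canonical basis vector `e_i`. -/
def e (i : Fin 2) : Lattice := Pi.single i 1

/-- The configuration `η^{x,y}` with the contents of `x` and `y` exchanged. -/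
def exch (x y : Lattice) (η : Config) : Config := η ∘ Equiv.swap x y

/-- The translation of functions, `(τ_x f)(η) = f(τ_x η)` with `(τ_x η)_y = η_{y+x}`. -/
def shift (x : Lattice) (f : Config → ℝ) : Config → ℝ := fun η => f (fun y => η (y + x))

/-- The undirected gradient `f(η^{x,y}) - f(η)`. -/
def ugrad (x y : Lattice) (f : Config → ℝ) : Config → ℝ := fun η => f (exch x y η) - f η

/-- The directed gradient `η_x (1 - η_y) (f(η^{x,y}) - f(η))`. -/
def dgrad (x y : Lattice) (f : Config → ℝ) : Config → ℝ :=
  fun η => occTot x η * (1 - occTot y η) * ugrad x y f η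

/-- The generator of the nearest-neighbour symmetric simple exclusion process on `ℤ²`. On a local
function only finitely many terms of the sum are non-zero. -/
def gen (f : Config → ℝ) : Config → ℝ := fun η =>
  ∑ᶠ x : Lattice, ∑ i : Fin 2, (dgrad x (x + e i) f η + dgrad x (x - e i) f η)

/-! ### Function classes -/

/-- `Φ` is a `C²` function on the angular torus. -/
def IsC2 (Φ : Angle → ℝ) : Prop := ContDiff ℝ 2 (fun t : ℝ => Φ (t : Angle))

/-- Replace the angles of the particles located in `A` by `t`. -/
def setAngles (A : Finset Lattice) (η : Config) (t : A → ℝ) : Config :=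
  fun x => if h : x ∈ A then (η x).setAngle (t ⟨x, h⟩ : Angle) else η x

/-- Cylinder functions: local and `C²` in the angles. -/
def cylinder : Submodule ℝ (Config → ℝ) where
  carrier := {f | (∃ A : Finset Lattice, DependsOn f (A : Set Lattice)) ∧
    ∀ (A : Finset Lattice) (η : Config), ContDiff ℝ 2 (fun t : A → ℝ => f (setAngles A η t))}
  zero_mem' := ⟨⟨∅, fun _ _ _ => rfl⟩, fun _ _ => contDiff_const⟩
  add_mem' := by
    classical
    rintro f g ⟨⟨A, hA⟩, hf⟩ ⟨⟨B, hB⟩, hg⟩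
    refine ⟨⟨A ∪ B, fun η ξ h => ?_⟩, fun C η => (hf C η).add (hg C η)⟩
    have h1 : f η = f ξ := hA fun x hx => h x (by simp at hx ⊢; exact Or.inl hx)
    have h2 : g η = g ξ := hB fun x hx => h x (by simp at hx ⊢; exact Or.inr hx)
    simp [h1, h2]
  smul_mem' := by
    rintro c f ⟨⟨A, hA⟩, hf⟩
    refine ⟨⟨A, fun η ξ h => ?_⟩, fun C η => contDiff_const.mul (hf C η)⟩
    have h1 : f η = f ξ := hA h
    simp [h1]

/-- The box `B_l = {-l, …, l}²`. -/
def box (l : ℕ) : Finset Lattice := Finset.Icc (fun _ => -(l : ℤ)) (fun _ => (l : ℤ))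

/-- The expectation of `ψ` under the canonical measure on `B_l` whose canonical state (the multisets
of angles of active and of passive particles) is the one of `ξ`: all the arrangements in `B_l` of the
particles that `ξ` has there are equally likely. -/
def canonicalExp (l : ℕ) (ξ : Config) (ψ : Config → ℝ) : ℝ :=
  (∑ π : Equiv.Perm (box l), ψ (ξ ∘ Equiv.Perm.ofSubtype π)) / (Fintype.card (Equiv.Perm (box l)))

/-- At least two sites of `B_l` are empty in `ξ`. -/
def TwoVacancies (l : ℕ) (ξ : Config) : Prop :=
  ∃ x ∈ box l, ∃ y ∈ box l, x ≠ y ∧ ξ x = Site.empty ∧ ξ y = Site.empty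

/-- `C_0`: cylinder functions that have mean zero under every canonical measure, with at least two
empty sites, on the boxes that contain their support. -/
def cylinderZero : Submodule ℝ (Config → ℝ) where
  carrier := {ψ | ψ ∈ cylinder ∧ ∃ s : ℕ, DependsOn ψ (box s : Set Lattice) ∧
    ∀ l, s ≤ l → ∀ ξ : Config, TwoVacancies l ξ → canonicalExp l ξ ψ = 0}
  zero_mem' := ⟨cylinder.zero_mem, 0, fun _ _ _ => rfl, fun _ _ _ _ => by simp [canonicalExp]⟩
  add_mem' := by
    rintro f g ⟨hf, s, hs, hs0⟩ ⟨hg, r, hr, hr0⟩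
    have mono : ∀ {a b : ℕ}, a ≤ b → ∀ x ∈ box a, x ∈ box b := by
      intro a b hab x hx
      have hab' : (a : ℤ) ≤ b := by exact_mod_cast hab
      rw [box, Finset.mem_Icc] at hx ⊢
      exact ⟨fun i => le_trans (neg_le_neg hab') (hx.1 i), fun i => le_trans (hx.2 i) hab'⟩
    refine ⟨cylinder.add_mem hf hg, max s r, fun η ξ h => ?_, fun l hl ξ hξ => ?_⟩
    · have h1 : f η = f ξ := hs fun x hx => h x (mono (le_max_left s r) x hx)
      have h2 : g η = g ξ := hr fun x hx => h x (mono (le_max_right s r) x hx)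
      simp [h1, h2]
    · have h1 := hs0 l (le_trans (le_max_left s r) hl) ξ hξ
      have h2 := hr0 l (le_trans (le_max_right s r) hl) ξ hξ
      simp only [canonicalExp] at h1 h2 ⊢
      simp only [Pi.add_apply, Finset.sum_add_distrib, add_div, h1, h2, add_zero]
  smul_mem' := by
    rintro c f ⟨hf, s, hs, hs0⟩
    refine ⟨cylinder.smul_mem c hf, s, fun η ξ h => ?_, fun l hl ξ hξ => ?_⟩
    · have h1 : f η = f ξ := hs h
      simp [h1]
    · have h1 := hs0 l hl ξ hξ
      simp only [canonicalExp] at h1 ⊢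
      simp only [Pi.smul_apply, smul_eq_mul, ← Finset.mul_sum, mul_div_assoc, h1, mul_zero]

/-- `S`: local functions that are blind to types and angles, that is, functions of the occupation
numbers `η_x` of finitely many sites. -/
def blind : Set (Config → ℝ) :=
  {F | ∃ A : Finset Lattice, ∀ η ξ : Config, (∀ x ∈ A, occTot x η = occTot x ξ) → F η = F ξ}

/-- `T^ω`: the span of the cylinder functions
`∑_x (a η^a_x + b η^p_x + c η^{a,ω}_x + d η^{p,ω}_x) F_x(η)` with `F_x ∈ S`. -/
def classT (ω : Angle → ℝ) : Submodule ℝ (Config → ℝ) :=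
  Submodule.span ℝ {f | f ∈ cylinder ∧ ∃ (a b c d : ℝ) (A : Finset Lattice)
    (F : Lattice → Config → ℝ), (∀ x, F x ∈ blind) ∧
    f = fun η => ∑ x ∈ A, (a * occ .active x η + b * occ .passive x η
      + c * occAng .active ω x η + d * occAng .passive ω x η) * F x η}

/-- `T_0^ω = C_0 ∩ T^ω`. -/
def classT0 (ω : Angle → ℝ) : Submodule ℝ (Config → ℝ) := cylinderZero ⊓ classT ω

/-! ### Grand canonical measures -/

/-- Grand canonical parameters: pairs of non-negative measures on the angular torus of joint total
mass at most one. -/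
structure GCParam where
  meas : Species → Measure Angle
  mass_le : ∑ σ, meas σ Set.univ ≤ 1

/-- The law of one site: a particle of type `σ` with angle in `dθ` with probability `α̂^σ(dθ)`, and
no particle with the remaining probability. -/
def GCParam.siteLaw (α : GCParam) : Measure Site :=
  ∑ σ, (α.meas σ).map (Site.particle σ)
    + (1 - ∑ σ, α.meas σ Set.univ) • Measure.dirac Site.empty

lemma measurable_particle (σ : Species) : Measurable (Site.particle σ) :=
  measurable_iff_le_map.2 (iInf_le _ σ)

instance (α : GCParam) : IsProbabilityMeasure α.siteLaw := by
  refine ⟨?_⟩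
  have h : ∀ σ, (α.meas σ).map (Site.particle σ) Set.univ = α.meas σ Set.univ := fun σ => by
    rw [Measure.map_apply (measurable_particle σ) MeasurableSet.univ, Set.preimage_univ]
  simp only [GCParam.siteLaw, Measure.add_apply, Measure.finsetSum_apply, h, Measure.smul_apply,
    measure_univ, smul_eq_mul, mul_one]
  exact add_tsub_cancel_of_le α.mass_le

/-- The grand canonical measure: the sites are independent with law `siteLaw`. -/
def GCParam.measure (α : GCParam) : Measure Config := Measure.infinitePi fun _ => α.siteLaw

/-- The expectation under the grand canonical measure. -/
def GCParam.E (α : GCParam) (f : Config → ℝ) : ℝ := ∫ η, f η ∂α.measure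

/-- The density `α^σ`. -/
def GCParam.density (α : GCParam) (σ : Species) : ℝ := (α.meas σ Set.univ).toReal

/-- The total density `α = α^a + α^p`. -/
def GCParam.total (α : GCParam) : ℝ := ∑ σ, α.density σ

/-- The conditional mean `E[ω(θ_0) | η^σ_0 = 1]`. -/
def GCParam.angMean (α : GCParam) (σ : Species) (ω : Angle → ℝ) : ℝ :=
  α.E (occAng σ ω 0) / α.E (occ σ 0)

/-! ### The semi-norm -/

/-- `⟪j* + 𝓛 g⟫_α̂`, where `j* = ∑_σ ∑_i j_i^{σ,Φ σ i}`. Here `∇̃_{0,e_i} Σ_g` is the sum over `x` of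
`∇̃_{0,e_i} τ_x g`, finitely many terms of which are non-zero when `g` is local. -/
def energy (α : GCParam) (Φ : Species → Fin 2 → Angle → ℝ) (g : Config → ℝ) : ℝ :=
  ∑ σ, ∑ i, α.E fun η => occ σ 0 η * (1 - occTot (e i) η) *
    (Φ σ i (η 0).angle + ∑ᶠ x : Lattice, ugrad 0 (e i) (shift x g) η) ^ 2

/-- `⟪φ, j* + 𝓛 g⟫_α̂ = - E[φ (Σ_g + ∑_i ∑_x x_i (η_x^{a,Φ^a_i} + η_x^{p,Φ^p_i}))]`, the sums over `x`
being taken outside the expectation; only finitely many terms are non-zero when `φ` is local with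
mean zero and `g` is local. -/
def pairing (α : GCParam) (φ : Config → ℝ) (Φ : Species → Fin 2 → Angle → ℝ)
    (g : Config → ℝ) : ℝ :=
  -(∑ᶠ x : Lattice, α.E (fun η => φ η * shift x g η)
    + ∑ i, ∑ᶠ x : Lattice, (x i : ℝ) * α.E (fun η => φ η * ∑ σ, occAng σ (Φ σ i) x η))

/-- The angular functions `c σ i + d σ i • ω` of the element
`∑_σ ∑_i (c σ i • j_i^σ + d σ i • j_i^{σ,ω})` of `J^ω`. -/
def affineAng (ω : Angle → ℝ) (c d : Species → Fin 2 → ℝ) : Species → Fin 2 → Angle → ℝ :=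
  fun σ i θ => c σ i + d σ i * ω θ

/-- `⟪φ⟫_α̂ = sup_{j ∈ J^ω, g ∈ T_0^ω} (2 ⟪φ, j + 𝓛 g⟫_α̂ - ⟪j + 𝓛 g⟫_α̂)`, the squared semi-norm
on `T_0^ω`, as an extended real number. -/
def seminormSq (α : GCParam) (ω : Angle → ℝ) (φ : Config → ℝ) : EReal :=
  ⨆ (c : Species → Fin 2 → ℝ) (d : Species → Fin 2 → ℝ) (g : classT0 ω),
    ((2 * pairing α φ (affineAng ω c d) g - energy α (affineAng ω c d) g : ℝ) : EReal)

/-- `f` belongs to the closure of `𝓛 T_0^ω` with respect to the semi-norm `⟪·⟫_α̂^{1/2}` on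
`T_0^ω`: it is the limit of a sequence `𝓛 g_n` with `g_n ∈ T_0^ω`. -/
def InClosureGen (α : GCParam) (ω : Angle → ℝ) (f : Config → ℝ) : Prop :=
  f ∈ classT0 ω ∧ ∃ g : ℕ → classT0 ω,
    Tendsto (fun n => seminormSq α ω (f - gen (g n))) atTop (𝓝 0)

/-! ### Currents and local gradients -/

/-- The current `j_i^{σ,Φ}`. -/
def current (σ : Species) (Φ : Angle → ℝ) (i : Fin 2) : Config → ℝ := fun η =>
  occAng σ Φ 0 η * (1 - occTot (e i) η) - occAng σ Φ (e i) η * (1 - occTot 0 η)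

/-- The current `j_i^σ`. -/
def current1 (σ : Species) (i : Fin 2) : Config → ℝ := current σ (fun _ => 1) i

/-- The local gradient `δ_i η^{σ,Φ}`. -/
def locGradAng (σ : Species) (Φ : Angle → ℝ) (i : Fin 2) : Config → ℝ :=
  fun η => occAng σ Φ (e i) η - occAng σ Φ 0 η

/-- The local gradient `δ_i η^σ`. -/
def locGrad (σ : Species) (i : Fin 2) : Config → ℝ := fun η => occ σ (e i) η - occ σ 0 η

/-- The local gradient `δ_i η`. -/
def locGradTot (i : Fin 2) : Config → ℝ := fun η => occTot (e i) η - occTot 0 η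

/-- The centered current `j_i^{σ,ω} - E[ω(θ_0) | η^σ_0 = 1] j_i^σ`. -/
def centeredCurrent (α : GCParam) (σ : Species) (ω : Angle → ℝ) (i : Fin 2) : Config → ℝ :=
  current σ ω i - α.angMean σ ω • current1 σ i

/-- The centered local gradient `δ_i η^{σ,ω} - E[ω(θ_0) | η^σ_0 = 1] δ_i η^σ`. -/
def centeredLocGrad (α : GCParam) (σ : Species) (ω : Angle → ℝ) (i : Fin 2) : Config → ℝ :=
  locGradAng σ ω i - α.angMean σ ω • locGrad σ i

/-! ### Self-diffusion -/

/-- A grand canonical parameter of total density `ρ ∈ [0,1]` (`ρ` is clamped to this interval). -/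
def GCParam.ofDensity (ρ : ℝ) : GCParam where
  meas σ := if σ = .active then ENNReal.ofReal (min ρ 1) • Measure.dirac 0 else 0
  mass_le := by
    have h : (Finset.univ : Finset Species) = {.active, .passive} := rfl
    simp [h]

/-- The quadratic form `x ↦ xᵀ D_s(ρ) x` of the self-diffusion matrix of the symmetric simple
exclusion process on `ℤ²` at density `ρ`. The integrand only sees occupation numbers, so that any
parameter of density `ρ` gives the same value. -/
def selfDiffusionForm (ρ : ℝ) (x : Fin 2 → ℝ) : ℝ :=
  ⨅ f : blind, ∑ i, (GCParam.ofDensity ρ).E fun η =>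
    (1 - occTot (e i) η) * (x i + shift (e i) f.1 (exch 0 (e i) η) - f.1 η) ^ 2
      + ∑ᶠ (y : Lattice) (_ : y ≠ 0 ∧ y ≠ e i), dgrad 0 (e i) (shift y f.1) η ^ 2

/-- The self-diffusion coefficient `d_s(ρ)`, the common value on unit vectors of the isotropic form
`x ↦ xᵀ D_s(ρ) x`. -/
def ds (ρ : ℝ) : ℝ := selfDiffusionForm ρ (Pi.single 0 1)

/-- `𝓓(ρ) = (1 - d_s(ρ)) / ρ`, extended to `ρ = 0` by its limit. -/
def crossD (ρ : ℝ) : ℝ :=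
  if ρ = 0 then limUnder (𝓝[>] (0 : ℝ)) (fun r => (1 - ds r) / r) else (1 - ds ρ) / ρ

/-- `𝔡(α̂) = E[η^{a,ω}_0] 𝓓(α)`. -/
def frakD (α : GCParam) (ω : Angle → ℝ) : ℝ := α.E (occAng .active ω 0) * crossD α.total

/-- The two forms of the assertion that `f` vanishes modulo the closure of `𝓛 T_0^ω`: the infimum
over `g ∈ T_0^ω` of `⟪f + 𝓛 g⟫_α̂` is zero, and `f` lies in the closure. -/
def VanishesModGen (α : GCParam) (ω : Angle → ℝ) (f : Config → ℝ) : Prop :=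
  (⨅ g : classT0 ω, seminormSq α ω (f + gen g)) = 0 ∧ InClosureGen α ω f

end APLG

end

noncomputable section

open MeasureTheory Filter Topology

namespace APLG

/-! ### Site functions and local observables -/

/-! All three claims are instances of one statement about a site function `v` that is affine in `ω`
on each species. Its current, corrected by `ds` times the gradient of `v` and by `mean v * crossD`
times the gradient of the occupation number, is a limit of elements of the image of the generator.
Write `v = Φ + m * tot` with `m = mean v / total`, so that `Φ` has mean zero. The total current is
exactly minus the gradient of the occupation number, hence the `tot` part cancels and only `curr Φ +
ds * lgrad Φ` remains to be corrected.

Summation by parts (`pairing_curr_gen`) writes the pairing of `curr Φ + ds * lgrad Φ + gen g` with a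
trial field `(Ψ, h)` as the inner product, in the energy form, of the gradient field of `(Φ, g)`
with that of `(Ψ, h)`, minus `ds * mean (Φ Ψ_i)`. It therefore suffices to find `g` for which this
difference is at most `√(δ * energy)` for every trial field.

The corrector is `g = Φ(η_0) f` with `f` a function of occupation numbers. Its gradient field is a
sum over particles: each one is in turn regarded as tagged, carries the weight `Φ` of its own state,
and multiplies the increment of `f` for the environment seen from it. Since `Φ` has mean zero and
exclusion does not see types and angles, resampling the state of a single particle kills every
product of fields carried by two different particles (`E_tagField_mul`). Thus the fields with weight
`Φ` form a copy of the gradient fields of a tagged particle, and the energy form against any trial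
field reduces to `tagForm` (`energyForm_tag`): the trial field enters only through the vector `mean
(Φ Ψ_k)` and one blind function `G`.

On that side, `ds` is the infimum of `tagForm` over blind functions. Lattice symmetries give
isotropy (`ds_mul_le_tagForm`), so `tagForm` minus `ds` times the squared norm is non-negative, and
at a near-minimizer it is at most `δ`. The Cauchy–Schwarz inequality for it shows that a
near-minimizer pairs with `(x, G)` as `ds * x_i` up to `√(δ * tagForm (x, G))`
(`tagForm_sub_sq_le`). A Bessel inequality bounds `tagForm (x, G)` by `mean (Φ²)` times the energy
of the trial field, which gives `exists_corrector`.

The function `Φ(η_0) f` must also have zero canonical means. First `f` is made independent of the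
origin without raising its form; then the average of its translates over a distant square of side
`n` is subtracted. That average has the same canonical means against `Φ(η_0)`, and its form is of
order `n⁻²`, so near-minimality survives (`exists_nearMinimizer`). -/

/-- The occupation number of a site state. -/
def Site.tot (s : Site) : ℝ := ∑ σ, s.num σ

/-- A reference particle. -/
def refParticle : Site := Site.particle .active 0

lemma sum_species {M : Type*} [AddCommMonoid M] (f : Species → M) :
    ∑ σ, f σ = f .active + f .passive := by
  have h : (Finset.univ : Finset Species) = {.active, .passive} := rfl
  rw [h, Finset.sum_pair (by decide)]

@[simp] lemma Site.tot_empty : Site.empty.tot = 0 := by simp [Site.tot, Site.num]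

@[simp] lemma Site.tot_particle (σ : Species) (θ : Angle) : (Site.particle σ θ).tot = 1 := by
  simp [Site.tot, Site.num]

lemma Site.tot_of_ne {s : Site} (h : s ≠ Site.empty) : s.tot = 1 := by
  cases s <;> simp_all

@[simp] lemma Site.tot_refParticle : refParticle.tot = 1 := Site.tot_particle _ _

lemma occTot_eq (x : Lattice) (η : Config) : occTot x η = (η x).tot := rfl

lemma Site.measurable_iff {v : Site → ℝ} :
    Measurable v ↔ ∀ σ, Measurable fun θ => v (Site.particle σ θ) := by
  constructor
  · intro h σ
    exact h.comp (measurable_particle σ)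
  · intro h s hs
    refine MeasurableSpace.measurableSet_iInf.2 fun σ => ?_
    exact h σ hs

/-- Bounded measurable functions of the state of one site that vanish at the empty state. -/
structure SiteFn (v : Site → ℝ) : Prop where
  meas : Measurable v
  bdd : ∃ C, ∀ s, |v s| ≤ C
  empty : v Site.empty = 0

lemma SiteFn.mk' {v : Site → ℝ} (hm : ∀ σ, Measurable fun θ => v (Site.particle σ θ))
    (hb : ∃ C, ∀ s, |v s| ≤ C) (h0 : v Site.empty = 0) : SiteFn v :=
  ⟨Site.measurable_iff.2 hm, hb, h0⟩

lemma SiteFn.add {v w : Site → ℝ} (hv : SiteFn v) (hw : SiteFn w) :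
    SiteFn (fun s => v s + w s) := by
  obtain ⟨C, hC⟩ := hv.bdd
  obtain ⟨D, hD⟩ := hw.bdd
  exact ⟨hv.meas.add hw.meas, ⟨C + D, fun s => (abs_add_le _ _).trans (add_le_add (hC s) (hD s))⟩,
    by simp [hv.empty, hw.empty]⟩

lemma SiteFn.mul {v w : Site → ℝ} (hv : SiteFn v) (hw : SiteFn w) :
    SiteFn (fun s => v s * w s) := by
  obtain ⟨C, hC⟩ := hv.bdd
  obtain ⟨D, hD⟩ := hw.bdd
  refine ⟨hv.meas.mul hw.meas, ⟨C * D, fun s => ?_⟩, by simp [hv.empty]⟩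
  rw [abs_mul]
  exact mul_le_mul (hC s) (hD s) (abs_nonneg _) ((abs_nonneg _).trans (hC s))

lemma SiteFn.const_mul {v : Site → ℝ} (hv : SiteFn v) (c : ℝ) : SiteFn (fun s => c * v s) := by
  obtain ⟨C, hC⟩ := hv.bdd
  refine ⟨hv.meas.const_mul c, ⟨|c| * C, fun s => ?_⟩, by simp [hv.empty]⟩
  rw [abs_mul]
  exact mul_le_mul_of_nonneg_left (hC s) (abs_nonneg _)

lemma siteFn_zero : SiteFn (fun _ => 0) := ⟨measurable_const, ⟨0, by simp⟩, rfl⟩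

lemma siteFn_tot : SiteFn Site.tot := by
  refine SiteFn.mk' (fun σ => by simp) ⟨1, fun s => ?_⟩ (by simp)
  cases s <;> simp

lemma siteFn_num (σ : Species) : SiteFn (Site.num σ) := by
  refine SiteFn.mk' (fun τ => by simp [Site.num]) ⟨1, fun s => ?_⟩ rfl
  cases s with
  | empty => simp [Site.num]
  | particle τ θ => by_cases h : τ = σ <;> simp [Site.num, h]

lemma SiteFn.mul_tot {v : Site → ℝ} (hv : SiteFn v) (s : Site) : v s * s.tot = v s := by
  cases s <;> simp [hv.empty]

lemma SiteFn.mul_one_sub_tot {v : Site → ℝ} (hv : SiteFn v) (s : Site) :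
    v s * (1 - s.tot) = 0 := by
  cases s <;> simp [hv.empty]

/-- Measurable bounded functions of finitely many sites. -/
structure Nice (f : Config → ℝ) : Prop where
  meas : Measurable f
  bdd : ∃ C, ∀ η, |f η| ≤ C
  loc : ∃ A : Finset Lattice, DependsOn f (A : Set Lattice)

lemma nice_const (c : ℝ) : Nice (fun _ => c) :=
  ⟨measurable_const, ⟨|c|, fun _ => le_rfl⟩, ⟨∅, fun _ _ _ => rfl⟩⟩

lemma Nice.add {f g : Config → ℝ} (hf : Nice f) (hg : Nice g) : Nice (fun η => f η + g η) := by
  classical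
  obtain ⟨C, hC⟩ := hf.bdd
  obtain ⟨D, hD⟩ := hg.bdd
  obtain ⟨A, hA⟩ := hf.loc
  obtain ⟨B, hB⟩ := hg.loc
  refine ⟨hf.meas.add hg.meas, ⟨C + D, fun s => (abs_add_le _ _).trans (add_le_add (hC s) (hD s))⟩,
    ⟨A ∪ B, fun η ξ h => ?_⟩⟩
  have h1 := hA fun x hx => h x (by simp at hx ⊢; exact Or.inl hx)
  have h2 := hB fun x hx => h x (by simp at hx ⊢; exact Or.inr hx)
  simp [h1, h2]

lemma Nice.mul {f g : Config → ℝ} (hf : Nice f) (hg : Nice g) : Nice (fun η => f η * g η) := by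
  classical
  obtain ⟨C, hC⟩ := hf.bdd
  obtain ⟨D, hD⟩ := hg.bdd
  obtain ⟨A, hA⟩ := hf.loc
  obtain ⟨B, hB⟩ := hg.loc
  refine ⟨hf.meas.mul hg.meas, ⟨C * D, fun s => ?_⟩, ⟨A ∪ B, fun η ξ h => ?_⟩⟩
  · rw [abs_mul]
    exact mul_le_mul (hC s) (hD s) (abs_nonneg _) ((abs_nonneg _).trans (hC s))
  have h1 := hA fun x hx => h x (by simp at hx ⊢; exact Or.inl hx)
  have h2 := hB fun x hx => h x (by simp at hx ⊢; exact Or.inr hx)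
  simp [h1, h2]

lemma Nice.const_mul {f : Config → ℝ} (hf : Nice f) (c : ℝ) : Nice (fun η => c * f η) :=
  (nice_const c).mul hf

lemma Nice.neg {f : Config → ℝ} (hf : Nice f) : Nice (fun η => -f η) := by
  simpa using hf.const_mul (-1)

lemma Nice.sub {f g : Config → ℝ} (hf : Nice f) (hg : Nice g) : Nice (fun η => f η - g η) := by
  simpa [sub_eq_add_neg] using hf.add hg.neg

lemma Nice.pow_two {f : Config → ℝ} (hf : Nice f) : Nice (fun η => f η ^ 2) := by
  simpa only [sq] using hf.mul hf

lemma Nice.sum {ι : Type*} {f : ι → Config → ℝ} (s : Finset ι) (hf : ∀ i ∈ s, Nice (f i)) :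
    Nice (fun η => ∑ i ∈ s, f i η) := by
  classical
  induction s using Finset.induction_on with
  | empty => simpa using nice_const 0
  | insert a s ha ih =>
    simp only [Finset.sum_insert ha]
    exact (hf a (by simp)).add (ih fun i hi => hf i (by simp [hi]))

lemma Nice.comp_perm {f : Config → ℝ} (hf : Nice f) (π : Equiv.Perm Lattice) :
    Nice (fun η => f (η ∘ π)) := by
  obtain ⟨C, hC⟩ := hf.bdd
  obtain ⟨A, hA⟩ := hf.loc
  refine ⟨hf.meas.comp (measurable_pi_iff.2 fun x => measurable_pi_apply _), ⟨C, fun η => hC _⟩,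
    ⟨A.map π.toEmbedding, fun η ξ h => hA fun x hx => h _ ?_⟩⟩
  simpa using hx

lemma Nice.comp_exch {f : Config → ℝ} (hf : Nice f) (x y : Lattice) :
    Nice (fun η => f (exch x y η)) := hf.comp_perm (Equiv.swap x y)

lemma Nice.shift {f : Config → ℝ} (hf : Nice f) (x : Lattice) : Nice (shift x f) :=
  hf.comp_perm (Equiv.addRight x)

lemma Nice.ugrad {f : Config → ℝ} (hf : Nice f) (x y : Lattice) : Nice (ugrad x y f) :=
  (hf.comp_exch x y).sub hf

lemma Nice.update {f : Config → ℝ} (hf : Nice f) (x : Lattice) (s : Site) :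
    Nice (fun η => f (Function.update η x s)) := by
  obtain ⟨C, hC⟩ := hf.bdd
  obtain ⟨A, hA⟩ := hf.loc
  refine ⟨hf.meas.comp (measurable_pi_iff.2 fun y => ?_), ⟨C, fun η => hC _⟩,
    ⟨A, fun η ξ h => hA fun y hy => ?_⟩⟩
  · by_cases h : y = x
    · subst h; simp
    · simpa [h] using measurable_pi_apply y
  · by_cases h' : y = x
    · subst h'; simp
    · simpa [h'] using h y hy

lemma SiteFn.nice {v : Site → ℝ} (hv : SiteFn v) (x : Lattice) : Nice (fun η => v (η x)) := by
  obtain ⟨C, hC⟩ := hv.bdd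
  exact ⟨hv.meas.comp (measurable_pi_apply x), ⟨C, fun η => hC _⟩,
    ⟨{x}, fun η ξ h => congrArg v (h x (by simp))⟩⟩

lemma nice_occTot (x : Lattice) : Nice (occTot x) := siteFn_tot.nice x

lemma nice_vac (x : Lattice) : Nice (fun η => 1 - occTot x η) := (nice_const 1).sub (nice_occTot x)

lemma Nice.dgrad {f : Config → ℝ} (hf : Nice f) (x y : Lattice) : Nice (dgrad x y f) :=
  ((nice_occTot x).mul (nice_vac y)).mul (hf.ugrad x y)

/-! ### Expectations -/

instance (α : GCParam) : IsProbabilityMeasure α.measure := by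
  unfold GCParam.measure; infer_instance

lemma Nice.integrable {f : Config → ℝ} (hf : Nice f) (α : GCParam) : Integrable f α.measure := by
  obtain ⟨C, hC⟩ := hf.bdd
  exact Integrable.of_bound hf.meas.aestronglyMeasurable C (ae_of_all _ fun η => hC η)

section
variable (α : GCParam)

lemma E_add {f g : Config → ℝ} (hf : Nice f) (hg : Nice g) :
    α.E (fun η => f η + g η) = α.E f + α.E g :=
  integral_add (hf.integrable α) (hg.integrable α)

lemma E_sub {f g : Config → ℝ} (hf : Nice f) (hg : Nice g) :
    α.E (fun η => f η - g η) = α.E f - α.E g :=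
  integral_sub (hf.integrable α) (hg.integrable α)

lemma E_const_mul (c : ℝ) (f : Config → ℝ) : α.E (fun η => c * f η) = c * α.E f :=
  integral_const_mul c f

lemma E_neg (f : Config → ℝ) : α.E (fun η => -f η) = -α.E f := integral_neg f

lemma E_const (c : ℝ) : α.E (fun _ => c) = c := by simp [GCParam.E]

lemma E_sum {ι : Type*} {f : ι → Config → ℝ} (s : Finset ι) (hf : ∀ i ∈ s, Nice (f i)) :
    α.E (fun η => ∑ i ∈ s, f i η) = ∑ i ∈ s, α.E (f i) :=
  integral_finsetSum s fun i hi => (hf i hi).integrable α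

lemma E_nonneg {f : Config → ℝ} (hf : ∀ η, 0 ≤ f η) : 0 ≤ α.E f := integral_nonneg hf

lemma E_mono {f g : Config → ℝ} (hf : Nice f) (hg : Nice g) (h : ∀ η, f η ≤ g η) :
    α.E f ≤ α.E g :=
  integral_mono (hf.integrable α) (hg.integrable α) h

lemma measurePreserving_perm (π : Equiv.Perm Lattice) :
    MeasurePreserving (fun η : Config => η ∘ π) α.measure α.measure :=
  ⟨measurable_pi_iff.2 fun _ => measurable_pi_apply _,
    Measure.map_infinitePi_infinitePi_of_inj (P := fun _ : Lattice => α.siteLaw) π.injective⟩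

lemma E_perm {f : Config → ℝ} (hf : Nice f) (π : Equiv.Perm Lattice) :
    α.E (fun η => f (η ∘ π)) = α.E f := by
  have h := measurePreserving_perm α π
  unfold GCParam.E
  conv_rhs => rw [← h.map_eq]
  rw [integral_map h.measurable.aemeasurable hf.meas.aestronglyMeasurable]

lemma E_exch {f : Config → ℝ} (hf : Nice f) (x y : Lattice) :
    α.E (fun η => f (exch x y η)) = α.E f := E_perm α hf (Equiv.swap x y)

lemma E_shift {f : Config → ℝ} (hf : Nice f) (x : Lattice) :
    α.E (shift x f) = α.E f := E_perm α hf (Equiv.addRight x)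

/-- The mean of a function of the state of one site. -/
def GCParam.mean (v : Site → ℝ) : ℝ := α.E (fun η => v (η 0))

lemma E_siteFn {v : Site → ℝ} (hv : SiteFn v) (x : Lattice) :
    α.E (fun η => v (η x)) = α.mean v := by
  have := E_shift α (hv.nice 0) x
  rw [GCParam.mean, ← this]
  change _ = α.E (fun η => v (η (0 + x)))
  rw [zero_add]

/-- Independence of the site `x` from the finitely many other sites on which `K` depends. -/
lemma E_mul_of_update {v : Site → ℝ} (hv : SiteFn v) {x : Lattice} {K : Config → ℝ} (hK : Nice K)
    (hx : ∀ η s, K (Function.update η x s) = K η) :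
    α.E (fun η => v (η x) * K η) = α.mean v * α.E K := by
  classical
  obtain ⟨A, hA⟩ := hK.loc
  set T : Finset Lattice := A.erase x
  have hind := (ProbabilityTheory.iIndepFun_infinitePi (P := fun _ : Lattice => α.siteLaw)
    (X := fun _ s => s) (fun _ => measurable_id)).indepFun_finset {x} T
    (by simp [T]) (fun i => measurable_pi_apply i)
  -- Filling the sites outside `T` with vacancies does not change `K`: it ignores the sites outside
  -- `A` by locality, and `x` by hypothesis.
  let ext : (T → Site) → Config := fun b y => if h : y ∈ T then b ⟨y, h⟩ else Site.empty
  have hext : Measurable ext := measurable_pi_iff.2 fun y => by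
    by_cases h : y ∈ T
    · simpa [ext, h] using measurable_pi_apply _
    · simp [ext, h]
  have hKext : ∀ η : Config, K (ext fun i => η i) = K η := by
    intro η
    rw [← hx η Site.empty]
    refine hA fun y hy => ?_
    by_cases h : y = x
    · subst h; simp [ext, T]
    · have : y ∈ T := by simp only [T, Finset.mem_erase]; exact ⟨h, hy⟩
      simp [ext, this, h]
  have := hind.integral_fun_comp_mul_comp (f := fun b : ({x} : Finset Lattice) → Site =>
      v (b ⟨x, by simp⟩)) (g := fun b => K (ext b))
      (measurable_pi_iff.2 fun i => measurable_pi_apply _).aemeasurable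
      (measurable_pi_iff.2 fun i => measurable_pi_apply _).aemeasurable
      (hv.meas.comp (measurable_pi_apply _)).aestronglyMeasurable
      (hK.meas.comp hext).aestronglyMeasurable
  simp only [hKext] at this
  rw [← E_siteFn α hv x]
  exact this

/-- A function that sees the site `x` only through its occupation number, when it is occupied. -/
def OccInv (x : Lattice) (K : Config → ℝ) : Prop :=
  ∀ η : Config, η x ≠ Site.empty → K (Function.update η x refParticle) = K η

/-- Resampling of the particle at one site. -/
lemma E_resample {v : Site → ℝ} (hv : SiteFn v) {x : Lattice} {K : Config → ℝ} (hK : Nice K)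
    (hx : OccInv x K) :
    α.E (fun η => v (η x) * K η)
      = α.mean v * α.E (fun η => K (Function.update η x refParticle)) := by
  rw [← E_mul_of_update α hv (x := x) (hK.update x refParticle) (fun η s => by simp)]
  congr 1
  funext η
  -- An empty site makes both sides zero because `v` vanishes there; otherwise the particle can be
  -- replaced by the reference one.
  by_cases h : η x = Site.empty
  · simp [h, hv.empty]
  · rw [hx η h]

lemma mean_add {v w : Site → ℝ} (hv : SiteFn v) (hw : SiteFn w) :
    α.mean (fun s => v s + w s) = α.mean v + α.mean w := E_add α (hv.nice 0) (hw.nice 0)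

lemma mean_const_mul (v : Site → ℝ) (c : ℝ) : α.mean (fun s => c * v s) = c * α.mean v :=
  E_const_mul α c _

lemma mean_sub {v w : Site → ℝ} (hv : SiteFn v) (hw : SiteFn w) :
    α.mean (fun s => v s - w s) = α.mean v - α.mean w := E_sub α (hv.nice 0) (hw.nice 0)

lemma mean_num (σ : Species) : α.mean (Site.num σ) = α.density σ := by
  have hE : α.mean (Site.num σ) = ∫ s, s.num σ ∂α.siteLaw := by
    have h := measurePreserving_eval_infinitePi (fun _ : Lattice => α.siteLaw) 0
    conv_rhs => rw [← h.map_eq]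
    rw [integral_map h.measurable.aemeasurable (siteFn_num σ).meas.aestronglyMeasurable]
    rfl
  have hS : MeasurableSet {s : Site | s.num σ = 1} :=
    (siteFn_num σ).meas (measurableSet_singleton 1)
  have hind : Site.num σ = Set.indicator {s : Site | s.num σ = 1} (fun _ => (1 : ℝ)) := by
    funext s
    by_cases h : s.num σ = 1
    · simp [Set.indicator, h]
    · cases s with
      | empty => simp [Set.indicator, Site.num]
      | particle τ θ =>
        by_cases h' : τ = σ
        · simp [Site.num, h'] at h
        · simp [Set.indicator, Site.num, h']
  have hp : ∀ τ, Site.particle τ ⁻¹' {s : Site | s.num σ = 1}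
      = if τ = σ then Set.univ else ∅ := by
    intro τ
    ext θ
    by_cases h' : τ = σ <;> simp [Site.num, h']
  rw [hE, hind, integral_indicator_const _ hS, GCParam.density, Measure.real]
  simp only [smul_eq_mul, mul_one]
  congr 1
  simp only [GCParam.siteLaw, Measure.add_apply, Measure.finsetSum_apply, Measure.smul_apply,
    Measure.map_apply (measurable_particle _) hS, hp, Measure.dirac_apply' _ hS]
  cases σ <;> simp [sum_species, Site.num]

lemma mean_tot : α.mean Site.tot = α.total := by
  have h : Site.tot = fun s => s.num .active + s.num .passive := by
    funext s; simp [Site.tot, sum_species]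
  rw [h, mean_add α (siteFn_num _) (siteFn_num _), mean_num, mean_num, GCParam.total, sum_species]

lemma total_nonneg : 0 ≤ α.total := by
  rw [← mean_tot]
  exact E_nonneg α fun η => by rcases h : η 0 with _ | _ <;> simp

lemma total_le_one : α.total ≤ 1 := by
  rw [← mean_tot, ← E_const α 1]
  exact E_mono α (siteFn_tot.nice 0) (nice_const 1) fun η => by rcases h : η 0 with _ | _ <;> simp

lemma total_ofDensity {ρ : ℝ} (h0 : 0 ≤ ρ) (h1 : ρ ≤ 1) : (GCParam.ofDensity ρ).total = ρ := by
  simp [GCParam.total, sum_species, GCParam.density, GCParam.ofDensity, h1, h0]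

end

/-! ### Blind functions -/

/-- Replace a particle by the reference particle. -/
def Site.norm : Site → Site
  | .empty => .empty
  | .particle _ _ => refParticle

/-- Replace all particles by reference particles. -/
def normCfg (η : Config) : Config := fun x => (η x).norm

@[simp] lemma Site.norm_empty : Site.empty.norm = Site.empty := rfl

@[simp] lemma Site.norm_refParticle : refParticle.norm = refParticle := rfl

lemma Site.norm_of_ne {s : Site} (h : s ≠ Site.empty) : s.norm = refParticle := by
  cases s
  · exact absurd rfl h
  · rfl

@[simp] lemma Site.tot_norm (s : Site) : s.norm.tot = s.tot := by cases s <;> simp [Site.norm]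

lemma Site.norm_eq_of_tot {s t : Site} (h : s.tot = t.tot) : s.norm = t.norm := by
  cases s <;> cases t <;> simp_all [Site.norm]

/-- Local functions of the occupation numbers. -/
structure Blind (F : Config → ℝ) : Prop where
  loc : ∃ A : Finset Lattice, DependsOn F (A : Set Lattice)
  norm : ∀ η, F (normCfg η) = F η

lemma mem_blind_iff {F : Config → ℝ} : F ∈ blind ↔ Blind F := by
  constructor
  · rintro ⟨A, hA⟩
    refine ⟨⟨A, fun η ξ h => hA η ξ fun x hx => ?_⟩, fun η => hA _ _ fun x _ => ?_⟩
    · rw [occTot_eq, occTot_eq, h x hx]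
    · rw [occTot_eq, occTot_eq, normCfg, Site.tot_norm]
  · rintro ⟨⟨A, hA⟩, hn⟩
    refine ⟨A, fun η ξ h => ?_⟩
    rw [← hn η, ← hn ξ]
    exact hA fun x hx => Site.norm_eq_of_tot (h x hx)

lemma blind_const (c : ℝ) : Blind (fun _ => c) := ⟨⟨∅, fun _ _ _ => rfl⟩, fun _ => rfl⟩

lemma Blind.add {f g : Config → ℝ} (hf : Blind f) (hg : Blind g) : Blind (fun η => f η + g η) := by
  classical
  obtain ⟨A, hA⟩ := hf.loc
  obtain ⟨B, hB⟩ := hg.loc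
  refine ⟨⟨A ∪ B, fun η ξ h => ?_⟩, fun η => by rw [hf.norm, hg.norm]⟩
  have h1 := hA fun x hx => h x (by simp at hx ⊢; exact Or.inl hx)
  have h2 := hB fun x hx => h x (by simp at hx ⊢; exact Or.inr hx)
  simp [h1, h2]

lemma Blind.mul {f g : Config → ℝ} (hf : Blind f) (hg : Blind g) : Blind (fun η => f η * g η) := by
  classical
  obtain ⟨A, hA⟩ := hf.loc
  obtain ⟨B, hB⟩ := hg.loc
  refine ⟨⟨A ∪ B, fun η ξ h => ?_⟩, fun η => by rw [hf.norm, hg.norm]⟩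
  have h1 := hA fun x hx => h x (by simp at hx ⊢; exact Or.inl hx)
  have h2 := hB fun x hx => h x (by simp at hx ⊢; exact Or.inr hx)
  simp [h1, h2]

lemma Blind.const_mul {f : Config → ℝ} (hf : Blind f) (c : ℝ) : Blind (fun η => c * f η) :=
  (blind_const c).mul hf

lemma Blind.sub {f g : Config → ℝ} (hf : Blind f) (hg : Blind g) : Blind (fun η => f η - g η) := by
  simpa [sub_eq_add_neg] using hf.add (hg.const_mul (-1))

lemma Blind.sum {ι : Type*} {f : ι → Config → ℝ} (s : Finset ι) (hf : ∀ i ∈ s, Blind (f i)) :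
    Blind (fun η => ∑ i ∈ s, f i η) := by
  classical
  induction s using Finset.induction_on with
  | empty => simpa using blind_const 0
  | insert a s ha ih =>
    simp only [Finset.sum_insert ha]
    exact (hf a (by simp)).add (ih fun i hi => hf i (by simp [hi]))

lemma Blind.comp_perm {f : Config → ℝ} (hf : Blind f) (π : Equiv.Perm Lattice) :
    Blind (fun η => f (η ∘ π)) := by
  obtain ⟨A, hA⟩ := hf.loc
  refine ⟨⟨A.map π.toEmbedding, fun η ξ h => hA fun x hx => h _ ?_⟩, fun η => hf.norm (η ∘ π)⟩
  simpa using hx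

lemma Blind.comp_exch {f : Config → ℝ} (hf : Blind f) (x y : Lattice) :
    Blind (fun η => f (exch x y η)) := hf.comp_perm (Equiv.swap x y)

lemma Blind.shift {f : Config → ℝ} (hf : Blind f) (x : Lattice) : Blind (shift x f) :=
  hf.comp_perm (Equiv.addRight x)

lemma Blind.ugrad {f : Config → ℝ} (hf : Blind f) (x y : Lattice) : Blind (ugrad x y f) :=
  (hf.comp_exch x y).sub hf

lemma blind_occTot (x : Lattice) : Blind (occTot x) :=
  ⟨⟨{x}, fun η ξ h => by rw [occTot_eq, occTot_eq, h x (by simp)]⟩, fun η => by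
    rw [occTot_eq, occTot_eq, normCfg, Site.tot_norm]⟩

lemma blind_vac (x : Lattice) : Blind (fun η => 1 - occTot x η) := (blind_const 1).sub (blind_occTot x)

lemma Blind.dgrad {f : Config → ℝ} (hf : Blind f) (x y : Lattice) : Blind (dgrad x y f) :=
  ((blind_occTot x).mul (blind_vac y)).mul (hf.ugrad x y)

lemma normCfg_update (η : Config) (x : Lattice) (s : Site) :
    normCfg (Function.update η x s) = Function.update (normCfg η) x s.norm := by
  funext y
  by_cases h : y = x
  · subst h; simp [normCfg]
  · simp [normCfg, h]

lemma Blind.update {f : Config → ℝ} (hf : Blind f) (x : Lattice) {s : Site} (hs : s.norm = s) :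
    Blind (fun η => f (Function.update η x s)) := by
  obtain ⟨A, hA⟩ := hf.loc
  refine ⟨⟨A, fun η ξ h => hA fun y hy => ?_⟩, fun η => ?_⟩
  · by_cases h' : y = x
    · subst h'; simp
    · simpa [h'] using h y hy
  · rw [← hf.norm (Function.update η x s), normCfg_update, hs]

lemma Blind.occInv {f : Config → ℝ} (hf : Blind f) (x : Lattice) : OccInv x f := by
  intro η hη
  rw [← hf.norm, normCfg_update, ← hf.norm η, Site.norm_refParticle, ← Site.norm_of_ne hη]
  congr 1
  exact Function.update_eq_self x (normCfg η)

/-- A blind local function factors through the finite set of occupation patterns on its support, so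
measurability and boundedness are automatic. -/
lemma Blind.nice {f : Config → ℝ} (hf : Blind f) : Nice f := by
  classical
  obtain ⟨A, hA⟩ := hf.loc
  let ext : (A → Bool) → Config := fun b y =>
    if h : y ∈ A then (if b ⟨y, h⟩ then refParticle else Site.empty) else Site.empty
  let occ : Config → A → Bool := fun η a => decide ((η a).tot = 1)
  have hocc : Measurable occ := measurable_pi_iff.2 fun a => by
    refine measurable_to_bool ?_
    have : (fun η : Config => occ η a) ⁻¹' {true} = (fun η : Config => (η a).tot) ⁻¹' {1} := by
      ext η; simp [occ]
    rw [this]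
    exact (siteFn_tot.nice a).meas (measurableSet_singleton 1)
  have key : f = (fun b => f (ext b)) ∘ occ := by
    funext η
    rw [← hf.norm η]
    refine hA fun y hy => ?_
    have hy' : y ∈ A := hy
    cases h : η y <;> simp [ext, occ, hy', normCfg, h, Site.norm]
  refine ⟨?_, ?_, hf.loc⟩
  · rw [key]
    exact (measurable_of_countable _).comp hocc
  · refine ⟨∑ b, |f (ext b)|, fun η => ?_⟩
    have : f η = f (ext (occ η)) := congrFun key η
    rw [this]
    exact Finset.single_le_sum (f := fun b => |f (ext b)|) (fun b _ => abs_nonneg _)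
      (Finset.mem_univ (occ η))

lemma Blind.split {f : Config → ℝ} (hf : Blind f) (x : Lattice) (η : Config) :
    f η = (η x).tot * f (Function.update η x refParticle)
      + (1 - (η x).tot) * f (Function.update η x Site.empty) := by
  by_cases h : η x = Site.empty
  · have : Function.update η x Site.empty = η := by rw [← h, Function.update_eq_self]
    simp [h, this]
  · rw [Site.tot_of_ne h, hf.occInv x η h]; ring

lemma E_blind_split (α : GCParam) {f : Config → ℝ} (hf : Blind f) (x : Lattice) :
    α.E f = α.total * α.E (fun η => f (Function.update η x refParticle))
      + (1 - α.total) * α.E (fun η => f (Function.update η x Site.empty)) := by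
  have h1 : Nice fun η => f (Function.update η x refParticle) := hf.nice.update _ _
  have h2 : Nice fun η => f (Function.update η x Site.empty) := hf.nice.update _ _
  have e1 := E_mul_of_update α siteFn_tot (x := x) h1 (fun η s => by simp)
  have e2 := E_mul_of_update α siteFn_tot (x := x) h2 (fun η s => by simp)
  rw [mean_tot] at e1 e2
  have : f = fun η => ((η x).tot * f (Function.update η x refParticle)
      + f (Function.update η x Site.empty)) - (η x).tot * f (Function.update η x Site.empty) := by
    funext η; rw [hf.split x η]; ring
  conv_lhs => rw [this]
  rw [E_sub α (((siteFn_tot.nice x).mul h1).add h2) ((siteFn_tot.nice x).mul h2),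
    E_add α ((siteFn_tot.nice x).mul h1) h2, e1, e2]
  ring

/-- Conditioning on the sites of the support one by one uses only the total density. This allows the
measure `ofDensity` in the definition of `ds` to be exchanged for the given one. -/
lemma E_blind_congr {α β : GCParam} (h : α.total = β.total) {f : Config → ℝ} (hf : Blind f) :
    α.E f = β.E f := by
  classical
  have key : ∀ (A : Finset Lattice) (f : Config → ℝ), Blind f →
      DependsOn f (A : Set Lattice) → α.E f = β.E f := by
    intro A
    induction A using Finset.induction_on with
    | empty =>
      intro f _ hd
      have : f = fun _ => f (fun _ => Site.empty) := by
        funext η; exact hd fun x hx => by simp at hx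
      rw [this, E_const, E_const]
    | insert a A ha ih =>
      intro f hf hd
      have hu : ∀ s, DependsOn (fun η => f (Function.update η a s)) (A : Set Lattice) := by
        intro s η ξ hηξ
        refine hd fun y hy => ?_
        by_cases hya : y = a
        · subst hya; simp
        · have : y ∈ A := by simpa [hya] using hy
          simpa [hya] using hηξ y this
      rw [E_blind_split α hf a, E_blind_split β hf a, h,
        ih _ (hf.update a Site.norm_refParticle) (hu _),
        ih _ (hf.update a Site.norm_empty) (hu _)]
  obtain ⟨A, hA⟩ := hf.loc
  exact key A f hf hA

/-! ### Gradients of formal sums of translates -/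

lemma e_ne_zero (i : Fin 2) : e i ≠ 0 := by
  intro h
  have := congrFun h i
  simp [e] at this

lemma add_e_ne (y : Lattice) (i : Fin 2) : y + e i ≠ y := by simpa using e_ne_zero i

lemma shift_shift (x y : Lattice) (f : Config → ℝ) : shift y (shift x f) = shift (x + y) f := by
  funext η; simp only [shift, add_assoc]

lemma shift_zero (f : Config → ℝ) : shift 0 f = f := by
  funext η; simp [shift]

lemma shift_ugrad (x a b : Lattice) (f : Config → ℝ) :
    shift x (ugrad a b f) = ugrad (a + x) (b + x) (shift x f) := by
  funext η
  simp only [shift, ugrad, exch]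
  congr 2
  funext y
  simp only [Function.comp]
  congr 1
  by_cases h1 : y = a
  · subst h1; simp
  · by_cases h2 : y = b
    · subst h2; simp
    · rw [Equiv.swap_apply_of_ne_of_ne h1 h2, Equiv.swap_apply_of_ne_of_ne] <;> simpa

lemma ugrad_eq_zero {f : Config → ℝ} {A : Finset Lattice} (hA : DependsOn f (A : Set Lattice))
    {a b : Lattice} (ha : a ∉ A) (hb : b ∉ A) (η : Config) : ugrad a b f η = 0 := by
  rw [ugrad, sub_eq_zero]
  refine hA fun y hy => ?_
  have h1 : y ≠ a := fun h => ha (h ▸ hy)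
  have h2 : y ≠ b := fun h => hb (h ▸ hy)
  simp [exch, Equiv.swap_apply_of_ne_of_ne h1 h2]

lemma dependsOn_shift {f : Config → ℝ} {A : Finset Lattice} (hA : DependsOn f (A : Set Lattice))
    (x : Lattice) : DependsOn (shift x f) ((A.map (Equiv.addRight x).toEmbedding : Finset Lattice) :
      Set Lattice) := by
  intro η ξ h
  exact hA fun y hy => h _ (by simpa using hy)

lemma exists_ugrad_shift_eq_zero {f : Config → ℝ} (hf : Nice f) (a b : Lattice) :
    ∃ X : Finset Lattice, ∀ x ∉ X, ∀ η, ugrad a b (shift x f) η = 0 := by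
  classical
  obtain ⟨A, hA⟩ := hf.loc
  refine ⟨A.image (fun z => a - z) ∪ A.image (fun z => b - z), fun x hx η => ?_⟩
  simp only [Finset.mem_union, Finset.mem_image, not_or, not_exists, not_and] at hx
  refine ugrad_eq_zero (dependsOn_shift hA x) ?_ ?_ η
  · intro h
    simp only [Finset.mem_map, Equiv.coe_toEmbedding, Equiv.coe_addRight] at h
    obtain ⟨z, hz, h⟩ := h
    exact hx.1 z hz (by rw [← h]; abel)
  · intro h
    simp only [Finset.mem_map, Equiv.coe_toEmbedding, Equiv.coe_addRight] at h
    obtain ⟨z, hz, h⟩ := h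
    exact hx.2 z hz (by rw [← h]; abel)

lemma finsum_eq_sum_of_zero {ι M : Type*} [AddCommMonoid M] {f : ι → M} {X : Finset ι}
    (h : ∀ x ∉ X, f x = 0) : ∑ᶠ x, f x = ∑ x ∈ X, f x :=
  finsum_eq_sum_of_support_subset f fun x hx => by
    by_contra hx'
    exact hx (h x hx')

/-- The gradient of `∑_x τ_x f` along the edge from `0` to `e i`. -/
def tgrad (i : Fin 2) (f : Config → ℝ) : Config → ℝ :=
  fun η => ∑ᶠ x : Lattice, ugrad 0 (e i) (shift x f) η

lemma tgrad_eq_sum {f : Config → ℝ} {i : Fin 2} {X : Finset Lattice}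
    (hX : ∀ x ∉ X, ∀ η, ugrad 0 (e i) (shift x f) η = 0) :
    tgrad i f = fun η => ∑ x ∈ X, ugrad 0 (e i) (shift x f) η := by
  funext η
  exact finsum_eq_sum_of_zero fun x hx => hX x hx η

lemma Nice.tgrad {f : Config → ℝ} (hf : Nice f) (i : Fin 2) : Nice (tgrad i f) := by
  obtain ⟨X, hX⟩ := exists_ugrad_shift_eq_zero hf 0 (e i)
  rw [tgrad_eq_sum hX]
  exact Nice.sum X fun x _ => (hf.shift x).ugrad _ _

lemma tgrad_add {f g : Config → ℝ} (hf : Nice f) (hg : Nice g) (i : Fin 2) :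
    tgrad i (fun η => f η + g η) = fun η => tgrad i f η + tgrad i g η := by
  classical
  obtain ⟨X, hX⟩ := exists_ugrad_shift_eq_zero hf 0 (e i)
  obtain ⟨Y, hY⟩ := exists_ugrad_shift_eq_zero hg 0 (e i)
  have h : ∀ x η, ugrad 0 (e i) (shift x fun η => f η + g η) η
      = ugrad 0 (e i) (shift x f) η + ugrad 0 (e i) (shift x g) η := by
    intro x η; simp only [ugrad, shift]; ring
  rw [tgrad_eq_sum (X := X ∪ Y), tgrad_eq_sum (X := X ∪ Y) (f := f),
    tgrad_eq_sum (X := X ∪ Y) (f := g)]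
  · funext η
    simp only [h, Finset.sum_add_distrib]
  · intro x hx; exact hY x fun h => hx (Finset.mem_union_right _ h)
  · intro x hx; exact hX x fun h => hx (Finset.mem_union_left _ h)
  · intro x hx η
    rw [h, hX x fun h => hx (Finset.mem_union_left _ h),
      hY x fun h => hx (Finset.mem_union_right _ h), add_zero]

lemma tgrad_const_mul (c : ℝ) (f : Config → ℝ) (i : Fin 2) :
    tgrad i (fun η => c * f η) = fun η => c * tgrad i f η := by
  funext η
  simp only [tgrad, mul_finsum]
  refine finsum_congr fun x => ?_
  simp only [ugrad, shift]; ring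

lemma tgrad_zero (i : Fin 2) : tgrad i (fun _ => 0) = fun _ => 0 := by
  simpa using tgrad_const_mul 0 (fun _ => 0) i

/-- The formal sum of translates does not see a translation of its summand, so a generator `v(η_x)
F` of `classT` may be recentred at the origin. -/
lemma tgrad_shift (x : Lattice) (f : Config → ℝ) (i : Fin 2) :
    tgrad i (shift x f) = tgrad i f := by
  funext η
  simp only [tgrad, shift_shift]
  exact finsum_comp_equiv (Equiv.addLeft x) (f := fun y => ugrad 0 (e i) (shift y f) η)

/-! ### Integration by parts -/

lemma exch_comm (a b : Lattice) (η : Config) : exch a b η = exch b a η := by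
  rw [exch, exch, Equiv.swap_comm]

lemma exch_exch (a b : Lattice) (η : Config) : exch a b (exch a b η) = η := by
  funext x; simp [exch]

lemma exch_left (a b : Lattice) (η : Config) : exch a b η a = η b := by simp [exch]

lemma exch_right (a b : Lattice) (η : Config) : exch a b η b = η a := by simp [exch]

lemma exch_of_ne {a b x : Lattice} (ha : x ≠ a) (hb : x ≠ b) (η : Config) :
    exch a b η x = η x := by simp [exch, Equiv.swap_apply_of_ne_of_ne ha hb]

/-- The current associated with a site function. -/
def curr (v : Site → ℝ) (i : Fin 2) : Config → ℝ := fun η =>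
  v (η 0) * (1 - occTot (e i) η) - v (η (e i)) * (1 - occTot 0 η)

/-- The gradient associated with a site function. -/
def lgrad (v : Site → ℝ) (i : Fin 2) : Config → ℝ := fun η => v (η (e i)) - v (η 0)

lemma nice_curr {v : Site → ℝ} (hv : SiteFn v) (i : Fin 2) : Nice (curr v i) :=
  ((hv.nice _).mul (nice_vac _)).sub ((hv.nice _).mul (nice_vac _))

lemma nice_lgrad {v : Site → ℝ} (hv : SiteFn v) (i : Fin 2) : Nice (lgrad v i) :=
  (hv.nice _).sub (hv.nice _)

section
variable (α : GCParam)

/-- The two halves of the current are images of each other under the exchange of `0` and `e i`,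
which preserves the measure; the exchange is transferred to `K`. -/
lemma E_curr_mul {v : Site → ℝ} (hv : SiteFn v) (i : Fin 2) {K : Config → ℝ} (hK : Nice K) :
    α.E (fun η => curr v i η * K η) = -α.E (fun η => v (η 0) * dgrad 0 (e i) K η) := by
  have h1 : Nice fun η => v (η 0) * (1 - occTot (e i) η) * K η :=
    ((hv.nice _).mul (nice_vac _)).mul hK
  have h2 : Nice fun η => v (η (e i)) * (1 - occTot 0 η) * K η :=
    ((hv.nice _).mul (nice_vac _)).mul hK
  have e2 := E_exch α h2 0 (e i)
  have h3 : Nice fun η => v (exch 0 (e i) η (e i)) * (1 - occTot 0 (exch 0 (e i) η)) *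
      K (exch 0 (e i) η) := h2.comp_exch 0 (e i)
  calc α.E (fun η => curr v i η * K η)
      = α.E (fun η => v (η 0) * (1 - occTot (e i) η) * K η
          - v (η (e i)) * (1 - occTot 0 η) * K η) := by
        congr 1; funext η; simp only [curr]; ring
    _ = α.E (fun η => v (η 0) * (1 - occTot (e i) η) * K η
          - v (exch 0 (e i) η (e i)) * (1 - occTot 0 (exch 0 (e i) η)) * K (exch 0 (e i) η)) := by
        rw [E_sub α h1 h2, E_sub α h1 h3, e2]
    _ = -α.E (fun η => v (η 0) * dgrad 0 (e i) K η) := by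
        rw [← E_neg]
        congr 1; funext η
        have := hv.mul_tot (η 0)
        simp only [occTot_eq, exch_left, exch_right, dgrad, ugrad]
        linear_combination (-(1 - (η (e i)).tot) * K η + (1 - (η (e i)).tot) * K (exch 0 (e i) η))
          * this

/-- Reversibility of the dynamics on a single edge, with the two jump directions grouped together.
-/
lemma E_dgrad_mul {a b : Lattice} {g K : Config → ℝ} (hg : Nice g) (hK : Nice K) :
    α.E (fun η => (dgrad a b g η + dgrad b a g η) * K η)
      = -α.E (fun η => ugrad a b g η * dgrad a b K η) := by
  have h1 : Nice fun η => dgrad a b g η * K η := (hg.dgrad a b).mul hK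
  have h2 : Nice fun η => dgrad b a g η * K η := (hg.dgrad b a).mul hK
  have e2 := E_exch α h2 a b
  calc α.E (fun η => (dgrad a b g η + dgrad b a g η) * K η)
      = α.E (fun η => dgrad a b g η * K η + dgrad b a g η * K η) := by
        congr 1; funext η; ring
    _ = α.E (fun η => dgrad a b g η * K η
          + dgrad b a g (exch a b η) * K (exch a b η)) := by
        rw [E_add α h1 h2, E_add α h1 (h2.comp_exch a b), e2]
    _ = -α.E (fun η => ugrad a b g η * dgrad a b K η) := by
        rw [← E_neg]
        congr 1; funext η
        simp only [occTot_eq, exch_left, exch_right, dgrad, ugrad, exch_comm b a, exch_exch]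
        ring

/-- A family of local functions whose formal sum has the gradient `shift y (U i)` along the edge
from `y` to `y + e i`. -/
structure GradFamily (K : Lattice → Config → ℝ) (U : Fin 2 → Config → ℝ) : Prop where
  nice : ∀ x, Nice (K x)
  niceU : ∀ i, Nice (U i)
  fin : ∀ y i, ∃ X : Finset Lattice, ∀ x ∉ X, ∀ η, ugrad y (y + e i) (K x) η = 0
  sum : ∀ y i η, ∑ᶠ x, dgrad y (y + e i) (K x) η = shift y (U i) η

/-- `∑_x E[φ K_x] = r`, with finitely many non-zero terms. -/
def PairSum (φ : Config → ℝ) (K : Lattice → Config → ℝ) (r : ℝ) : Prop :=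
  (Function.support fun x => α.E fun η => φ η * K x η).Finite ∧
    ∑ᶠ x, α.E (fun η => φ η * K x η) = r

variable {α}

/-! ### Pairings of currents, gradients and generator terms with formal sums -/

lemma PairSum.of_sum {φ : Config → ℝ} {K : Lattice → Config → ℝ} {r : ℝ} {X : Finset Lattice}
    (h0 : ∀ x ∉ X, α.E (fun η => φ η * K x η) = 0)
    (hr : ∑ x ∈ X, α.E (fun η => φ η * K x η) = r) : PairSum α φ K r := by
  refine ⟨X.finite_toSet.subset fun x hx => ?_, ?_⟩
  · by_contra hx'
    exact hx (h0 x hx')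
  · rw [finsum_eq_sum_of_zero h0, hr]

lemma PairSum.add {φ ψ : Config → ℝ} {K : Lattice → Config → ℝ} {r s : ℝ}
    (hφ : Nice φ) (hψ : Nice ψ) (hK : ∀ x, Nice (K x))
    (h1 : PairSum α φ K r) (h2 : PairSum α ψ K s) :
    PairSum α (fun η => φ η + ψ η) K (r + s) := by
  have h : (fun x => α.E fun η => (φ η + ψ η) * K x η)
      = fun x => α.E (fun η => φ η * K x η) + α.E (fun η => ψ η * K x η) := by
    funext x
    rw [← E_add α (hφ.mul (hK x)) (hψ.mul (hK x))]
    congr 1; funext η; ring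
  refine ⟨?_, ?_⟩
  · rw [h]
    exact (h1.1.union h2.1).subset (Function.support_add _ _)
  · rw [h, finsum_add_distrib h1.1 h2.1, h1.2, h2.2]

lemma PairSum.const_mul {φ : Config → ℝ} {K : Lattice → Config → ℝ} {r : ℝ} (c : ℝ)
    (h1 : PairSum α φ K r) : PairSum α (fun η => c * φ η) K (c * r) := by
  have h : (fun x => α.E fun η => c * φ η * K x η)
      = fun x => c * α.E (fun η => φ η * K x η) := by
    funext x
    rw [← E_const_mul]
    congr 1; funext η; ring
  refine ⟨?_, ?_⟩
  · rw [h]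
    exact h1.1.subset fun x hx => right_ne_zero_of_mul hx
  · rw [h, ← mul_finsum, h1.2]

variable {K : Lattice → Config → ℝ} {U : Fin 2 → Config → ℝ}

lemma GradFamily.sum_finset (hF : GradFamily K U) {y : Lattice} {i : Fin 2} {X : Finset Lattice}
    (hX : ∀ x ∉ X, ∀ η, ugrad y (y + e i) (K x) η = 0) (η : Config) :
    ∑ x ∈ X, dgrad y (y + e i) (K x) η = shift y (U i) η := by
  rw [← hF.sum, finsum_eq_sum_of_zero]
  intro x hx
  simp [dgrad, hX x hx]

lemma pairSum_curr {v : Site → ℝ} (hv : SiteFn v) (i : Fin 2) (hF : GradFamily K U) :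
    PairSum α (curr v i) K (-α.E (fun η => v (η 0) * U i η)) := by
  obtain ⟨X, hX⟩ := hF.fin 0 i
  have hs := hF.sum_finset hX
  rw [zero_add] at hX
  simp only [zero_add, shift_zero] at hs
  refine PairSum.of_sum (X := X) (fun x hx => ?_) ?_
  · rw [E_curr_mul α hv i (hF.nice x)]
    simp [dgrad, hX x hx, E_const]
  · simp only [fun x => E_curr_mul α hv i (hF.nice x), Finset.sum_neg_distrib]
    rw [← E_sum α X fun x _ => (hv.nice 0).mul ((hF.nice x).dgrad _ _)]
    simp only [← Finset.mul_sum, hs]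

lemma exists_gen_eq_sum {g : Config → ℝ} (hg : Nice g) :
    ∃ Z : Finset Lattice, (∀ y ∉ Z, ∀ i η, ugrad y (y + e i) g η = 0) ∧
      gen g = fun η => ∑ y ∈ Z, ∑ i, (dgrad y (y + e i) g η + dgrad (y + e i) y g η) := by
  classical
  obtain ⟨A, hA⟩ := hg.loc
  let Z : Finset Lattice := A ∪ Finset.univ.biUnion (fun i => A.image (· - e i))
    ∪ Finset.univ.biUnion (fun i => A.image (· + e i))
  have hZ : ∀ y ∉ Z, y ∉ A ∧ ∀ i, y + e i ∉ A ∧ y - e i ∉ A := by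
    intro y hy
    simp only [Z, Finset.mem_union, Finset.mem_biUnion, Finset.mem_image, Finset.mem_univ,
      true_and, not_or, not_exists, not_and] at hy
    exact ⟨hy.1.1, fun i => ⟨fun h => hy.1.2 i _ h (by abel), fun h => hy.2 i _ h (by abel)⟩⟩
  have h1 : ∀ y ∉ Z, ∀ i η, ugrad y (y + e i) g η = 0 := fun y hy i η =>
    ugrad_eq_zero hA (hZ y hy).1 ((hZ y hy).2 i).1 η
  have h2 : ∀ y ∉ Z, ∀ i η, ugrad (y + e i) y g η = 0 := fun y hy i η =>
    ugrad_eq_zero hA ((hZ y hy).2 i).1 (hZ y hy).1 η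
  have h3 : ∀ y ∉ Z, ∀ i η, ugrad y (y - e i) g η = 0 := fun y hy i η =>
    ugrad_eq_zero hA (hZ y hy).1 ((hZ y hy).2 i).2 η
  refine ⟨Z, h1, ?_⟩
  funext η
  -- Jumps in the direction `-e i` are re-indexed by their arrival site, so that each edge appears
  -- once with both of its orientations.
  have hr : ∀ i, ∑ y ∈ Z, dgrad y (y - e i) g η = ∑ y ∈ Z, dgrad (y + e i) y g η := by
    intro i
    rw [← finsum_eq_sum_of_zero (X := Z) (f := fun y => dgrad y (y - e i) g η)
        fun y hy => by simp [dgrad, h3 y hy],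
      ← finsum_eq_sum_of_zero (X := Z) (f := fun y => dgrad (y + e i) y g η)
        fun y hy => by simp [dgrad, h2 y hy],
      ← finsum_comp_equiv (Equiv.addRight (e i))]
    simp
  rw [gen, finsum_eq_sum_of_zero (X := Z)]
  · rw [Finset.sum_comm]
    conv_rhs => rw [Finset.sum_comm]
    simp only [Finset.sum_add_distrib, hr]
  · intro y hy
    simp [dgrad, h1 y hy, h3 y hy]

lemma Nice.gen {g : Config → ℝ} (hg : Nice g) : Nice (gen g) := by
  obtain ⟨Z, -, h⟩ := exists_gen_eq_sum hg
  rw [h]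
  exact Nice.sum Z fun y _ => Nice.sum _ fun i _ => (hg.dgrad _ _).add (hg.dgrad _ _)

lemma ugrad_eq_shift (y : Lattice) (i : Fin 2) (g : Config → ℝ) :
    ugrad y (y + e i) g = shift y (ugrad 0 (e i) (shift (-y) g)) := by
  rw [shift_ugrad, shift_shift, neg_add_cancel, shift_zero, zero_add, add_comm]

/-- Summation by parts edge by edge; translation invariance then carries every edge to the one from
`0` to `e i`, and the translations applied to `g` add up to `tgrad i g`. -/
lemma pairSum_gen {g : Config → ℝ} (hg : Nice g) (hF : GradFamily K U) :
    PairSum α (gen g) K (-∑ i, α.E (fun η => tgrad i g η * U i η)) := by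
  classical
  obtain ⟨Z, hZ, hgen⟩ := exists_gen_eq_sum hg
  choose X hX using hF.fin
  let Y : Finset Lattice := Z.biUnion fun y => Finset.univ.biUnion fun i => X y i
  have hY : ∀ y ∈ Z, ∀ i, ∀ x ∉ Y, ∀ η, ugrad y (y + e i) (K x) η = 0 := by
    intro y hy i x hx
    refine hX y i x fun h => hx ?_
    exact Finset.mem_biUnion.2 ⟨y, hy, Finset.mem_biUnion.2 ⟨i, Finset.mem_univ _, h⟩⟩
  have hE : ∀ x, α.E (fun η => gen g η * K x η)
      = ∑ y ∈ Z, ∑ i, -α.E (fun η => ugrad y (y + e i) g η * dgrad y (y + e i) (K x) η) := by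
    intro x
    simp only [← fun y i => E_dgrad_mul α (a := y) (b := y + e i) hg (hF.nice x)]
    simp only [hgen, Finset.sum_mul]
    rw [E_sum α Z fun y _ => Nice.sum _ fun i _ =>
      ((hg.dgrad _ _).add (hg.dgrad _ _)).mul (hF.nice x)]
    refine Finset.sum_congr rfl fun y _ => ?_
    rw [E_sum α _ fun i _ => ((hg.dgrad _ _).add (hg.dgrad _ _)).mul (hF.nice x)]
  refine PairSum.of_sum (X := Y) (fun x hx => ?_) ?_
  · rw [hE]
    refine Finset.sum_eq_zero fun y hy => Finset.sum_eq_zero fun i _ => ?_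
    simp [dgrad, hY y hy i x hx, E_const]
  · simp only [hE]
    rw [Finset.sum_comm]
    have h1 : ∀ y ∈ Z, ∑ x ∈ Y, ∑ i, -α.E (fun η => ugrad y (y + e i) g η *
        dgrad y (y + e i) (K x) η)
        = ∑ i, -α.E (fun η => ugrad 0 (e i) (shift (-y) g) η * U i η) := by
      intro y hy
      rw [Finset.sum_comm]
      refine Finset.sum_congr rfl fun i _ => ?_
      rw [Finset.sum_neg_distrib, ← E_sum α Y fun x _ => (hg.ugrad _ _).mul ((hF.nice x).dgrad _ _)]
      simp only [← Finset.mul_sum, hF.sum_finset (hY y hy i)]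
      rw [ugrad_eq_shift, ← E_shift α (((hg.shift _).ugrad _ _).mul (hF.niceU i)) y]
      rfl
    rw [Finset.sum_congr rfl h1, Finset.sum_comm, ← Finset.sum_neg_distrib]
    refine Finset.sum_congr rfl fun i _ => ?_
    rw [Finset.sum_neg_distrib,
      ← E_sum α Z fun y _ => ((hg.shift _).ugrad _ _).mul (hF.niceU i)]
    rw [tgrad_eq_sum (X := Z.map (Equiv.neg Lattice).toEmbedding)]
    · simp only [← Finset.sum_mul, Finset.sum_map]
      rfl
    · intro x hx η
      have hx' : -x ∉ Z := fun h => hx (by simpa using h)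
      have := hZ (-x) hx' i
      rw [ugrad_eq_shift, neg_neg] at this
      have h2 := this (fun z => η (z + x))
      simpa [shift] using h2

lemma gradFamily_shift {h : Config → ℝ} (hh : Nice h) :
    GradFamily (fun x => shift x h)
      (fun i η => occTot 0 η * (1 - occTot (e i) η) * tgrad i h η) where
  nice x := hh.shift x
  niceU i := ((nice_occTot _).mul (nice_vac _)).mul (hh.tgrad i)
  fin y i := exists_ugrad_shift_eq_zero hh _ _
  sum y i η := by
    simp only [dgrad, ← mul_finsum]
    simp only [shift, occTot_eq, zero_add, add_comm (e i) y]
    congr 1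
    simp only [tgrad]
    rw [← finsum_comp_equiv (Equiv.addRight y)]
    refine finsum_congr fun x => ?_
    change ugrad y (y + e i) (shift (x + y) h) η = shift y (ugrad 0 (e i) (shift x h)) η
    rw [ugrad_eq_shift, shift_shift, add_neg_cancel_right]

/-- A particle jumping from `y` to `y + e i` raises `∑_x x_k v(η_x)` by `v(η_y)` when `i = k` and
leaves it unchanged otherwise. -/
lemma gradFamily_linear {v : Site → ℝ} (hv : SiteFn v) (k : Fin 2) :
    GradFamily (fun x η => (x k : ℝ) * v (η x))
      (fun i η => if i = k then v (η 0) * (1 - occTot (e i) η) else 0) where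
  nice x := (hv.nice x).const_mul _
  niceU i := by
    by_cases h : i = k
    · simpa only [h, if_true] using (hv.nice 0).mul (nice_vac (e k))
    · simpa [h] using nice_const 0
  fin y i := by
    classical
    refine ⟨{y, y + e i}, fun x hx η => ?_⟩
    simp only [Finset.mem_insert, Finset.mem_singleton, not_or] at hx
    simp [ugrad, exch_of_ne hx.1 hx.2]
  sum y i η := by
    classical
    rw [finsum_eq_sum_of_zero (X := {y, y + e i})]
    · rw [Finset.sum_pair (add_e_ne y i).symm]
      have h1 := hv.mul_one_sub_tot (η (y + e i))
      have h2 := hv.mul_tot (η y)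
      simp only [dgrad, ugrad, exch_left, exch_right, shift, occTot_eq, zero_add, add_comm (e i) y]
      by_cases h : i = k
      · subst h
        simp only [Pi.add_apply, if_true]
        have : e i i = 1 := by simp [e]
        rw [this]
        push_cast
        linear_combination (-(η y).tot) * h1 + (1 - (η (y + e i)).tot) * h2
      · have : e i k = 0 := by simp [e, Ne.symm h]
        simp only [Pi.add_apply, this, h, if_false]
        push_cast
        ring
    · intro x hx
      simp only [Finset.mem_insert, Finset.mem_singleton, not_or] at hx
      simp [dgrad, ugrad, exch_of_ne hx.1 hx.2]

/-- Local gradients are differences of translates of one observable, so they telescope to zero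
against a translation-invariant sum. -/
lemma pairSum_lgrad_shift {v : Site → ℝ} (hv : SiteFn v) (i : Fin 2) {h : Config → ℝ}
    (hh : Nice h) : PairSum α (lgrad v i) (fun x => shift x h) 0 := by
  classical
  obtain ⟨A, hA⟩ := hh.loc
  set C : ℝ := α.mean v * α.E h
  -- The expectations alone tend to the constant `C`, in fact equal it for distant `x`. Subtracting
  -- it makes `w` finitely supported, so the difference of its two translates may be summed term by
  -- term.
  set w : Lattice → ℝ := fun x => α.E (fun η => v (η 0) * shift x h η) - C
  have hw : (Function.support w).Finite := by
    refine (A.image fun z => -z).finite_toSet.subset fun x hx => ?_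
    by_contra hx'
    apply hx
    have hd := dependsOn_shift hA x
    have : ∀ (η : Config) s, shift x h (Function.update η 0 s) = shift x h η := by
      intro η s
      refine hd fun y hy => ?_
      have : y ≠ 0 := by
        rintro rfl
        simp only [Finset.coe_map, Set.mem_image, Finset.mem_coe] at hy
        obtain ⟨z, hz, hzx⟩ := hy
        apply hx'
        simp only [Finset.coe_image, Set.mem_image, Finset.mem_coe]
        exact ⟨z, hz, neg_eq_of_add_eq_zero_right hzx⟩
      simp [this]
    simp only [w]
    rw [E_mul_of_update α hv (hh.shift x) this, E_shift α hh, sub_self]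
  have key : (fun x => α.E fun η => lgrad v i η * shift x h η) = fun x => w (x - e i) - w x := by
    funext x
    have h1 : (fun η => lgrad v i η * shift x h η)
        = fun η => v (η (e i)) * shift x h η - v (η 0) * shift x h η := by
      funext η; simp only [lgrad]; ring
    have h2 : α.E (fun η => v (η (e i)) * shift x h η)
        = α.E (fun η => v (η 0) * shift (x - e i) h η) := by
      rw [← E_shift α ((hv.nice 0).mul (hh.shift (x - e i))) (e i)]
      congr 1
      funext η
      have : shift (e i) (shift (x - e i) h) η = shift x h η := by
        rw [shift_shift, sub_add_cancel]
      rw [← this]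
      simp [shift]
    rw [h1, E_sub α ((hv.nice _).mul (hh.shift x)) ((hv.nice _).mul (hh.shift x)), h2]
    simp only [w]; ring
  have hw' : (Function.support fun x => w (x - e i)).Finite :=
    hw.preimage (f := fun x => x - e i) (sub_left_injective.injOn)
  refine ⟨?_, ?_⟩
  · rw [key]
    exact (hw'.union hw).subset (Function.support_sub _ _)
  · rw [key, finsum_sub_distrib hw' hw, sub_eq_zero]
    exact finsum_comp_equiv (Equiv.subRight (e i)) (f := w)

lemma E_mul_ne {v w : Site → ℝ} (hv : SiteFn v) (hw : SiteFn w) {x y : Lattice} (h : x ≠ y) :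
    α.E (fun η => v (η x) * w (η y)) = α.mean v * α.mean w := by
  rw [E_mul_of_update α hv (hw.nice y) fun η s => by simp [h.symm], E_siteFn α hw]

/-- By independence, the covariances at `0` and at `e i` are the only possible contributions. The
weight `x_k` removes the one at `0`, leaving the static covariance when `i = k`. -/
lemma pairSum_lgrad_linear {v w : Site → ℝ} (hv : SiteFn v) (hw : SiteFn w) (i k : Fin 2) :
    PairSum α (lgrad v i) (fun x η => (x k : ℝ) * w (η x))
      (if i = k then α.mean (fun s => v s * w s) - α.mean v * α.mean w else 0) := by
  have key : ∀ x : Lattice, α.E (fun η => lgrad v i η * ((x k : ℝ) * w (η x)))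
      = (x k : ℝ) * (α.E (fun η => v (η (e i)) * w (η x)) - α.E (fun η => v (η 0) * w (η x))) := by
    intro x
    rw [← E_sub α ((hv.nice _).mul (hw.nice x)) ((hv.nice _).mul (hw.nice x)), ← E_const_mul]
    congr 1; funext η; simp only [lgrad]; ring
  have hx : ∀ x ∉ ({e i} : Finset Lattice),
      α.E (fun η => lgrad v i η * ((x k : ℝ) * w (η x))) = 0 := by
    intro x hx
    rw [key]
    simp only [Finset.mem_singleton] at hx
    by_cases h0 : x = 0
    · simp [h0]
    · rw [E_mul_ne hv hw (Ne.symm hx), E_mul_ne hv hw (Ne.symm h0)]; simp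
  refine PairSum.of_sum hx ?_
  rw [Finset.sum_singleton, key, E_mul_ne hv hw (e_ne_zero i).symm, E_siteFn α (hv.mul hw) (e i)]
  by_cases h : i = k
  · subst h; simp [e]
  · simp [e, h, Ne.symm h]

end

/-! ### The quadratic form of the tagged particle -/

/-- The increment of `f` under a jump of the tagged particle. -/
def tagGrad (z : Lattice) (f : Config → ℝ) : Config → ℝ :=
  fun η => shift z f (exch 0 z η) - f η

open Classical in
/-- The increment of `shift y f` under a jump from `0` to `z`, both different from `y`. -/
def envGrad (z y : Lattice) (f : Config → ℝ) : Config → ℝ :=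
  fun η => if y ≠ 0 ∧ y ≠ z then dgrad 0 z (shift y f) η else 0

/-- The density of the bilinear form of the tagged particle in the direction `z`. -/
def tagDensity (z : Lattice) (c : ℝ) (f : Config → ℝ) (c' : ℝ) (f' : Config → ℝ) : Config → ℝ :=
  fun η => (1 - occTot z η) * ((c + tagGrad z f η) * (c' + tagGrad z f' η))
    + ∑ᶠ y : Lattice, envGrad z y f η * envGrad z y f' η

/-- The bilinear form of the tagged particle. -/
def tagForm (α : GCParam) (c : Fin 2 → ℝ) (f : Config → ℝ) (c' : Fin 2 → ℝ) (f' : Config → ℝ) :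
    ℝ :=
  ∑ i, α.E (tagDensity (e i) (c i) f (c' i) f')

lemma Blind.tagGrad {f : Config → ℝ} (hf : Blind f) (z : Lattice) : Blind (tagGrad z f) :=
  ((hf.shift z).comp_exch 0 z).sub hf

lemma Blind.envGrad {f : Config → ℝ} (hf : Blind f) (z y : Lattice) : Blind (envGrad z y f) := by
  unfold APLG.envGrad
  by_cases h : y ≠ 0 ∧ y ≠ z
  · simpa only [if_pos h] using (hf.shift y).dgrad 0 z
  · simpa only [if_neg h] using blind_const 0

lemma exists_envGrad_eq_zero {f : Config → ℝ} (hf : Nice f) (z : Lattice) :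
    ∃ X : Finset Lattice, ∀ y ∉ X, ∀ η, envGrad z y f η = 0 := by
  obtain ⟨X, hX⟩ := exists_ugrad_shift_eq_zero hf 0 z
  exact ⟨X, fun y hy η => by simp [envGrad, dgrad, hX y hy]⟩

lemma tagDensity_eq_sum {z : Lattice} {f f' : Config → ℝ} {X : Finset Lattice}
    (hX : ∀ y ∉ X, ∀ η, envGrad z y f η = 0) (c c' : ℝ) (η : Config) :
    tagDensity z c f c' f' η = (1 - occTot z η) * ((c + tagGrad z f η) * (c' + tagGrad z f' η))
      + ∑ y ∈ X, envGrad z y f η * envGrad z y f' η := by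
  rw [tagDensity, finsum_eq_sum_of_zero fun y hy => by rw [hX y hy, zero_mul]]

lemma blind_tagDensity {f f' : Config → ℝ} (hf : Blind f) (hf' : Blind f') (z : Lattice)
    (c c' : ℝ) : Blind (tagDensity z c f c' f') := by
  obtain ⟨X, hX⟩ := exists_envGrad_eq_zero hf.nice z
  rw [funext (tagDensity_eq_sum (f' := f') hX c c')]
  exact ((blind_vac z).mul (((blind_const c).add (hf.tagGrad z)).mul
    ((blind_const c').add (hf'.tagGrad z)))).add
    (Blind.sum X fun y _ => (hf.envGrad z y).mul (hf'.envGrad z y))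

lemma tagDensity_comm (z : Lattice) (c : ℝ) (f : Config → ℝ) (c' : ℝ) (f' : Config → ℝ) :
    tagDensity z c f c' f' = tagDensity z c' f' c f := by
  funext η
  simp only [tagDensity, mul_comm (c + tagGrad z f η), mul_comm (envGrad z _ f η)]

lemma envGrad_add (z y : Lattice) (f g : Config → ℝ) (η : Config) :
    envGrad z y (fun η => f η + g η) η = envGrad z y f η + envGrad z y g η := by
  simp only [envGrad, dgrad, ugrad, shift]
  split_ifs <;> ring

lemma envGrad_const_mul (z y : Lattice) (t : ℝ) (f : Config → ℝ) (η : Config) :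
    envGrad z y (fun η => t * f η) η = t * envGrad z y f η := by
  simp only [envGrad, dgrad, ugrad, shift]
  split_ifs <;> ring

lemma tagDensity_add {f g : Config → ℝ} (hf : Blind f) (hg : Blind g) (z : Lattice)
    (c d c' : ℝ) (f' : Config → ℝ) (η : Config) :
    tagDensity z (c + d) (fun η => f η + g η) c' f' η
      = tagDensity z c f c' f' η + tagDensity z d g c' f' η := by
  classical
  obtain ⟨X, hX⟩ := exists_envGrad_eq_zero hf.nice z
  obtain ⟨Y, hY⟩ := exists_envGrad_eq_zero hg.nice z
  have hX' : ∀ y ∉ X ∪ Y, ∀ η, envGrad z y f η = 0 := fun y hy =>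
    hX y fun h => hy (Finset.mem_union_left _ h)
  have hY' : ∀ y ∉ X ∪ Y, ∀ η, envGrad z y g η = 0 := fun y hy =>
    hY y fun h => hy (Finset.mem_union_right _ h)
  have hXY : ∀ y ∉ X ∪ Y, ∀ η, envGrad z y (fun η => f η + g η) η = 0 := fun y hy η => by
    rw [envGrad_add, hX' y hy, hY' y hy, add_zero]
  rw [tagDensity_eq_sum hXY, tagDensity_eq_sum hX', tagDensity_eq_sum hY']
  simp only [envGrad_add, add_mul, Finset.sum_add_distrib, tagGrad, shift]
  ring

lemma tagDensity_const_mul (z : Lattice) (t c : ℝ) (f : Config → ℝ) (c' : ℝ) (f' : Config → ℝ)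
    (η : Config) :
    tagDensity z (t * c) (fun η => t * f η) c' f' η = t * tagDensity z c f c' f' η := by
  simp only [tagDensity, envGrad_const_mul, mul_assoc, ← mul_finsum, tagGrad, shift]
  ring

section
variable (α : GCParam)

lemma tagForm_comm (c : Fin 2 → ℝ) (f : Config → ℝ) (c' : Fin 2 → ℝ) (f' : Config → ℝ) :
    tagForm α c f c' f' = tagForm α c' f' c f := by
  simp only [tagForm, tagDensity_comm _ _ f]

lemma tagForm_add {f g f' : Config → ℝ} (hf : Blind f) (hg : Blind g) (hf' : Blind f')
    (c d c' : Fin 2 → ℝ) :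
    tagForm α (c + d) (fun η => f η + g η) c' f' = tagForm α c f c' f' + tagForm α d g c' f' := by
  rw [tagForm, tagForm, tagForm, ← Finset.sum_add_distrib]
  refine Finset.sum_congr rfl fun i _ => ?_
  rw [← E_add α (blind_tagDensity hf hf' _ _ _).nice (blind_tagDensity hg hf' _ _ _).nice]
  congr 1
  funext η
  exact tagDensity_add hf hg _ _ _ _ _ _

lemma tagForm_smul (t : ℝ) (c : Fin 2 → ℝ) (f : Config → ℝ) (c' : Fin 2 → ℝ) (f' : Config → ℝ) :
    tagForm α (t • c) (fun η => t * f η) c' f' = t * tagForm α c f c' f' := by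
  rw [tagForm, tagForm, Finset.mul_sum]
  refine Finset.sum_congr rfl fun i _ => ?_
  rw [← E_const_mul]
  congr 1
  funext η
  exact tagDensity_const_mul _ _ _ _ _ _ _

lemma tagForm_add_right {f g f' : Config → ℝ} (hf : Blind f) (hg : Blind g) (hf' : Blind f')
    (c d c' : Fin 2 → ℝ) :
    tagForm α c' f' (c + d) (fun η => f η + g η) = tagForm α c' f' c f + tagForm α c' f' d g := by
  rw [tagForm_comm, tagForm_add α hf hg hf', tagForm_comm α c, tagForm_comm α d]

lemma tagForm_smul_right (t : ℝ) (c : Fin 2 → ℝ) (f : Config → ℝ) (c' : Fin 2 → ℝ)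
    (f' : Config → ℝ) :
    tagForm α c' f' (t • c) (fun η => t * f η) = t * tagForm α c' f' c f := by
  rw [tagForm_comm, tagForm_smul, tagForm_comm]

lemma tagForm_add_smul {f g : Config → ℝ} (hf : Blind f) (hg : Blind g) (c d : Fin 2 → ℝ) (t : ℝ) :
    tagForm α (c + t • d) (fun η => f η + t * g η) (c + t • d) (fun η => f η + t * g η)
      = tagForm α c f c f + 2 * t * tagForm α c f d g + t ^ 2 * tagForm α d g d g := by
  have hg' := hg.const_mul t
  rw [tagForm_add α hf hg' (hf.add hg'), tagForm_add_right α hf hg' hf,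
    tagForm_add_right α hf hg' hg', tagForm_smul, tagForm_smul, tagForm_smul_right,
    tagForm_smul_right, tagForm_comm α d g c f]
  ring

lemma occTot_le_one (x : Lattice) (η : Config) : occTot x η ≤ 1 := by
  rw [occTot_eq]; cases η x <;> simp

lemma occTot_nonneg (x : Lattice) (η : Config) : 0 ≤ occTot x η := by
  rw [occTot_eq]; cases η x <;> simp

lemma tagDensity_self_nonneg (z : Lattice) (c : ℝ) (f : Config → ℝ) (η : Config) :
    0 ≤ tagDensity z c f c f η :=
  add_nonneg (mul_nonneg (sub_nonneg.2 (occTot_le_one _ _)) (mul_self_nonneg _))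
    (finsum_nonneg fun _ => mul_self_nonneg _)

lemma tagForm_self_nonneg (c : Fin 2 → ℝ) (f : Config → ℝ) : 0 ≤ tagForm α c f c f :=
  Finset.sum_nonneg fun _ _ => E_nonneg α fun η => tagDensity_self_nonneg _ _ _ η

/-- The discriminant of a non-negative quadratic polynomial; every Cauchy–Schwarz inequality below
is deduced from this. -/
lemma sq_le_mul_of_forall {a b c : ℝ} (h : ∀ t : ℝ, 0 ≤ a + 2 * t * b + t ^ 2 * c) :
    b ^ 2 ≤ a * c := by
  have := discrim_le_zero (a := c) (b := 2 * b) (c := a) fun t => by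
    have := h t; nlinarith
  rw [discrim] at this
  nlinarith

lemma tagForm_sq_le {f g : Config → ℝ} (hf : Blind f) (hg : Blind g) (c d : Fin 2 → ℝ) :
    tagForm α c f d g ^ 2 ≤ tagForm α c f c f * tagForm α d g d g :=
  sq_le_mul_of_forall fun t => by
    rw [← tagForm_add_smul α hf hg]
    exact tagForm_self_nonneg α _ _

end

/-! ### Symmetries -/

lemma exch_comp_addEquiv (S : Lattice ≃+ Lattice) (a b : Lattice) (η : Config) (y : Lattice) :
    exch (S a) (S b) η (S y) = exch a b (η ∘ S) y := by
  have h : Equiv.swap (S a) (S b) (S y) = S (Equiv.swap a b y) :=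
    (S.toEquiv.injective.map_swap a b y).symm
  simp [exch, h]

lemma tagDensity_comp_addEquiv (S : Lattice ≃+ Lattice) (z : Lattice) (c : ℝ) (f : Config → ℝ)
    (η : Config) :
    tagDensity (S z) c (fun ξ => f (ξ ∘ S)) c (fun ξ => f (ξ ∘ S)) η
      = tagDensity z c f c f (η ∘ S) := by
  have hs : ∀ (y : Lattice) (ξ : Config), shift (S y) (fun ξ => f (ξ ∘ S)) ξ = shift y f (ξ ∘ S) := by
    intro y ξ
    simp only [shift]
    congr 1
    funext x
    simp
  have hx : ∀ ξ : Config, exch 0 (S z) ξ ∘ S = exch 0 z (ξ ∘ S) := by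
    intro ξ
    funext y
    have := exch_comp_addEquiv S 0 z ξ y
    rw [map_zero] at this
    exact this
  have h1 : tagGrad (S z) (fun ξ => f (ξ ∘ S)) η = tagGrad z f (η ∘ S) := by
    simp only [tagGrad, hs, hx]
  have h2 : ∀ y, envGrad (S z) (S y) (fun ξ => f (ξ ∘ S)) η = envGrad z y f (η ∘ S) := by
    intro y
    have h0 : S 0 = 0 := map_zero S
    simp only [envGrad, dgrad, ugrad, hs, hx, occTot_eq, Function.comp, h0, ne_eq,
      EmbeddingLike.apply_eq_iff_eq, EmbeddingLike.map_eq_zero_iff]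
  simp only [tagDensity, h1, occTot_eq, Function.comp]
  rw [← finsum_comp_equiv S.toEquiv]
  simp only [AddEquiv.toEquiv_eq_coe, AddEquiv.coe_toEquiv, h2]

/-- The environment seen from the tagged particle after a jump to `z`. -/
def jumpPerm (z : Lattice) : Equiv.Perm Lattice := (Equiv.addRight z).trans (Equiv.swap 0 z)

lemma jumpPerm_apply (z y : Lattice) : jumpPerm z y = Equiv.swap 0 z (y + z) := rfl

lemma comp_jumpPerm_exch (z : Lattice) (η : Config) :
    exch 0 (-z) (η ∘ jumpPerm z) = fun y => η (y + z) := by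
  funext y
  simp only [exch, Function.comp, jumpPerm_apply]
  congr 1
  by_cases h0 : y = 0
  · subst h0; simp
  · by_cases h1 : y = -z
    · subst h1; simp
    · rw [Equiv.swap_apply_of_ne_of_ne h0 h1, Equiv.swap_apply_of_ne_of_ne]
      · intro h; exact h1 (eq_neg_of_add_eq_zero_left h)
      · intro h; exact h0 (by simpa using h)

/-- The configuration `η ∘ jumpPerm z` is the environment seen from the origin after the contents of
`0` and `z` are exchanged. The exchange along `-z` undoes this one, so every increment changes sign,
and so does the drift `c` once the overall sign is absorbed in the square. -/
lemma tagDensity_reverse (z : Lattice) (c : ℝ) (f : Config → ℝ) (η : Config) :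
    tagDensity (-z) c f c f (η ∘ jumpPerm z) = tagDensity z (-c) f (-c) f η := by
  have hj : ∀ y, (fun x => (η ∘ jumpPerm z) (x + y)) = fun x => exch 0 z η (x + (y + z)) := by
    intro y
    funext x
    simp [exch, jumpPerm_apply, add_assoc]
  have hx : ∀ y, (fun x => exch 0 (-z) (η ∘ jumpPerm z) (x + y)) = fun x => η (x + (y + z)) := by
    intro y
    rw [comp_jumpPerm_exch]
    simp [add_assoc]
  have hz : (η ∘ jumpPerm z) (-z) = η z := by simp [jumpPerm_apply]
  have h0 : (η ∘ jumpPerm z) 0 = η 0 := by simp [jumpPerm_apply]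
  have h1 : tagGrad (-z) f (η ∘ jumpPerm z) = -tagGrad z f η := by
    simp only [tagGrad, shift, hx]
    have : η ∘ jumpPerm z = fun x => exch 0 z η (x + z) := rfl
    rw [this]
    simp
  have h2 : ∀ y, envGrad (-z) y f (η ∘ jumpPerm z) = -envGrad z (y + z) f η := by
    intro y
    have hy : (y ≠ 0 ∧ y ≠ -z) ↔ (y + z ≠ 0 ∧ y + z ≠ z) := by
      rw [ne_eq, ne_eq, ne_eq, ne_eq, add_eq_zero_iff_eq_neg, add_eq_right, and_comm]
    simp only [envGrad, hy, dgrad, ugrad, shift, hj, hx, occTot_eq, hz, h0]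
    split_ifs <;> ring
  simp only [tagDensity, h1, h2, occTot_eq, hz]
  rw [← finsum_comp_equiv (Equiv.addRight z) (f := fun y => envGrad z y f η * envGrad z y f η)]
  simp only [Equiv.coe_addRight, neg_mul_neg]
  ring

section
variable (α : GCParam)

lemma E_tagDensity_addEquiv (S : Lattice ≃+ Lattice) (z : Lattice) (c : ℝ) {f : Config → ℝ}
    (hf : Blind f) :
    α.E (tagDensity (S z) c (fun ξ => f (ξ ∘ S)) c (fun ξ => f (ξ ∘ S)))
      = α.E (tagDensity z c f c f) := by
  rw [← E_perm α (blind_tagDensity hf hf z c c).nice S.toEquiv]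
  congr 1
  funext η
  exact tagDensity_comp_addEquiv S z c f η

lemma E_tagDensity_neg (z : Lattice) (c : ℝ) {f : Config → ℝ} (hf : Blind f) :
    α.E (tagDensity (-z) c f c f) = α.E (tagDensity z (-c) f (-c) f) := by
  rw [← E_perm α (blind_tagDensity hf hf (-z) c c).nice (jumpPerm z)]
  congr 1
  funext η
  exact tagDensity_reverse z c f η

/-- The reflection that changes the sign of the second coordinate. -/
def reflection : Lattice ≃+ Lattice where
  toFun x := ![x 0, -x 1]
  invFun x := ![x 0, -x 1]
  left_inv x := by ext i; fin_cases i <;> simp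
  right_inv x := by ext i; fin_cases i <;> simp
  map_add' x y := by ext i; fin_cases i <;> simp [add_comm]

/-- The exchange of the two coordinates. -/
def transposition : Lattice ≃+ Lattice where
  toFun x := ![x 1, x 0]
  invFun x := ![x 1, x 0]
  left_inv x := by ext i; fin_cases i <;> simp
  right_inv x := by ext i; fin_cases i <;> simp
  map_add' x y := by ext i; fin_cases i <;> simp

lemma reflection_e0 : reflection (e 0) = e 0 := by
  ext i; fin_cases i <;> simp [reflection, e]

lemma reflection_e1 : reflection (-e 1) = e 1 := by
  ext i; fin_cases i <;> simp [reflection, e]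

lemma transposition_e0 : transposition (e 0) = e 1 := by
  ext i; fin_cases i <;> simp [transposition, e]

lemma transposition_e1 : transposition (e 1) = e 0 := by
  ext i; fin_cases i <;> simp [transposition, e]

lemma tagForm_reflection (c : Fin 2 → ℝ) {f : Config → ℝ} (hf : Blind f) :
    tagForm α ![c 0, -c 1] (fun ξ => f (ξ ∘ reflection)) ![c 0, -c 1]
      (fun ξ => f (ξ ∘ reflection)) = tagForm α c f c f := by
  have h0 := E_tagDensity_addEquiv α reflection (e 0) (c 0) hf
  have h1 := E_tagDensity_addEquiv α reflection (-e 1) (-c 1) hf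
  rw [reflection_e0] at h0
  rw [reflection_e1, E_tagDensity_neg α _ _ hf, neg_neg] at h1
  simp only [tagForm, Fin.sum_univ_two]
  rw [← h0, ← h1]
  rfl

lemma tagForm_transposition (c : Fin 2 → ℝ) {f : Config → ℝ} (hf : Blind f) :
    tagForm α ![c 1, c 0] (fun ξ => f (ξ ∘ transposition)) ![c 1, c 0]
      (fun ξ => f (ξ ∘ transposition)) = tagForm α c f c f := by
  have h0 := E_tagDensity_addEquiv α transposition (e 0) (c 0) hf
  have h1 := E_tagDensity_addEquiv α transposition (e 1) (c 1) hf
  rw [transposition_e0] at h0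
  rw [transposition_e1] at h1
  simp only [tagForm, Fin.sum_univ_two]
  rw [← h0, ← h1, add_comm]
  rfl

/-! ### The self-diffusion coefficient -/

/-- The integrand is blind, hence only the total density of the measure matters. -/
lemma selfDiffusionForm_eq (x : Fin 2 → ℝ) :
    selfDiffusionForm α.total x = ⨅ f : blind, tagForm α x f.1 x f.1 := by
  unfold selfDiffusionForm
  congr 1
  funext f
  have hf := mem_blind_iff.1 f.2
  refine Finset.sum_congr rfl fun i _ => ?_
  rw [← E_blind_congr (total_ofDensity (total_nonneg α) (total_le_one α))
    (blind_tagDensity hf hf (e i) (x i) (x i))]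
  congr 1
  funext η
  simp only [tagDensity, envGrad, tagGrad, finsum_eq_if, ← sq]
  refine congrArg₂ (· + ·) (by ring) (finsum_congr fun y => ?_)
  split_ifs <;> simp

lemma ds_le {f : Config → ℝ} (hf : Blind f) :
    ds α.total ≤ tagForm α (Pi.single 0 1) f (Pi.single 0 1) f := by
  rw [ds, selfDiffusionForm_eq]
  exact ciInf_le (f := fun f : blind => tagForm α (Pi.single 0 1) f.1 (Pi.single 0 1) f.1)
    ⟨0, by rintro _ ⟨f, rfl⟩; exact tagForm_self_nonneg α _ _⟩ ⟨f, mem_blind_iff.2 hf⟩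

lemma exists_tagForm_lt_zero {δ : ℝ} (hδ : 0 < δ) :
    ∃ f, Blind f ∧ tagForm α (Pi.single 0 1) f (Pi.single 0 1) f < ds α.total + δ := by
  rw [ds, selfDiffusionForm_eq]
  have : Nonempty blind := ⟨⟨fun _ => 0, mem_blind_iff.2 (blind_const 0)⟩⟩
  obtain ⟨f, hf⟩ := exists_lt_of_ciInf_lt (lt_add_of_pos_right
    (⨅ f : blind, tagForm α (Pi.single 0 1) f.1 (Pi.single 0 1) f.1) hδ)
  exact ⟨f.1, mem_blind_iff.1 f.2, hf⟩

lemma exists_tagForm_lt (i : Fin 2) {δ : ℝ} (hδ : 0 < δ) :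
    ∃ f, Blind f ∧ tagForm α (Pi.single i 1) f (Pi.single i 1) f < ds α.total + δ := by
  obtain ⟨f, hf, h⟩ := exists_tagForm_lt_zero α hδ
  fin_cases i
  · exact ⟨f, hf, h⟩
  -- Exchanging the two coordinates turns a near-minimizer for `e 0` into one for `e 1`.
  · refine ⟨_, hf.comp_perm transposition.toEquiv, ?_⟩
    have h1 : ![(Pi.single 0 1 : Fin 2 → ℝ) 1, (Pi.single 0 1 : Fin 2 → ℝ) 0] = Pi.single 1 1 := by
      ext i; fin_cases i <;> simp
    rw [← tagForm_transposition α _ hf, h1] at h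
    exact h

lemma tagForm_smul_smul (t : ℝ) (c : Fin 2 → ℝ) (f : Config → ℝ) :
    tagForm α (t • c) (fun η => t * f η) (t • c) (fun η => t * f η)
      = t ^ 2 * tagForm α c f c f := by
  rw [tagForm_smul, tagForm_smul_right]; ring

lemma ds_mul_sq_le (t : ℝ) {f : Config → ℝ} (hf : Blind f) :
    ds α.total * t ^ 2 ≤ tagForm α (Pi.single 0 t) f (Pi.single 0 t) f := by
  by_cases ht : t = 0
  · simpa [ht] using tagForm_self_nonneg α (Pi.single 0 0) f
  · have h := ds_le α (hf.const_mul t⁻¹)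
    have h2 := tagForm_smul_smul α t (Pi.single 0 1) (fun η => t⁻¹ * f η)
    have h3 : (fun η => t * (t⁻¹ * f η)) = f := by funext η; field_simp
    have h4 : (t • Pi.single 0 1 : Fin 2 → ℝ) = Pi.single 0 t := by
      rw [← Pi.single_smul]; simp
    rw [h3, h4] at h2
    rw [h2, mul_comm]
    exact mul_le_mul_of_nonneg_left h (sq_nonneg t)

lemma ds_mul_sq_le_one (t : ℝ) {f : Config → ℝ} (hf : Blind f) :
    ds α.total * t ^ 2 ≤ tagForm α (Pi.single 1 t) f (Pi.single 1 t) f := by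
  have h1 : ![(Pi.single 1 t : Fin 2 → ℝ) 1, (Pi.single 1 t : Fin 2 → ℝ) 0] = Pi.single 0 t := by
    ext i; fin_cases i <;> simp
  rw [← tagForm_transposition α _ hf, h1]
  exact ds_mul_sq_le α t (hf.comp_perm transposition.toEquiv)

/-- The quadratic form of the tagged particle dominates the self-diffusion matrix. -/
lemma ds_mul_le_tagForm (c : Fin 2 → ℝ) {f : Config → ℝ} (hf : Blind f) :
    ds α.total * (c 0 ^ 2 + c 1 ^ 2) ≤ tagForm α c f c f := by
  -- Parallelogram identity with the mirror image, which has the same form: the sum has drift along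
  -- `e 0` only and the difference along `e 1` only, and the bounds in the two coordinate directions
  -- apply to them.
  set f' : Config → ℝ := fun ξ => f (ξ ∘ reflection)
  set c' : Fin 2 → ℝ := ![c 0, -c 1]
  have hf' : Blind f' := hf.comp_perm reflection.toEquiv
  have hr : tagForm α c' f' c' f' = tagForm α c f c f := tagForm_reflection α c hf
  have hp := tagForm_add_smul α hf hf' c c' 1
  have hm := tagForm_add_smul α hf hf' c c' (-1)
  have h1 := ds_mul_sq_le α (2 * c 0) (hf.add (hf'.const_mul 1))
  have h2 := ds_mul_sq_le_one α (2 * c 1) (hf.add (hf'.const_mul (-1)))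
  have e1 : c + (1 : ℝ) • c' = Pi.single 0 (2 * c 0) := by
    ext i; fin_cases i <;> simp [c']; ring
  have e2 : c + (-1 : ℝ) • c' = Pi.single 1 (2 * c 1) := by
    ext i; fin_cases i <;> simp [c']; ring
  rw [e1] at hp
  rw [e2] at hm
  rw [hp] at h1
  rw [hm] at h2
  rw [hr] at h1 h2
  nlinarith

end

/-! ### Removing the dependence on the site of the tagged particle -/

/-- Freeze the state of the origin. -/
def freeze (s : Site) (f : Config → ℝ) : Config → ℝ := fun η => f (Function.update η 0 s)

/-- Before and after the jump, the state at the observer's origin is that of the tagged particle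
itself, so fixing it amounts to freezing `f` at the origin. -/
lemma tagGrad_update {z : Lattice} (hz : z ≠ 0) (s : Site) (f : Config → ℝ) (η : Config) :
    tagGrad z f (Function.update η 0 s) = tagGrad z (freeze s f) η := by
  simp only [tagGrad, shift, freeze]
  congr 2
  funext y
  by_cases h0 : y = 0
  · subst h0; simp [exch]
  · have h1 : y + z ≠ z := by simpa using h0
    rw [Function.update_of_ne h0]
    by_cases h2 : y + z = 0
    · rw [h2, exch_left, exch_left, Function.update_of_ne hz]
    · rw [exch_of_ne h2 h1, exch_of_ne h2 h1, Function.update_of_ne h2]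

lemma exch_update {a b y : Lattice} (ha : y ≠ a) (hb : y ≠ b) (s : Site) (η : Config) :
    exch a b (Function.update η y s) = Function.update (exch a b η) y s := by
  funext x
  by_cases h : x = y
  · subst h; rw [exch_of_ne ha hb]; simp
  · rw [Function.update_of_ne h]
    simp only [exch, Function.comp]
    rw [Function.update_of_ne]
    intro h'
    apply h
    rw [← Equiv.swap_apply_of_ne_of_ne ha hb] at h'
    exact (Equiv.swap a b).injective h'

lemma shift_update (y : Lattice) (s : Site) (f : Config → ℝ) (η : Config) :
    shift y f (Function.update η y s) = shift y (freeze s f) η := by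
  simp only [shift, freeze]
  congr 1
  funext x
  by_cases h : x = 0
  · subst h; simp
  · have : x + y ≠ y := by simpa using h
    rw [Function.update_of_ne this, Function.update_of_ne h]

/-- Here the particle at `y` is the observer. A jump from `0` to `z` leaves its site untouched, so
its state can be frozen as well. -/
lemma envGrad_update (z y : Lattice) (s : Site) (f : Config → ℝ) (η : Config) :
    envGrad z y f (Function.update η y s) = envGrad z y (freeze s f) η := by
  by_cases h : y ≠ 0 ∧ y ≠ z
  · simp only [envGrad, if_pos h, dgrad, ugrad, exch_update h.1 h.2, shift_update, occTot_eq,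
      Function.update_of_ne h.1.symm, Function.update_of_ne h.2.symm]
  · simp only [envGrad, if_neg h]

section
variable (α : GCParam)

lemma E_tagDensity_eq {f f' : Config → ℝ} (hf : Blind f) (hf' : Blind f') {z : Lattice}
    {X : Finset Lattice} (hX : ∀ y ∉ X, ∀ η, envGrad z y f η = 0) (c c' : ℝ) :
    α.E (tagDensity z c f c' f')
      = α.E (fun η => (1 - occTot z η) * ((c + tagGrad z f η) * (c' + tagGrad z f' η)))
        + ∑ y ∈ X, α.E (fun η => envGrad z y f η * envGrad z y f' η) := by
  rw [funext (tagDensity_eq_sum (f' := f') hX c c')]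
  have h1 : Blind fun η => (1 - occTot z η) * ((c + tagGrad z f η) * (c' + tagGrad z f' η)) :=
    (blind_vac z).mul (((blind_const c).add (hf.tagGrad z)).mul
      ((blind_const c').add (hf'.tagGrad z)))
  have h2 : ∀ y ∈ X, Nice fun η => envGrad z y f η * envGrad z y f' η :=
    fun y _ => ((hf.envGrad z y).mul (hf'.envGrad z y)).nice
  rw [E_add α h1.nice (Nice.sum X h2), E_sum α X h2]

lemma Blind.freeze {f : Config → ℝ} (hf : Blind f) {s : Site} (hs : s.norm = s) :
    Blind (freeze s f) := hf.update 0 hs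

lemma freeze_update (s t : Site) (f : Config → ℝ) (η : Config) :
    freeze s f (Function.update η 0 t) = freeze s f η := by simp [freeze]

/-- Each term is conditioned on the site playing the role of the origin for `f`: the site `0` in the
tagged-jump term, the site `y` in the `y`-th environment term. The occupation probability is the
same for all of them. -/
lemma E_tagDensity_split {f : Config → ℝ} (hf : Blind f) {z : Lattice} (hz : z ≠ 0) (c : ℝ) :
    α.E (tagDensity z c f c f)
      = α.total * α.E (tagDensity z c (freeze refParticle f) c (freeze refParticle f))
      + (1 - α.total) * α.E (tagDensity z c (freeze Site.empty f) c (freeze Site.empty f)) := by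
  obtain ⟨X, hX⟩ := exists_envGrad_eq_zero hf.nice z
  have hX' : ∀ s, ∀ y ∉ X, ∀ η, envGrad z y (freeze s f) η = 0 := fun s y hy η => by
    rw [← envGrad_update, hX y hy]
  have h1 := hf.freeze Site.norm_refParticle
  have h0 := hf.freeze Site.norm_empty
  rw [E_tagDensity_eq α hf hf hX, E_tagDensity_eq α h1 h1 (hX' _),
    E_tagDensity_eq α h0 h0 (hX' _)]
  have hb : Blind fun η => (1 - occTot z η) * ((c + tagGrad z f η) * (c + tagGrad z f η)) :=
    (blind_vac z).mul (((blind_const c).add (hf.tagGrad z)).mul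
      ((blind_const c).add (hf.tagGrad z)))
  rw [E_blind_split α hb 0]
  simp only [tagGrad_update hz, occTot_eq, Function.update_of_ne hz]
  have hy : ∀ y, α.E (fun η => envGrad z y f η * envGrad z y f η)
      = α.total * α.E (fun η => envGrad z y (freeze refParticle f) η
          * envGrad z y (freeze refParticle f) η)
        + (1 - α.total) * α.E (fun η => envGrad z y (freeze Site.empty f) η
          * envGrad z y (freeze Site.empty f) η) := by
    intro y
    rw [E_blind_split α ((hf.envGrad z y).mul (hf.envGrad z y)) y]
    simp only [envGrad_update]
  simp only [hy, Finset.sum_add_distrib, ← Finset.mul_sum]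
  ring

/-- The form of `f` is a convex combination of the forms of its two frozen versions, so one of them
does no worse. Independence of the origin is what later lets `v(η_0)` and `f` be treated separately.
-/
lemma exists_freeze_tagForm_le {f : Config → ℝ} (hf : Blind f) (c : Fin 2 → ℝ) :
    ∃ f', Blind f' ∧ (∀ η s, f' (Function.update η 0 s) = f' η) ∧
      tagForm α c f' c f' ≤ tagForm α c f c f := by
  have h : tagForm α c f c f
      = α.total * tagForm α c (freeze refParticle f) c (freeze refParticle f)
      + (1 - α.total) * tagForm α c (freeze Site.empty f) c (freeze Site.empty f) := by
    simp only [tagForm, fun i => E_tagDensity_split α hf (e_ne_zero i) (c i),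
      Finset.sum_add_distrib, ← Finset.mul_sum]
  have h0 := total_nonneg α
  have h1 := total_le_one α
  rcases le_total (tagForm α c (freeze refParticle f) c (freeze refParticle f))
    (tagForm α c (freeze Site.empty f) c (freeze Site.empty f)) with hle | hle
  · exact ⟨_, hf.freeze Site.norm_refParticle, fun η s => freeze_update _ _ _ _, by nlinarith⟩
  · exact ⟨_, hf.freeze Site.norm_empty, fun η s => freeze_update _ _ _ _, by nlinarith⟩

end

/-! ### Averages over far translations -/

/-- The points of a translated quadrant. -/
def quadrant (M a b : ℕ) : Lattice := ![M + a, b]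

lemma quadrant_add_e0 (M a b : ℕ) : quadrant M a b + e 0 = quadrant M (a + 1) b := by
  ext i; fin_cases i <;> simp [quadrant, e, add_assoc]

lemma quadrant_add_e1 (M a b : ℕ) : quadrant M a b + e 1 = quadrant M a (b + 1) := by
  ext i; fin_cases i <;> simp [quadrant, e]

lemma quadrant_injective (M : ℕ) : Function.Injective fun p : ℕ × ℕ => quadrant M p.1 p.2 := by
  rintro ⟨a, b⟩ ⟨a', b'⟩ h
  have h0 := congrFun h 0
  have h1 := congrFun h 1
  simp [quadrant] at h0 h1
  simp [h0, h1]

/-- The average of the translates of `f` over a far square of side `n`. -/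
def farAvg (M n : ℕ) (f : Config → ℝ) : Config → ℝ := fun η =>
  ((n : ℝ) ^ 2)⁻¹ * ∑ p ∈ Finset.range n ×ˢ Finset.range n, shift (quadrant M p.1 p.2) f η

lemma Blind.farAvg {f : Config → ℝ} (hf : Blind f) (M n : ℕ) : Blind (farAvg M n f) :=
  (Blind.sum _ fun _ _ => hf.shift _).const_mul _

/-- Telescoping along one direction of the square leaves two of its sides: `n` differences of size
at most `2 * C` instead of `n ^ 2`. -/
lemma abs_sum_sub_le {F : ℕ → ℕ → ℝ} {C : ℝ} (hF : ∀ a b, |F a b| ≤ C) (n : ℕ) :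
    |∑ b ∈ Finset.range n, ∑ a ∈ Finset.range n, (F (a + 1) b - F a b)| ≤ n * (2 * C) := by
  simp only [fun b => Finset.sum_range_sub (fun a => F a b) n]
  refine (Finset.abs_sum_le_sum_abs _ _).trans ?_
  refine (Finset.sum_le_card_nsmul _ _ (2 * C) fun b _ => ?_).trans (by simp)
  refine (abs_sub _ _).trans ?_
  linarith [hF n b, hF 0 b]

lemma sum_le_of_support {ι : Type*} {d : ι → ℝ} (hd : ∀ x, 0 ≤ d x) {X : Finset ι}
    (hX : ∀ x ∉ X, d x = 0) (W : Finset ι) : ∑ x ∈ W, d x ≤ ∑ x ∈ X, d x := by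
  classical
  calc ∑ x ∈ W, d x ≤ ∑ x ∈ W ∪ X, d x :=
        Finset.sum_le_sum_of_subset_of_nonneg Finset.subset_union_left fun x _ _ => hd x
    _ = ∑ x ∈ X, d x := (Finset.sum_subset Finset.subset_union_right fun x _ hx => hX x hx).symm

lemma exists_box_subset (A : Finset Lattice) : ∃ s : ℕ, ∀ x ∈ A, ∀ i, |x i| ≤ (s : ℤ) := by
  refine ⟨A.sup fun x => (x 0).natAbs + (x 1).natAbs, fun x hx i => ?_⟩
  have h := Finset.le_sup (f := fun x : Lattice => (x 0).natAbs + (x 1).natAbs) hx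
  have h' : (x i).natAbs ≤ (x 0).natAbs + (x 1).natAbs := by fin_cases i <;> simp
  rw [Int.abs_eq_natAbs]
  exact_mod_cast h'.trans h

lemma mem_box {l : ℕ} {x : Lattice} : x ∈ box l ↔ ∀ i, |x i| ≤ (l : ℤ) := by
  rw [box, Finset.mem_Icc, Pi.le_def, Pi.le_def, ← forall_and]
  simp only [abs_le]

/-- The average over far translates has small energy. -/
lemma exists_tagForm_farAvg_le (α : GCParam) {f : Config → ℝ} (hf : Blind f) {s M : ℕ}
    (hs : DependsOn f (box s : Set Lattice)) (hM : s + 2 ≤ M) :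
    ∃ D : ℝ, ∀ n : ℕ, 0 < n → tagForm α 0 (farAvg M n f) 0 (farAvg M n f) ≤ D / (n : ℝ) ^ 2 := by
  obtain ⟨C, hC⟩ := hf.nice.bdd
  have hX : ∀ i, ∃ X : Finset Lattice, ∀ x ∉ X, ∀ η, ugrad 0 (e i) (shift x f) η = 0 :=
    fun i => exists_ugrad_shift_eq_zero hf.nice 0 (e i)
  choose X hX using hX
  have hC0 : 0 ≤ C := (abs_nonneg _).trans (hC fun _ => Site.empty)
  let B : Fin 2 → ℝ := fun i => (X i).card * (2 * C)
  refine ⟨∑ i, ((2 * C) ^ 2 + B i * B i), fun n hn => ?_⟩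
  have hn' : (0 : ℝ) < n := by exact_mod_cast hn
  rw [tagForm, Finset.sum_div]
  refine Finset.sum_le_sum fun i _ => ?_
  rw [← E_const α (((2 * C) ^ 2 + B i * B i) / (n : ℝ) ^ 2)]
  refine E_mono α (blind_tagDensity (hf.farAvg M n) (hf.farAvg M n) _ _ _).nice (nice_const _)
    fun η => ?_
  rw [add_div]
  refine add_le_add ?_ ?_
  · -- the jump of the tagged particle
    have hfar : ∀ a b : ℕ, ∀ ξ : Config, shift (quadrant M a b) f (exch 0 (e i) ξ)
        = shift (quadrant M a b) f ξ := by
      intro a b ξ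
      refine dependsOn_shift hs (quadrant M a b) fun y hy => ?_
      simp only [Finset.coe_map, Set.mem_image, Finset.mem_coe] at hy
      obtain ⟨w, hw, rfl⟩ := hy
      have hw0 := abs_le.1 (mem_box.1 hw 0)
      -- Every site seen by the translate has first coordinate at least `M - s ≥ 2`, hence is
      -- neither `0` nor `e i`. The exchange is invisible, and the tagged jump acts on the average
      -- as a plain translation.
      have h2 : (2 : ℤ) ≤ (w + quadrant M a b) 0 := by simp [quadrant]; omega
      refine exch_of_ne (fun h => ?_) (fun h => ?_) ξ
      · have := congrFun h 0
        simp at this h2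
        omega
      · have := congrFun h 0
        have h3 : (e i) 0 ≤ 1 := by fin_cases i <;> simp [e]
        simp at this h2
        omega
    have htag : |tagGrad (e i) (farAvg M n f) η| ≤ 2 * C / n := by
      have h1 : tagGrad (e i) (farAvg M n f) η = ((n : ℝ) ^ 2)⁻¹ *
          ∑ p ∈ Finset.range n ×ˢ Finset.range n, (shift (quadrant M p.1 p.2 + e i) f η
            - shift (quadrant M p.1 p.2) f η) := by
        have h2 : ∀ p : ℕ × ℕ, shift (e i) (shift (quadrant M p.1 p.2) f) (exch 0 (e i) η)
            = shift (quadrant M p.1 p.2 + e i) f η := by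
          intro p
          rw [shift_shift]
          fin_cases i
          · simp only [Fin.zero_eta, quadrant_add_e0]; exact hfar _ _ _
          · simp only [Fin.mk_one, quadrant_add_e1]; exact hfar _ _ _
        rw [Finset.sum_sub_distrib, mul_sub, tagGrad]
        simp only [← h2]
        rfl
      have hb : |∑ p ∈ Finset.range n ×ˢ Finset.range n, (shift (quadrant M p.1 p.2 + e i) f η
            - shift (quadrant M p.1 p.2) f η)| ≤ n * (2 * C) := by
        fin_cases i
        · simp only [Fin.zero_eta, quadrant_add_e0]
          rw [Finset.sum_product_right]
          exact abs_sum_sub_le (F := fun a b => shift (quadrant M a b) f η) (fun a b => hC _) n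
        · simp only [Fin.mk_one, quadrant_add_e1]
          rw [Finset.sum_product]
          exact abs_sum_sub_le (F := fun b a => shift (quadrant M a b) f η) (fun a b => hC _) n
      rw [h1, abs_mul, abs_of_pos (by positivity)]
      calc ((n : ℝ) ^ 2)⁻¹ * _ ≤ ((n : ℝ) ^ 2)⁻¹ * (n * (2 * C)) :=
            mul_le_mul_of_nonneg_left hb (by positivity)
        _ = 2 * C / n := by field_simp
    simp only [Pi.zero_apply, zero_add, ← sq]
    calc (1 - occTot (e i) η) * tagGrad (e i) (farAvg M n f) η ^ 2
        ≤ 1 * tagGrad (e i) (farAvg M n f) η ^ 2 :=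
          mul_le_mul_of_nonneg_right (by linarith [occTot_nonneg (e i) η]) (sq_nonneg _)
      _ ≤ (2 * C / n) ^ 2 := by
          rw [one_mul, ← sq_abs]
          exact pow_le_pow_left₀ (abs_nonneg _) htag 2
      _ = (2 * C) ^ 2 / (n : ℝ) ^ 2 := by ring
  · -- the jumps of the environment
    let d : Lattice → ℝ := fun x => |ugrad 0 (e i) (shift x f) η|
    have hd0 : ∀ x, 0 ≤ d x := fun x => abs_nonneg _
    have hdX : ∀ x ∉ X i, d x = 0 := fun x hx => by simp [d, hX i x hx]
    have hB : ∀ W : Finset Lattice, ∑ x ∈ W, d x ≤ B i := by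
      intro W
      refine (sum_le_of_support hd0 hdX W).trans ?_
      refine (Finset.sum_le_card_nsmul _ _ (2 * C) fun x _ => ?_).trans (by simp [B])
      refine (abs_sub _ _).trans ?_
      have h1 := hC (fun y => exch 0 (e i) η (y + x))
      have h2 := hC (fun y => η (y + x))
      simp only [shift]
      linarith
    obtain ⟨Z, hZ⟩ := exists_envGrad_eq_zero (hf.farAvg M n).nice (e i)
    rw [finsum_eq_sum_of_zero fun y hy => by rw [hZ y hy, zero_mul]]
    have henv : ∀ y, |envGrad (e i) y (farAvg M n f) η| ≤ ((n : ℝ) ^ 2)⁻¹ *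
        ∑ p ∈ Finset.range n ×ˢ Finset.range n, d (quadrant M p.1 p.2 + y) := by
      intro y
      have h0 : 0 ≤ ((n : ℝ) ^ 2)⁻¹ *
        ∑ p ∈ Finset.range n ×ˢ Finset.range n, d (quadrant M p.1 p.2 + y) :=
        mul_nonneg (by positivity) (Finset.sum_nonneg fun _ _ => hd0 _)
      by_cases hy : y ≠ 0 ∧ y ≠ e i
      · have hu : ugrad 0 (e i) (shift y (farAvg M n f)) η = ((n : ℝ) ^ 2)⁻¹ *
            ∑ p ∈ Finset.range n ×ˢ Finset.range n,
              ugrad 0 (e i) (shift (quadrant M p.1 p.2 + y) f) η := by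
          simp only [ugrad, Finset.sum_sub_distrib, mul_sub, ← shift_shift]
          rfl
        simp only [envGrad, if_pos hy, dgrad, hu]
        rw [abs_mul, abs_mul ((n : ℝ) ^ 2)⁻¹, abs_of_pos (a := ((n : ℝ) ^ 2)⁻¹) (by positivity)]
        have h1 : |occTot 0 η * (1 - occTot (e i) η)| ≤ 1 := by
          rw [abs_mul, abs_of_nonneg (occTot_nonneg _ _),
            abs_of_nonneg (sub_nonneg.2 (occTot_le_one _ _))]
          exact mul_le_one₀ (occTot_le_one _ _) (sub_nonneg.2 (occTot_le_one _ _))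
            (by linarith [occTot_nonneg (e i) η])
        refine (mul_le_of_le_one_left (by positivity) h1).trans ?_
        exact mul_le_mul_of_nonneg_left (Finset.abs_sum_le_sum_abs _ _) (by positivity)
      · simpa [envGrad, if_neg hy] using h0
    have hsup : ∀ y, ∑ p ∈ Finset.range n ×ˢ Finset.range n, d (quadrant M p.1 p.2 + y) ≤ B i := by
      intro y
      have hinj : Function.Injective fun p : ℕ × ℕ => quadrant M p.1 p.2 + y :=
        (add_left_injective y).comp (quadrant_injective M)
      have := hB ((Finset.range n ×ˢ Finset.range n).map ⟨_, hinj⟩)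
      rwa [Finset.sum_map] at this
    have hsum : ∑ y ∈ Z, ∑ p ∈ Finset.range n ×ˢ Finset.range n, d (quadrant M p.1 p.2 + y)
        ≤ (n : ℝ) ^ 2 * B i := by
      rw [Finset.sum_comm]
      refine (Finset.sum_le_card_nsmul _ _ (B i) fun p _ => ?_).trans (by simp [sq])
      have := hB (Z.map (Equiv.addLeft (quadrant M p.1 p.2)).toEmbedding)
      rwa [Finset.sum_map] at this
    -- Sum of squares bounded by supremum times sum. Each increment is at most `B i / n ^ 2`, since
    -- distinct translates use distinct values of `d`; their sum over `y` is at most `B i`, the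
    -- average of `n ^ 2` sums of that size.
    calc ∑ y ∈ Z, envGrad (e i) y (farAvg M n f) η * envGrad (e i) y (farAvg M n f) η
        ≤ ∑ y ∈ Z, (((n : ℝ) ^ 2)⁻¹ * B i) * (((n : ℝ) ^ 2)⁻¹ *
            ∑ p ∈ Finset.range n ×ˢ Finset.range n, d (quadrant M p.1 p.2 + y)) := by
          refine Finset.sum_le_sum fun y _ => ?_
          rw [← abs_mul_abs_self]
          refine mul_le_mul ((henv y).trans ?_) (henv y) (abs_nonneg _) ?_
          · exact mul_le_mul_of_nonneg_left (hsup y) (by positivity)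
          · exact mul_nonneg (by positivity) ((Finset.sum_nonneg fun _ _ => hd0 _).trans (hsup y))
      _ = (((n : ℝ) ^ 2)⁻¹ * B i) * (((n : ℝ) ^ 2)⁻¹ * ∑ y ∈ Z,
            ∑ p ∈ Finset.range n ×ˢ Finset.range n, d (quadrant M p.1 p.2 + y)) := by
          rw [← Finset.mul_sum, ← Finset.mul_sum]
      _ ≤ (((n : ℝ) ^ 2)⁻¹ * B i) * (((n : ℝ) ^ 2)⁻¹ * ((n : ℝ) ^ 2 * B i)) := by
          refine mul_le_mul_of_nonneg_left (mul_le_mul_of_nonneg_left hsum (by positivity)) ?_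
          have : 0 ≤ B i := by positivity
          positivity
      _ = B i * B i / (n : ℝ) ^ 2 := by field_simp

/-! ### Canonical expectations -/

lemma canonicalExp_comp {l : ℕ} (ξ : Config) (ψ : Config → ℝ) {ρ : Equiv.Perm Lattice}
    (hρ : ∀ x, ρ x ≠ x → x ∈ box l) :
    canonicalExp l ξ (fun η => ψ (η ∘ ρ)) = canonicalExp l ξ ψ := by
  have hmem : ∀ x, ρ x ∈ box l ↔ x ∈ box l := by
    intro x
    by_cases h : ρ x = x
    · rw [h]
    · exact iff_of_true (hρ _ fun h' => h (ρ.injective h')) (hρ x h)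
  have h1 : Equiv.Perm.ofSubtype (ρ.subtypePerm hmem) = ρ :=
    Equiv.Perm.ofSubtype_subtypePerm hmem hρ
  have h2 : ∑ π : Equiv.Perm (box l), ψ ((ξ ∘ Equiv.Perm.ofSubtype π) ∘ ρ)
      = ∑ π : Equiv.Perm (box l), ψ (ξ ∘ Equiv.Perm.ofSubtype π) := by
    refine Fintype.sum_equiv (Equiv.mulRight (ρ.subtypePerm hmem)) _ _ fun π => ?_
    rw [Equiv.coe_mulRight, map_mul, h1, Equiv.Perm.coe_mul, Function.comp_assoc]
  rw [canonicalExp, canonicalExp, h2]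

lemma canonicalExp_sub (l : ℕ) (ξ : Config) (ψ φ : Config → ℝ) :
    canonicalExp l ξ (fun η => ψ η - φ η) = canonicalExp l ξ ψ - canonicalExp l ξ φ := by
  simp only [canonicalExp, Finset.sum_sub_distrib, sub_div]

lemma canonicalExp_const_mul (l : ℕ) (ξ : Config) (c : ℝ) (ψ : Config → ℝ) :
    canonicalExp l ξ (fun η => c * ψ η) = c * canonicalExp l ξ ψ := by
  simp only [canonicalExp, ← Finset.mul_sum, mul_div_assoc]

lemma canonicalExp_sum {ι : Type*} (l : ℕ) (ξ : Config) (s : Finset ι) (ψ : ι → Config → ℝ) :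
    canonicalExp l ξ (fun η => ∑ k ∈ s, ψ k η) = ∑ k ∈ s, canonicalExp l ξ (ψ k) := by
  simp only [canonicalExp, ← Finset.sum_div]
  rw [Finset.sum_comm]

lemma canonicalExp_eq_zero_of_exch {l : ℕ} (ξ : Config) {ψ : Config → ℝ} {a b : Lattice}
    (ha : a ∈ box l) (hb : b ∈ box l) (h : ∀ η, ψ (exch a b η) = -ψ η) :
    canonicalExp l ξ ψ = 0 := by
  have h1 := canonicalExp_comp (l := l) ξ ψ (ρ := Equiv.swap a b) fun x hx => by
    by_contra hx'
    exact hx (Equiv.swap_apply_of_ne_of_ne (fun h => hx' (h ▸ ha)) fun h => hx' (h ▸ hb))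
  have h2 : (fun η : Config => ψ (η ∘ Equiv.swap a b)) = fun η => -1 * ψ η := by
    funext η
    rw [neg_one_mul]
    exact h η
  rw [h2, canonicalExp_const_mul] at h1
  linarith

open Classical in
/-- The involution that exchanges `A` with its translate `A + y`. -/
def translSwap (A : Finset Lattice) (y : Lattice) (h : ∀ x ∈ A, x + y ∉ A) :
    Equiv.Perm Lattice :=
  Function.Involutive.toPerm (fun x => if x ∈ A then x + y else if x - y ∈ A then x - y else x) (by
    intro x
    by_cases h1 : x ∈ A
    · simp [h1, h x h1]
    · by_cases h2 : x - y ∈ A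
      · simp [h1, h2]
      · simp [h1, h2])

lemma translSwap_of_mem {A : Finset Lattice} {y : Lattice} (h : ∀ x ∈ A, x + y ∉ A) {x : Lattice}
    (hx : x ∈ A) : translSwap A y h x = x + y := by
  simp [translSwap, Function.Involutive.toPerm, hx]

lemma translSwap_of_notMem {A : Finset Lattice} {y : Lattice} (h : ∀ x ∈ A, x + y ∉ A)
    {x : Lattice} (hx : x ∉ A) (hx' : x - y ∉ A) : translSwap A y h x = x := by
  simp [translSwap, Function.Involutive.toPerm, hx, hx']

/-- The involution exchanging `A` and `A + y` preserves the canonical measure. It fixes the origin,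
which lies in neither set. -/
lemma canonicalExp_shift {A : Finset Lattice} {y : Lattice} (h : ∀ x ∈ A, x + y ∉ A)
    (h0 : (0 : Lattice) ∉ A) (hy : -y ∉ A) {l : ℕ} (hl : ∀ x ∈ A, x ∈ box l)
    (hl' : ∀ x ∈ A, x + y ∈ box l) (ξ : Config) (v : Site → ℝ) {f : Config → ℝ}
    (hf : DependsOn f (A : Set Lattice)) :
    canonicalExp l ξ (fun η => v (η 0) * shift y f η)
      = canonicalExp l ξ (fun η => v (η 0) * f η) := by
  rw [← canonicalExp_comp (ρ := translSwap A y h) ξ (fun η => v (η 0) * f η)]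
  · congr 1
    funext η
    have h1 : translSwap A y h 0 = 0 := translSwap_of_notMem h h0 (by simpa using hy)
    have h2 : f (η ∘ translSwap A y h) = shift y f η := by
      refine hf fun x hx => ?_
      simp [translSwap_of_mem h hx]
    rw [h2, Function.comp_apply, h1]
  · intro x hx
    by_cases h1 : x ∈ A
    · exact hl x h1
    · by_cases h2 : x - y ∈ A
      · simpa using hl' _ h2
      · exact absurd (translSwap_of_notMem h h1 h2) hx

/-! ### The class `T^ω` -/

/-- The site functions that are affine in `ω`, for each species. -/
def siteAff (ω : Angle → ℝ) (a b c d : ℝ) (s : Site) : ℝ :=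
  a * s.num .active + b * s.num .passive
    + c * (ω s.angle * s.num .active) + d * (ω s.angle * s.num .passive)

section
variable {ω : Angle → ℝ}

lemma IsC2.continuous (hω : IsC2 ω) : Continuous ω :=
  (QuotientAddGroup.isQuotientMap_mk (N := AddSubgroup.zmultiples (2 * Real.pi))).continuous_iff.2
    (ContDiff.continuous hω)

lemma IsC2.bdd (hω : IsC2 ω) : ∃ C, ∀ θ, |ω θ| ≤ C := by
  have : Fact (0 < 2 * Real.pi) := ⟨Real.two_pi_pos⟩
  obtain ⟨C, hC⟩ := (isCompact_range hω.continuous).isBounded.exists_norm_le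
  exact ⟨C, fun θ => hC _ (Set.mem_range_self θ)⟩

lemma siteFn_angle_mul (hω : IsC2 ω) (σ : Species) : SiteFn (fun s => ω s.angle * s.num σ) := by
  obtain ⟨C, hC⟩ := hω.bdd
  obtain ⟨D, hD⟩ := (siteFn_num σ).bdd
  refine SiteFn.mk' (fun τ => ?_) ⟨C * D, fun s => ?_⟩ (by simp [Site.num])
  · simp only [Site.angle, Site.num]
    exact hω.continuous.measurable.mul measurable_const
  · rw [abs_mul]
    exact mul_le_mul (hC _) (hD s) (abs_nonneg _) ((abs_nonneg _).trans (hC s.angle))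

lemma siteFn_siteAff (hω : IsC2 ω) (a b c d : ℝ) : SiteFn (siteAff ω a b c d) :=
  ((((siteFn_num _).const_mul a).add ((siteFn_num _).const_mul b)).add
    ((siteFn_angle_mul hω _).const_mul c)).add ((siteFn_angle_mul hω _).const_mul d)

lemma siteAff_mul_mem_cylinder (hω : IsC2 ω) (a b c d : ℝ) (x : Lattice) {F : Config → ℝ}
    (hF : Blind F) : (fun η => siteAff ω a b c d (η x) * F η) ∈ cylinder := by
  refine ⟨((siteFn_siteAff hω a b c d).nice x |>.mul hF.nice).loc, fun A η => ?_⟩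
  have hn : ∀ t, normCfg (setAngles A η t) = normCfg η := by
    intro t
    funext y
    by_cases hy : y ∈ A
    · cases h : η y <;> simp [normCfg, setAngles, hy, h, Site.setAngle, Site.norm]
    · simp [normCfg, setAngles, hy]
  have hF' : ∀ t, F (setAngles A η t) = F η := fun t => by rw [← hF.norm, hn, hF.norm]
  simp only [hF']
  refine ContDiff.mul ?_ contDiff_const
  by_cases hx : x ∈ A
  · cases h : η x with
    | empty =>
      simp only [setAngles, hx, dif_pos, h, Site.setAngle]
      exact contDiff_const
    | particle σ θ =>
      simp only [setAngles, hx, dif_pos, h, Site.setAngle, siteAff, Site.num, Site.angle]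
      have hc : ContDiff ℝ 2 fun t : A → ℝ => ω ((t ⟨x, hx⟩ : ℝ) : Angle) :=
        ContDiff.comp (g := fun t : ℝ => ω (t : Angle)) hω (contDiff_apply ℝ ℝ _)
      exact (contDiff_const.add (contDiff_const.mul (hc.mul contDiff_const))).add
        (contDiff_const.mul (hc.mul contDiff_const))
  · simp only [setAngles, hx, dif_neg, not_false_iff]
    exact contDiff_const

lemma siteAff_mul_mem_classT (hω : IsC2 ω) (a b c d : ℝ) (x : Lattice) {F : Config → ℝ}
    (hF : Blind F) : (fun η => siteAff ω a b c d (η x) * F η) ∈ classT ω := by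
  refine Submodule.subset_span ⟨siteAff_mul_mem_cylinder hω a b c d x hF, a, b, c, d, {x},
    fun _ => F, fun _ => mem_blind_iff.2 hF, ?_⟩
  simp [siteAff, occ, occAng]

lemma classT_le_cylinder : classT ω ≤ cylinder := Submodule.span_le.2 fun _ hf => hf.1

lemma mem_classT0_of {ψ : Config → ℝ} (hT : ψ ∈ classT ω) {s : ℕ}
    (h : ∀ l, s ≤ l → ∀ ξ : Config, canonicalExp l ξ ψ = 0) : ψ ∈ classT0 ω := by
  have hc := classT_le_cylinder hT
  obtain ⟨A, hA⟩ := hc.1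
  obtain ⟨r, hr⟩ := exists_box_subset A
  refine ⟨⟨hc, max s r, hA.mono fun x hx => ?_, fun l hl ξ _ => h l (le_of_max_le_left hl) ξ⟩, hT⟩
  exact mem_box.2 fun i => (hr x hx i).trans (by exact_mod_cast le_max_right s r)

lemma curr_mem_classT0 (hω : IsC2 ω) (a b c d : ℝ) (i : Fin 2) :
    curr (siteAff ω a b c d) i ∈ classT0 ω := by
  refine mem_classT0_of (s := 1) ?_ fun l hl ξ =>
    canonicalExp_eq_zero_of_exch (a := 0) (b := e i) ξ ?_ ?_ fun η => ?_
  · exact Submodule.sub_mem _ (siteAff_mul_mem_classT hω a b c d 0 (blind_vac (e i)))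
      (siteAff_mul_mem_classT hω a b c d (e i) (blind_vac 0))
  · exact mem_box.2 fun k => by simp
  · refine mem_box.2 fun k => ?_
    have hl' : (1 : ℤ) ≤ l := by exact_mod_cast hl
    by_cases h : k = i
    · subst h; simpa [e] using hl'
    · simp [e, h]
  -- The current is antisymmetric under the exchange of `0` and `e i`, so its canonical means
  -- vanish.
  · simp only [curr, occTot_eq, exch_left, exch_right]; ring

lemma lgrad_mem_classT0 (hω : IsC2 ω) (a b c d : ℝ) (i : Fin 2) :
    lgrad (siteAff ω a b c d) i ∈ classT0 ω := by
  refine mem_classT0_of (s := 1) ?_ fun l hl ξ =>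
    canonicalExp_eq_zero_of_exch (a := 0) (b := e i) ξ ?_ ?_ fun η => ?_
  · have := Submodule.sub_mem _ (siteAff_mul_mem_classT hω a b c d (e i) (blind_const 1))
      (siteAff_mul_mem_classT hω a b c d 0 (blind_const 1))
    simp only [mul_one] at this
    exact this
  · exact mem_box.2 fun k => by simp
  · refine mem_box.2 fun k => ?_
    have hl' : (1 : ℤ) ≤ l := by exact_mod_cast hl
    by_cases h : k = i
    · subst h; simpa [e] using hl'
    · simp [e, h]
  · simp only [lgrad, exch_left, exch_right]; ring

/-- Against `v(η_0)`, each distant translate of `f` has the same canonical mean as `f`, so the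
difference with the average has mean zero. The bound on `M` separates the support from its
translates, and `s + M + n` is large enough for a box to contain them all. -/
lemma farAvg_mem_classT0 (hω : IsC2 ω) (a b c d : ℝ) {f : Config → ℝ} (hf : Blind f)
    (hf0 : ∀ η s, f (Function.update η 0 s) = f η) {s M n : ℕ}
    (hs : DependsOn f (box s : Set Lattice)) (hM : 2 * s + 2 ≤ M) (hn : 0 < n) :
    (fun η => siteAff ω a b c d (η 0) * (f η - farAvg M n f η)) ∈ classT0 ω := by
  classical
  refine mem_classT0_of (s := s + M + n) (siteAff_mul_mem_classT hω a b c d 0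
    (hf.sub (hf.farAvg M n))) fun l hl ξ => ?_
  have hA : DependsOn f (((box s).erase 0 : Finset Lattice) : Set Lattice) := by
    intro η ξ h
    rw [← hf0 η Site.empty, ← hf0 ξ Site.empty]
    refine hs fun y hy => ?_
    by_cases h0 : y = 0
    · subst h0; simp
    · simp only [Function.update_of_ne h0]
      exact h y (by simpa [h0] using hy)
  have key : ∀ p ∈ Finset.range n ×ˢ Finset.range n,
      canonicalExp l ξ (fun η => siteAff ω a b c d (η 0) * shift (quadrant M p.1 p.2) f η)
        = canonicalExp l ξ (fun η => siteAff ω a b c d (η 0) * f η) := by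
    intro p hp
    simp only [Finset.mem_product, Finset.mem_range] at hp
    refine canonicalExp_shift ?_ (by simp) ?_ ?_ ?_ ξ _ hA
    · intro x hx hx'
      have h1 := abs_le.1 (mem_box.1 (Finset.mem_of_mem_erase hx) 0)
      have h2 := abs_le.1 (mem_box.1 (Finset.mem_of_mem_erase hx') 0)
      simp [quadrant] at h2
      omega
    · intro hx'
      have h2 := abs_le.1 (mem_box.1 (Finset.mem_of_mem_erase hx') 0)
      simp [quadrant] at h2
      omega
    · intro x hx
      refine mem_box.2 fun i => (mem_box.1 (Finset.mem_of_mem_erase hx) i).trans ?_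
      exact_mod_cast (by omega : s ≤ l)
    · intro x hx
      refine mem_box.2 fun i => ?_
      have h1 := abs_le.1 (mem_box.1 (Finset.mem_of_mem_erase hx) i)
      rw [abs_le]
      fin_cases i <;> simp [quadrant] at h1 ⊢ <;> omega
  have hsplit : (fun η => siteAff ω a b c d (η 0) * (f η - farAvg M n f η))
      = fun η => siteAff ω a b c d (η 0) * f η - ((n : ℝ) ^ 2)⁻¹ *
        ∑ p ∈ Finset.range n ×ˢ Finset.range n,
          siteAff ω a b c d (η 0) * shift (quadrant M p.1 p.2) f η := by
    funext η
    rw [← Finset.mul_sum, farAvg]; ring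
  rw [hsplit, canonicalExp_sub, canonicalExp_const_mul, canonicalExp_sum,
    Finset.sum_congr rfl key]
  have hn' : (n : ℝ) ≠ 0 := by exact_mod_cast hn.ne'
  simp
  field_simp
  ring

/-- Near-minimizers of the tagged particle form that give elements of `T_0^ω`. -/
lemma exists_nearMinimizer (α : GCParam) (hω : IsC2 ω) (a b c d : ℝ) (i : Fin 2) {δ : ℝ}
    (hδ : 0 < δ) :
    ∃ f, Blind f ∧ (∀ η s, f (Function.update η 0 s) = f η) ∧
      (fun η => siteAff ω a b c d (η 0) * f η) ∈ classT0 ω ∧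
      tagForm α (Pi.single i 1) f (Pi.single i 1) f ≤ ds α.total + δ := by
  -- Half of `δ` is spent on approaching the infimum, the other half on subtracting the far average.
  obtain ⟨f₀, hf₀, hlt⟩ := exists_tagForm_lt α i (half_pos hδ)
  obtain ⟨f, hf, hf0, hle⟩ := exists_freeze_tagForm_le α hf₀ (Pi.single i 1)
  obtain ⟨A, hA⟩ := hf.loc
  obtain ⟨s, hs⟩ := exists_box_subset A
  have hfs : DependsOn f (box s : Set Lattice) := hA.mono fun x hx => mem_box.2 (hs x hx)
  set M : ℕ := 2 * s + 2
  obtain ⟨D, hD⟩ := exists_tagForm_farAvg_le α hf (M := M) hfs (by omega)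
  set T := tagForm α (Pi.single i 1) f (Pi.single i 1) f
  have hT0 : 0 ≤ T := tagForm_self_nonneg α _ _
  -- This is the cost of the subtraction: the cross term, estimated by Cauchy–Schwarz, plus the form
  -- of the far average.
  have hlim : Tendsto (fun n : ℕ => 2 * √(T * (D / (n : ℝ) ^ 2)) + D / (n : ℝ) ^ 2) atTop
      (𝓝 (2 * √(T * 0) + 0)) := by
    have h1 : Tendsto (fun n : ℕ => D / (n : ℝ) ^ 2) atTop (𝓝 0) :=
      tendsto_const_nhds.div_atTop
        ((tendsto_pow_atTop two_ne_zero).comp tendsto_natCast_atTop_atTop)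
    exact ((Real.continuous_sqrt.tendsto _).comp (h1.const_mul T)).const_mul 2 |>.add h1
  simp only [mul_zero, Real.sqrt_zero, add_zero] at hlim
  obtain ⟨n, hn1, hn⟩ := ((hlim.eventually_lt_const (half_pos hδ)).and
    (eventually_gt_atTop 0)).exists
  have hG := hf.farAvg M n
  refine ⟨fun η => f η - farAvg M n f η, hf.sub hG, fun η s' => ?_,
    farAvg_mem_classT0 hω a b c d hf hf0 hfs le_rfl hn, ?_⟩
  · have : farAvg M n f (Function.update η 0 s') = farAvg M n f η := by
      simp only [farAvg]
      congr 1
      refine Finset.sum_congr rfl fun p _ => dependsOn_shift hfs _ fun y hy => ?_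
      simp only [Finset.coe_map, Set.mem_image, Finset.mem_coe] at hy
      obtain ⟨w, hw, rfl⟩ := hy
      refine Function.update_of_ne (fun h => ?_) _ _
      have h1 := abs_le.1 (mem_box.1 hw 0)
      have h2 := congrFun h 0
      simp [quadrant] at h2
      omega
    simp only [this, hf0]
  · have hexp := tagForm_add_smul α hf hG (Pi.single i 1) 0 (-1)
    have hcs := tagForm_sq_le α hf hG (Pi.single i 1) 0
    have hDn := hD n hn
    have h2 : tagForm α (Pi.single i 1) f 0 (farAvg M n f) ^ 2 ≤ T * (D / (n : ℝ) ^ 2) :=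
      hcs.trans (mul_le_mul_of_nonneg_left hDn hT0)
    have h3 := Real.abs_le_sqrt h2
    have h4 := (abs_le.1 h3).1
    have e1 : (fun η => f η - farAvg M n f η) = fun η => f η + -1 * farAvg M n f η := by
      funext η; ring
    have e2 : (Pi.single i 1 : Fin 2 → ℝ) + (-1 : ℝ) • (0 : Fin 2 → ℝ) = Pi.single i 1 := by simp
    rw [e2] at hexp
    rw [e1, hexp]
    nlinarith

end

/-! ### The energy form and its components -/

/-- The gradient of `∑_x x_i Ψ_i(η_x) + ∑_x τ_x h` along the edge from `0` to `e i`, on the event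
that a particle can jump along this edge. -/
def jumpGrad (i : Fin 2) (v : Site → ℝ) (h : Config → ℝ) : Config → ℝ := fun η =>
  occTot 0 η * (1 - occTot (e i) η) * (v (η 0) + tgrad i h η)

lemma nice_jumpGrad {v : Site → ℝ} (hv : SiteFn v) {h : Config → ℝ} (hh : Nice h) (i : Fin 2) :
    Nice (jumpGrad i v h) :=
  ((nice_occTot 0).mul (nice_vac (e i))).mul ((hv.nice 0).add (hh.tgrad i))

lemma occTot_mul_self (x : Lattice) (η : Config) : occTot x η * occTot x η = occTot x η := by
  rw [occTot_eq]; cases η x <;> simp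

lemma vac_mul_self (x : Lattice) (η : Config) :
    (1 - occTot x η) * (1 - occTot x η) = 1 - occTot x η := by
  linear_combination occTot_mul_self x η

lemma mul_jumpGrad (i : Fin 2) (v : Site → ℝ) (h : Config → ℝ) (η : Config) :
    occTot 0 η * (1 - occTot (e i) η) * jumpGrad i v h η = jumpGrad i v h η := by
  simp only [jumpGrad]
  linear_combination (occTot 0 η * (v (η 0) + tgrad i h η)) * vac_mul_self (e i) η
    + ((1 - occTot (e i) η) ^ 2 * (v (η 0) + tgrad i h η)) * occTot_mul_self 0 η

/-- The gradient field of a function `v(η_0) f` with `f` blind. -/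
def tagField (i : Fin 2) (X : Finset Lattice) (v : Site → ℝ) (c : ℝ) (f : Config → ℝ) :
    Config → ℝ := fun η =>
  v (η 0) * ((1 - occTot (e i) η) * (c + tagGrad (e i) f η))
    + ∑ y ∈ X, v (η y) * envGrad (e i) y f η

/-- Three roles for the particle weighted by `v`: it leaves `0`, it has just arrived at `e i`, or it
sits at another site `y` and only sees its environment change. The first two roles combine into the
increment under its own jump. -/
lemma mul_ugrad_shift {v : Site → ℝ} (hv : SiteFn v) (i : Fin 2) (f : Config → ℝ) (y : Lattice)
    (η : Config) :
    occTot 0 η * (1 - occTot (e i) η) * ugrad 0 (e i) (shift y fun η => v (η 0) * f η) η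
      = (if y = 0 then -(v (η 0) * (1 - occTot (e i) η) * f η) else 0)
        + (if y = e i then v (η 0) * (1 - occTot (e i) η) * shift (e i) f (exch 0 (e i) η) else 0)
        + v (η y) * envGrad (e i) y f η := by
  have h1 := hv.mul_one_sub_tot (η (e i))
  have h2 := hv.mul_tot (η 0)
  by_cases hy0 : y = 0
  · subst hy0
    have : (0 : Lattice) ≠ e i := (e_ne_zero i).symm
    simp only [this, if_false, if_true, envGrad, ugrad, shift, add_zero, exch_left,
      occTot_eq, ne_eq, not_true_eq_false, false_and, mul_zero]
    linear_combination ((η 0).tot * f (exch 0 (e i) η)) * h1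
      - (1 - (η (e i)).tot) * f η * h2
  · by_cases hye : y = e i
    · subst hye
      simp only [e_ne_zero, if_false, if_true, envGrad, ugrad, shift, zero_add, add_zero,
        exch_right, occTot_eq, ne_eq, not_true_eq_false, and_false, mul_zero]
      linear_combination (-(η 0).tot * f (fun z => η (z + e i))) * h1
        + (1 - (η (e i)).tot) * f (fun z => exch 0 (e i) η (z + e i)) * h2
    · simp only [hy0, hye, if_false, envGrad, ne_eq, not_false_eq_true, and_self, if_true, dgrad,
        ugrad, shift, zero_add, exch_of_ne hy0 hye]
      ring

lemma mul_tgrad_eq {v : Site → ℝ} (hv : SiteFn v) {f : Config → ℝ} (hf : Blind f) (i : Fin 2)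
    {X : Finset Lattice} (hX : ∀ y ∉ X, ∀ η, envGrad (e i) y f η = 0) (η : Config) :
    occTot 0 η * (1 - occTot (e i) η) * tgrad i (fun η => v (η 0) * f η) η
      = tagField i X v 0 f η := by
  classical
  obtain ⟨Y, hY⟩ := exists_ugrad_shift_eq_zero ((hv.nice 0).mul hf.nice) 0 (e i)
  rw [tgrad_eq_sum (X := insert 0 (insert (e i) (X ∪ Y)))
    fun x hx => hY x fun h => hx (by simp [h])]
  rw [Finset.mul_sum]
  simp only [mul_ugrad_shift hv, Finset.sum_add_distrib, Finset.sum_ite_eq']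
  rw [← Finset.sum_subset (s₁ := X) (fun x hx => by simp [hx])
    fun y _ hy => by rw [hX y hy, mul_zero]]
  simp [tagField, tagGrad]
  ring

lemma jumpGrad_eq_tagField {v : Site → ℝ} (hv : SiteFn v) {f : Config → ℝ} (hf : Blind f)
    (i : Fin 2) {X : Finset Lattice} (hX : ∀ y ∉ X, ∀ η, envGrad (e i) y f η = 0) (c : ℝ)
    (η : Config) :
    jumpGrad i (fun s => c * v s) (fun η => v (η 0) * f η) η = tagField i X v c f η := by
  have h := mul_tgrad_eq hv hf i hX η
  have h2 := hv.mul_tot (η 0)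
  simp only [jumpGrad, tagField, mul_add, occTot_eq] at h ⊢
  linear_combination h + c * (1 - (η (e i)).tot) * h2

/-! ### Orthogonality of particles carrying a mean-zero weight -/

lemma OccInv.mul {x : Lattice} {f g : Config → ℝ} (hf : OccInv x f) (hg : OccInv x g) :
    OccInv x (fun η => f η * g η) := fun η h => by simp only [hf η h, hg η h]

lemma occInv_site {x y : Lattice} (h : y ≠ x) (v : Site → ℝ) : OccInv x (fun η => v (η y)) :=
  fun η _ => by simp only [Function.update_of_ne h]

section
variable (α : GCParam)

lemma E_resample_zero {v : Site → ℝ} (hv : SiteFn v) (h0 : α.mean v = 0) {x : Lattice}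
    {K : Config → ℝ} (hK : Nice K) (hx : OccInv x K) :
    α.E (fun η => v (η x) * K η) = 0 := by
  rw [E_resample α hv hK hx, h0, zero_mul]

lemma envGrad_zero (z : Lattice) (f : Config → ℝ) : envGrad z 0 f = fun _ => 0 := by
  funext η; simp [envGrad]

/-- A function that does not depend on the state of the origin. -/
def FreeAtZero (f : Config → ℝ) : Prop := ∀ η s, f (Function.update η 0 s) = f η

lemma FreeAtZero.freeze {f : Config → ℝ} (hf : FreeAtZero f) (s : Site) : freeze s f = f :=
  funext fun η => hf η s

/-- In a product of terms carried by two different particles, the one weighted by `Φ` is seen by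
everything else only through its occupation, so resampling it yields a factor `mean Φ = 0`. In a
product carried by one particle, the factors `a`, `b`, `D y`, `G y` do not depend on the site of
that particle, because `f` and `F` do not depend on the origin, and `mean (Φ v)` splits off. -/
lemma E_tagField_mul {Φ v : Site → ℝ} (hΦ : SiteFn Φ) (hv : SiteFn v) (h0 : α.mean Φ = 0)
    {f F : Config → ℝ} (hf : Blind f) (hF : Blind F) (hf0 : FreeAtZero f) (hF0 : FreeAtZero F)
    (i : Fin 2) {X Y : Finset Lattice} (hX : ∀ y ∉ X, ∀ η, envGrad (e i) y f η = 0)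
    (hY : ∀ y ∉ Y, ∀ η, envGrad (e i) y F η = 0) (c c' : ℝ) :
    α.E (fun η => tagField i X Φ c f η * tagField i Y v c' F η)
      = α.mean (fun s => Φ s * v s) * α.E (tagDensity (e i) c f c' F) := by
  classical
  set a : Config → ℝ := fun η => (1 - occTot (e i) η) * (c + tagGrad (e i) f η)
  set b : Config → ℝ := fun η => (1 - occTot (e i) η) * (c' + tagGrad (e i) F η)
  have ha : Blind a := (blind_vac _).mul ((blind_const c).add (hf.tagGrad _))
  have hb : Blind b := (blind_vac _).mul ((blind_const c').add (hF.tagGrad _))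
  have haf : ∀ η s, a (Function.update η 0 s) = a η := fun η s => by
    simp only [a, tagGrad_update (e_ne_zero i), hf0.freeze, occTot_eq,
      Function.update_of_ne (e_ne_zero i)]
  have hbf : ∀ η s, b (Function.update η 0 s) = b η := fun η s => by
    simp only [b, tagGrad_update (e_ne_zero i), hF0.freeze, occTot_eq,
      Function.update_of_ne (e_ne_zero i)]
  set D : Lattice → Config → ℝ := fun y => envGrad (e i) y f
  set G : Lattice → Config → ℝ := fun y => envGrad (e i) y F
  have hD : ∀ y, Blind (D y) := fun y => hf.envGrad _ y
  have hG : ∀ y, Blind (G y) := fun y => hF.envGrad _ y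
  have hDf : ∀ y η s, D y (Function.update η y s) = D y η := fun y η s => by
    simp only [D, envGrad_update, hf0.freeze]
  have hGf : ∀ y η s, G y (Function.update η y s) = G y η := fun y η s => by
    simp only [G, envGrad_update, hF0.freeze]
  have hD0 : D 0 = fun _ => 0 := envGrad_zero _ _
  have hG0 : G 0 = fun _ => 0 := envGrad_zero _ _
  -- the four kinds of products
  have t1 : α.E (fun η => (Φ (η 0) * v (η 0)) * (a η * b η))
      = α.mean (fun s => Φ s * v s) * α.E (fun η => a η * b η) :=
    E_mul_of_update α (hΦ.mul hv) (ha.mul hb).nice fun η s => by rw [haf, hbf]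
  have t2 : ∀ y, α.E (fun η => Φ (η 0) * (a η * (v (η y) * G y η))) = 0 := by
    intro y
    by_cases hy : y = 0
    · subst hy; simp [hG0, E_const]
    · exact E_resample_zero α hΦ h0 (ha.nice.mul ((hv.nice y).mul (hG y).nice))
        ((ha.occInv 0).mul ((occInv_site hy v).mul ((hG y).occInv 0)))
  have t3 : ∀ y, α.E (fun η => Φ (η y) * (D y η * (v (η 0) * b η))) = 0 := by
    intro y
    by_cases hy : y = 0
    · subst hy; simp [hD0, E_const]
    · exact E_resample_zero α hΦ h0 ((hD y).nice.mul ((hv.nice 0).mul hb.nice))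
        (((hD y).occInv y).mul ((occInv_site (Ne.symm hy) v).mul (hb.occInv y)))
  have t4 : ∀ y z, α.E (fun η => Φ (η y) * (D y η * (v (η z) * G z η)))
      = if y = z then α.mean (fun s => Φ s * v s) * α.E (fun η => D y η * G y η) else 0 := by
    intro y z
    by_cases hyz : y = z
    · subst hyz
      rw [if_pos rfl, ← E_mul_of_update α (hΦ.mul hv) (x := y) ((hD y).mul (hG y)).nice
        fun η s => by rw [hDf, hGf]]
      congr 1; funext η; ring
    · rw [if_neg hyz]
      exact E_resample_zero α hΦ h0 ((hD y).nice.mul ((hv.nice z).mul (hG z).nice))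
        (((hD y).occInv y).mul ((occInv_site (Ne.symm hyz) v).mul ((hG z).occInv y)))
  have n1 : Nice fun η => (Φ (η 0) * v (η 0)) * (a η * b η) :=
    ((hΦ.nice 0).mul (hv.nice 0)).mul (ha.mul hb).nice
  have n2 : ∀ y, Nice fun η => Φ (η 0) * (a η * (v (η y) * G y η)) := fun y =>
    (hΦ.nice 0).mul (ha.nice.mul ((hv.nice y).mul (hG y).nice))
  have n3 : ∀ y, Nice fun η => Φ (η y) * (D y η * (v (η 0) * b η)) := fun y =>
    (hΦ.nice y).mul ((hD y).nice.mul ((hv.nice 0).mul hb.nice))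
  have n4 : ∀ y z, Nice fun η => Φ (η y) * (D y η * (v (η z) * G z η)) := fun y z =>
    (hΦ.nice y).mul ((hD y).nice.mul ((hv.nice z).mul (hG z).nice))
  have hexp : (fun η => tagField i X Φ c f η * tagField i Y v c' F η) = fun η =>
      ((Φ (η 0) * v (η 0)) * (a η * b η) + ∑ y ∈ Y, Φ (η 0) * (a η * (v (η y) * G y η)))
      + (∑ y ∈ X, Φ (η y) * (D y η * (v (η 0) * b η))
        + ∑ y ∈ X, ∑ z ∈ Y, Φ (η y) * (D y η * (v (η z) * G z η))) := by
    funext η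
    have e1 : ∑ y ∈ Y, Φ (η 0) * (a η * (v (η y) * G y η))
        = Φ (η 0) * a η * ∑ y ∈ Y, v (η y) * G y η := by
      rw [Finset.mul_sum]; exact Finset.sum_congr rfl fun _ _ => by ring
    have e2 : ∑ y ∈ X, Φ (η y) * (D y η * (v (η 0) * b η))
        = (∑ y ∈ X, Φ (η y) * D y η) * (v (η 0) * b η) := by
      rw [Finset.sum_mul]; exact Finset.sum_congr rfl fun _ _ => by ring
    have e3 : ∑ y ∈ X, ∑ z ∈ Y, Φ (η y) * (D y η * (v (η z) * G z η))
        = (∑ y ∈ X, Φ (η y) * D y η) * ∑ z ∈ Y, v (η z) * G z η := by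
      rw [Finset.sum_mul_sum]
      exact Finset.sum_congr rfl fun _ _ => Finset.sum_congr rfl fun _ _ => by ring
    rw [e1, e2, e3]
    simp only [tagField, a, b, D, G]
    ring
  rw [hexp, E_add α (n1.add (Nice.sum Y fun y _ => n2 y))
      ((Nice.sum X fun y _ => n3 y).add (Nice.sum X fun y _ => Nice.sum Y fun z _ => n4 y z)),
    E_add α n1 (Nice.sum Y fun y _ => n2 y),
    E_add α (Nice.sum X fun y _ => n3 y) (Nice.sum X fun y _ => Nice.sum Y fun z _ => n4 y z),
    E_sum α Y fun y _ => n2 y, E_sum α X fun y _ => n3 y,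
    E_sum α X fun y _ => Nice.sum Y fun z _ => n4 y z]
  simp only [fun y => E_sum α Y fun z _ => n4 y z, t1, t2, t3, t4, Finset.sum_const_zero, add_zero,
    zero_add, Finset.sum_ite_eq]
  rw [E_tagDensity_eq α hf hF hX, mul_add, Finset.mul_sum]
  congr 1
  · congr 2
    funext η
    simp only [a, b]
    linear_combination ((c + tagGrad (e i) f η) * (c' + tagGrad (e i) F η)) * vac_mul_self (e i) η
  · refine Finset.sum_congr rfl fun y _ => ?_
    by_cases hy : y ∈ Y
    · rw [if_pos hy]
    · rw [if_neg hy]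
      simp [hY y hy, E_const]

lemma tagGrad_const (z : Lattice) (c : ℝ) (η : Config) : tagGrad z (fun _ => c) η = 0 := by
  simp [tagGrad, shift]

lemma envGrad_const (z y : Lattice) (c : ℝ) (η : Config) : envGrad z y (fun _ => c) η = 0 := by
  simp [envGrad, dgrad, ugrad, shift]

/-- Restricted to possible jumps, `v(η_0)` is the field of a tagged particle with drift `1` and zero
corrector, so this is a case of `E_tagField_mul`. -/
lemma E_jumpGrad_mul_site {Φ v : Site → ℝ} (hΦ : SiteFn Φ) (hv : SiteFn v) (h0 : α.mean Φ = 0)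
    {f : Config → ℝ} (hf : Blind f) (hf0 : FreeAtZero f) (i : Fin 2) (c : ℝ) :
    α.E (fun η => jumpGrad i (fun s => c * Φ s) (fun η => Φ (η 0) * f η) η * v (η 0))
      = α.mean (fun s => Φ s * v s) * α.E (tagDensity (e i) c f 1 fun _ => 0) := by
  obtain ⟨X, hX⟩ := exists_envGrad_eq_zero hf.nice (e i)
  rw [← E_tagField_mul α hΦ hv h0 hf (blind_const 0) hf0 (fun _ _ => rfl) i hX (Y := ∅)
    (fun y _ η => envGrad_const _ _ _ _)]
  congr 1
  funext η
  rw [← jumpGrad_eq_tagField hΦ hf i hX]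
  simp only [tagField, tagGrad_const, Finset.sum_empty, add_zero, mul_one]
  set J := jumpGrad i (fun s => c * Φ s) (fun η => Φ (η 0) * f η) η with hJ
  have hm : occTot 0 η * (1 - occTot (e i) η) * J = J := mul_jumpGrad _ _ _ _
  linear_combination -v (η 0) * (occTot (e i) η * hm + occTot 0 η * J * vac_mul_self (e i) η)

/-- `h` has a component along the site function `Φ`, represented by a blind function. -/
def HasComponent (Φ : Site → ℝ) (h : Config → ℝ) : Prop :=
  Nice h ∧ ∃ G, Blind G ∧ FreeAtZero G ∧ ∀ (i : Fin 2) (c : ℝ) (f : Config → ℝ), Blind f →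
    FreeAtZero f →
    α.E (fun η => jumpGrad i (fun s => c * Φ s) (fun η => Φ (η 0) * f η) η * tgrad i h η)
      = α.E (tagDensity (e i) c f 0 G)

variable {α} {Φ : Site → ℝ}

lemma hasComponent_zero : HasComponent α Φ (fun _ => 0) := by
  refine ⟨nice_const 0, fun _ => 0, blind_const 0, fun _ _ => rfl, fun i c f _ _ => ?_⟩
  congr 1
  funext η
  simp [tgrad_zero, tagDensity, tagGrad_const, envGrad_const]

lemma nice_jumpGrad_tag (hΦ : SiteFn Φ) {f : Config → ℝ} (hf : Blind f) (i : Fin 2) (c : ℝ) :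
    Nice (jumpGrad i (fun s => c * Φ s) (fun η => Φ (η 0) * f η)) :=
  nice_jumpGrad (hΦ.const_mul c) ((hΦ.nice 0).mul hf.nice) i

lemma HasComponent.add (hΦ : SiteFn Φ) {h k : Config → ℝ} (hh : HasComponent α Φ h)
    (hk : HasComponent α Φ k) : HasComponent α Φ (fun η => h η + k η) := by
  obtain ⟨nh, G, bG, fG, eG⟩ := hh
  obtain ⟨nk, G', bG', fG', eG'⟩ := hk
  refine ⟨nh.add nk, fun η => G η + G' η, bG.add bG', fun η s => by simp only [fG η s, fG' η s],
    fun i c f hf hf0 => ?_⟩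
  have nJ := nice_jumpGrad_tag hΦ hf i c
  simp only [tgrad_add nh nk, mul_add]
  rw [E_add α (nJ.mul (nh.tgrad i)) (nJ.mul (nk.tgrad i)), eG i c f hf hf0, eG' i c f hf hf0,
    ← E_add α (blind_tagDensity hf bG _ _ _).nice (blind_tagDensity hf bG' _ _ _).nice]
  congr 1
  funext η
  have := tagDensity_add bG bG' (e i) 0 0 c f η
  rw [add_zero] at this
  rw [tagDensity_comm _ c f 0 fun η => G η + G' η, this, tagDensity_comm _ c f 0 G,
    tagDensity_comm _ c f 0 G']

lemma HasComponent.const_mul {h : Config → ℝ} (hh : HasComponent α Φ h) (t : ℝ) :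
    HasComponent α Φ (fun η => t * h η) := by
  obtain ⟨nh, G, bG, fG, eG⟩ := hh
  refine ⟨nh.const_mul t, fun η => t * G η, bG.const_mul t, fun η s => by simp only [fG η s],
    fun i c f hf hf0 => ?_⟩
  simp only [tgrad_const_mul, mul_left_comm _ t]
  rw [E_const_mul, eG i c f hf hf0, ← E_const_mul]
  congr 1
  funext η
  have := tagDensity_const_mul (e i) t 0 G c f η
  rw [mul_zero] at this
  rw [tagDensity_comm _ c f 0 fun η => t * G η, this, tagDensity_comm]

/-- After recentring at the origin and forgetting the state there beyond its occupation, the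
function is `v(η_0) F1`, whose component along `Φ` is `mean (Φ v) * F1`. -/
lemma hasComponent_site (hΦ : SiteFn Φ) (h0 : α.mean Φ = 0) {v : Site → ℝ} (hv : SiteFn v)
    (x : Lattice) {F : Config → ℝ} (hF : Blind F) :
    HasComponent α Φ (fun η => v (η x) * F η) := by
  set F1 : Config → ℝ := freeze refParticle (shift (-x) F)
  have bF1 : Blind F1 := (hF.shift (-x)).freeze Site.norm_refParticle
  have fF1 : FreeAtZero F1 := fun η s => freeze_update _ _ _ _
  have hshift : (fun η => v (η x) * F η) = shift x (fun η => v (η 0) * F1 η) := by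
    have h1 : (fun η : Config => v (η 0) * F1 η) = fun η => v (η 0) * shift (-x) F η := by
      funext η
      by_cases h : η 0 = Site.empty
      · simp [h, hv.empty]
      · simp only [F1, freeze, (hF.shift (-x)).occInv 0 η h]
    rw [h1]
    funext η
    have h2 : shift x (shift (-x) F) η = F η := by rw [shift_shift, neg_add_cancel, shift_zero]
    rw [← h2]
    simp [shift]
  refine ⟨(hv.nice x).mul hF.nice, fun η => α.mean (fun s => Φ s * v s) * F1 η,
    bF1.const_mul _, fun η s => by simp only [fF1 η s], fun i c f hf hf0 => ?_⟩
  obtain ⟨X, hX⟩ := exists_envGrad_eq_zero hf.nice (e i)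
  obtain ⟨Y, hY⟩ := exists_envGrad_eq_zero bF1.nice (e i)
  have h2 : α.E (tagDensity (e i) c f 0 fun η => α.mean (fun s => Φ s * v s) * F1 η)
      = α.mean (fun s => Φ s * v s) * α.E (tagDensity (e i) c f 0 F1) := by
    rw [← E_const_mul]
    congr 1
    funext η
    have := tagDensity_const_mul (e i) (α.mean (fun s => Φ s * v s)) 0 F1 c f η
    rw [mul_zero] at this
    rw [tagDensity_comm, this, tagDensity_comm]
  rw [h2, ← E_tagField_mul α hΦ hv h0 hf bF1 hf0 fF1 i hX hY, hshift, tgrad_shift]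
  congr 1
  funext η
  rw [← jumpGrad_eq_tagField hΦ hf i hX, ← mul_tgrad_eq hv bF1 i hY]
  have := mul_jumpGrad i (fun s => c * Φ s) (fun η => Φ (η 0) * f η) η
  linear_combination (-tgrad i (fun η => v (η 0) * F1 η) η) * this

lemma hasComponent_of_mem_classT {ω : Angle → ℝ} (hω : IsC2 ω) (hΦ : SiteFn Φ)
    (h0 : α.mean Φ = 0) {h : Config → ℝ} (hh : h ∈ classT ω) : HasComponent α Φ h := by
  induction hh using Submodule.span_induction with
  | mem h hh =>
    obtain ⟨-, a, b, c, d, A, F, hF, rfl⟩ := hh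
    have : ∀ B : Finset Lattice, HasComponent α Φ
        (fun η => ∑ x ∈ B, siteAff ω a b c d (η x) * F x η) := by
      classical
      intro B
      induction B using Finset.induction_on with
      | empty => simpa using hasComponent_zero
      | insert x B hx ih =>
        simp only [Finset.sum_insert hx]
        exact (hasComponent_site hΦ h0 (siteFn_siteAff hω a b c d) x
          (mem_blind_iff.1 (hF x))).add hΦ ih
    exact this A
  | zero => exact hasComponent_zero
  | add h k _ _ ih ik => exact ih.add hΦ ik
  | smul t h _ ih => exact ih.const_mul t

variable (α)

/-- The energy form. -/
def energyForm (Ψ : Fin 2 → Site → ℝ) (g : Config → ℝ) (Ψ' : Fin 2 → Site → ℝ)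
    (h : Config → ℝ) : ℝ :=
  ∑ i, α.E (fun η => jumpGrad i (Ψ i) g η * jumpGrad i (Ψ' i) h η)

variable {α}

/-- The trial field acts on fields weighted by `Φ` only through its component: the linear part
contributes the drift `mean (Φ Ψ_k)`, and the local part contributes `G`. The same `G` serves all
`c` and `f`, so it can itself be used as a test function. -/
lemma energyForm_tag {Ψ : Fin 2 → Site → ℝ} (hΦ : SiteFn Φ) (h0 : α.mean Φ = 0)
    (hΨ : ∀ k, SiteFn (Ψ k)) {h : Config → ℝ} (hh : HasComponent α Φ h) :
    ∃ G, Blind G ∧ FreeAtZero G ∧ ∀ (c : Fin 2 → ℝ) (f : Config → ℝ), Blind f → FreeAtZero f →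
      energyForm α (fun k s => c k * Φ s) (fun η => Φ (η 0) * f η) Ψ h
        = tagForm α c f (fun k => α.mean (fun s => Φ s * Ψ k s)) G := by
  obtain ⟨nh, G, bG, fG, eG⟩ := hh
  refine ⟨G, bG, fG, fun c f hf hf0 => ?_⟩
  refine Finset.sum_congr rfl fun i _ => ?_
  have nJ := nice_jumpGrad_tag hΦ hf i (c i)
  set m := α.mean (fun s => Φ s * Ψ i s)
  have e1 : (fun η => jumpGrad i (fun s => c i * Φ s) (fun η => Φ (η 0) * f η) η
        * jumpGrad i (Ψ i) h η)
      = fun η => jumpGrad i (fun s => c i * Φ s) (fun η => Φ (η 0) * f η) η * Ψ i (η 0)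
        + jumpGrad i (fun s => c i * Φ s) (fun η => Φ (η 0) * f η) η * tgrad i h η := by
    funext η
    have := mul_jumpGrad i (fun s => c i * Φ s) (fun η => Φ (η 0) * f η) η
    conv_lhs => rw [jumpGrad.eq_1 i (Ψ i) h]
    linear_combination (Ψ i (η 0) + tgrad i h η) * this
  rw [e1, E_add α (nJ.mul ((hΨ i).nice 0)) (nJ.mul (nh.tgrad i)), eG i (c i) f hf hf0,
    E_jumpGrad_mul_site α hΦ (hΨ i) h0 hf hf0 i (c i), ← E_const_mul,
    ← E_add α ((blind_tagDensity hf (blind_const 0) _ _ _).nice.const_mul m)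
      (blind_tagDensity hf bG _ _ _).nice]
  congr 1
  funext η
  have e2 := tagDensity_const_mul (e i) m 1 (fun _ => 0) (c i) f η
  have e3 := tagDensity_add ((blind_const 0).const_mul m) bG (e i) (m * 1) 0 (c i) f η
  simp only [mul_one, mul_zero, add_zero, zero_add] at e2 e3
  rw [tagDensity_comm _ (c i) f m G, e3, e2, tagDensity_comm, tagDensity_comm _ 0 G]

lemma energyForm_tag_self (hΦ : SiteFn Φ) (h0 : α.mean Φ = 0) (c : Fin 2 → ℝ) {f : Config → ℝ}
    (hf : Blind f) (hf0 : FreeAtZero f) :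
    energyForm α (fun k s => c k * Φ s) (fun η => Φ (η 0) * f η) (fun k s => c k * Φ s)
      (fun η => Φ (η 0) * f η) = α.mean (fun s => Φ s * Φ s) * tagForm α c f c f := by
  rw [energyForm, tagForm, Finset.mul_sum]
  refine Finset.sum_congr rfl fun i _ => ?_
  obtain ⟨X, hX⟩ := exists_envGrad_eq_zero hf.nice (e i)
  simp only [jumpGrad_eq_tagField hΦ hf i hX]
  exact E_tagField_mul α hΦ hΦ h0 hf hf hf0 hf0 i hX hX _ _

/-! ### Cauchy–Schwarz for the energy form and approximate correctors -/

lemma energyForm_self_nonneg (Ψ : Fin 2 → Site → ℝ) (h : Config → ℝ) :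
    0 ≤ energyForm α Ψ h Ψ h :=
  Finset.sum_nonneg fun _ _ => E_nonneg α fun _ => mul_self_nonneg _

lemma energyForm_sq_le {Ψ Ψ' : Fin 2 → Site → ℝ} (hΨ : ∀ k, SiteFn (Ψ k))
    (hΨ' : ∀ k, SiteFn (Ψ' k)) {g h : Config → ℝ} (hg : Nice g) (hh : Nice h) :
    energyForm α Ψ g Ψ' h ^ 2 ≤ energyForm α Ψ g Ψ g * energyForm α Ψ' h Ψ' h := by
  refine sq_le_mul_of_forall fun t => ?_
  have : energyForm α Ψ g Ψ g + 2 * t * energyForm α Ψ g Ψ' h + t ^ 2 * energyForm α Ψ' h Ψ' h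
      = ∑ i, α.E (fun η => (jumpGrad i (Ψ i) g η + t * jumpGrad i (Ψ' i) h η) ^ 2) := by
    simp only [energyForm, Finset.mul_sum, ← Finset.sum_add_distrib]
    refine Finset.sum_congr rfl fun i _ => ?_
    have n1 := nice_jumpGrad (hΨ i) hg i
    have n2 := nice_jumpGrad (hΨ' i) hh i
    rw [← E_const_mul, ← E_const_mul, ← E_add α (n1.mul n1) ((n1.mul n2).const_mul _),
      ← E_add α ((n1.mul n1).add ((n1.mul n2).const_mul _)) ((n2.mul n2).const_mul _)]
    congr 1
    funext η
    ring
  rw [this]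
  exact Finset.sum_nonneg fun i _ => E_nonneg α fun η => sq_nonneg _

lemma ds_nonneg : 0 ≤ ds α.total := by
  rw [ds, selfDiffusionForm_eq]
  exact Real.iInf_nonneg fun f => tagForm_self_nonneg α _ _

/-- Near-minimizers of the tagged particle form are nearly orthogonal to all gradients. -/
lemma tagForm_sub_sq_le {δ : ℝ} (i : Fin 2) {f : Config → ℝ} (hf : Blind f)
    (hle : tagForm α (Pi.single i 1) f (Pi.single i 1) f ≤ ds α.total + δ) (hδ : 0 ≤ δ)
    (x : Fin 2 → ℝ) {G : Config → ℝ} (hG : Blind G) :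
    (tagForm α (Pi.single i 1) f x G - ds α.total * x i) ^ 2 ≤ δ * tagForm α x G x G := by
  have h1 : (tagForm α (Pi.single i 1) f x G - ds α.total * x i) ^ 2
      ≤ δ * (tagForm α x G x G - ds α.total * (x 0 ^ 2 + x 1 ^ 2)) := by
    refine sq_le_mul_of_forall fun t => ?_
    -- `tagForm` minus `ds` times the squared norm of the drift is a non-negative quadratic form
    -- whose value at `(e_i, f)` is at most `δ`.
    have h2 := ds_mul_le_tagForm α (Pi.single i 1 + t • x) (hf.add (hG.const_mul t))
    rw [tagForm_add_smul α hf hG] at h2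
    fin_cases i <;> simp at h2 hle ⊢ <;> nlinarith
  refine h1.trans (mul_le_mul_of_nonneg_left ?_ hδ)
  have := ds_nonneg (α := α)
  nlinarith [mul_nonneg this (add_nonneg (sq_nonneg (x 0)) (sq_nonneg (x 1)))]

/-- One corrector works uniformly over all trial fields, with an error measured by their own energy.
This uniformity is what the supremum in the semi-norm requires. -/
lemma exists_corrector {ω : Angle → ℝ} (hω : IsC2 ω) {a b c d : ℝ}
    (h0 : α.mean (siteAff ω a b c d) = 0) (i : Fin 2) {δ : ℝ} (hδ : 0 < δ) :
    ∃ g ∈ classT0 ω, Nice g ∧ ∀ (Ψ : Fin 2 → Site → ℝ), (∀ k, SiteFn (Ψ k)) → ∀ h ∈ classT ω,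
      (energyForm α (fun k s => (Pi.single i 1 : Fin 2 → ℝ) k * siteAff ω a b c d s) g Ψ h
        - ds α.total * α.mean (fun s => siteAff ω a b c d s * Ψ i s)) ^ 2
        ≤ δ * energyForm α Ψ h Ψ h := by
  set Φ := siteAff ω a b c d
  have hΦ : SiteFn Φ := siteFn_siteAff hω a b c d
  set K := α.mean (fun s => Φ s * Φ s)
  have hK : 0 ≤ K := E_nonneg α fun η => mul_self_nonneg _
  -- The Bessel inequality costs a factor `K`; dividing by `K + 1` absorbs it and also covers `K =
  -- 0`.
  have hδ' : 0 < δ / (K + 1) := by positivity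
  obtain ⟨f, hf, hf0, hmem, hle⟩ := exists_nearMinimizer α hω a b c d i hδ'
  refine ⟨_, hmem, (hΦ.nice 0).mul hf.nice, fun Ψ hΨ h hh => ?_⟩
  have hc := hasComponent_of_mem_classT hω hΦ h0 hh
  obtain ⟨G, hG, hG0, hE⟩ := energyForm_tag hΦ h0 hΨ hc
  set x : Fin 2 → ℝ := fun k => α.mean (fun s => Φ s * Ψ k s)
  set En := energyForm α Ψ h Ψ h
  have hEn : 0 ≤ En := energyForm_self_nonneg Ψ h
  have hT : 0 ≤ tagForm α x G x G := tagForm_self_nonneg α _ _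
  -- Testing the trial field against its own component `(x, G)` gives `tagForm (x, G)` itself;
  -- Cauchy–Schwarz, followed by division by this quantity, bounds it.
  have hbessel : tagForm α x G x G ≤ K * En := by
    have hcs := energyForm_sq_le (α := α) (fun k => hΦ.const_mul (x k)) hΨ
      ((hΦ.nice 0).mul hG.nice) hc.1
    rw [hE x G hG hG0, energyForm_tag_self hΦ h0 x hG hG0] at hcs
    rcases hT.eq_or_lt with hz | hz
    · rw [← hz]; positivity
    · refine le_of_mul_le_mul_left ?_ hz
      calc tagForm α x G x G * tagForm α x G x G = tagForm α x G x G ^ 2 := (sq _).symm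
        _ ≤ K * tagForm α x G x G * En := hcs
        _ = tagForm α x G x G * (K * En) := by ring
  rw [hE (Pi.single i 1) f hf hf0]
  refine (tagForm_sub_sq_le i hf hle hδ'.le x hG).trans ?_
  calc δ / (K + 1) * tagForm α x G x G ≤ δ / (K + 1) * (K * En) :=
        mul_le_mul_of_nonneg_left hbessel hδ'.le
    _ ≤ δ / (K + 1) * ((K + 1) * En) := by
        refine mul_le_mul_of_nonneg_left ?_ hδ'.le
        nlinarith
    _ = δ * En := by field_simp

end

/-! ### The semi-norm -/

/-- The site functions of an affine family of angular functions. -/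
def affSite (ω : Angle → ℝ) (c d : Species → Fin 2 → ℝ) (k : Fin 2) : Site → ℝ :=
  siteAff ω (c .active k) (c .passive k) (d .active k) (d .passive k)

lemma sum_occAng_affineAng (ω : Angle → ℝ) (c d : Species → Fin 2 → ℝ) (k : Fin 2) (x : Lattice)
    (η : Config) : ∑ σ, occAng σ (affineAng ω c d σ k) x η = affSite ω c d k (η x) := by
  simp only [sum_species, occAng, affineAng, affSite, siteAff, occ]
  ring

section
variable {α : GCParam} {ω : Angle → ℝ}

/-- A site holds at most one species, so the sum over species of squares is the square of a single
jump gradient. -/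
lemma energy_eq (hω : IsC2 ω) (c d : Species → Fin 2 → ℝ) {h : Config → ℝ} (hh : Nice h) :
    energy α (affineAng ω c d) h = energyForm α (affSite ω c d) h (affSite ω c d) h := by
  rw [energy, Finset.sum_comm, energyForm]
  refine Finset.sum_congr rfl fun i _ => ?_
  have hn : ∀ σ, Nice fun η => occ σ 0 η * (1 - occTot (e i) η) *
      (affineAng ω c d σ i (η 0).angle + tgrad i h η) ^ 2 := by
    intro σ
    have h1 : SiteFn fun s => affineAng ω c d σ i s.angle * s.num σ := by
      have := ((siteFn_num σ).const_mul (c σ i)).add ((siteFn_angle_mul hω σ).const_mul (d σ i))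
      convert this using 2
      simp only [affineAng]; ring
    have h2 := (nice_vac (e i)).mul (((h1.nice 0).add (((siteFn_num σ).nice 0).mul
      (hh.tgrad i))).pow_two)
    convert h2 using 2 with η
    have h3 : (η 0).num σ * (η 0).num σ = (η 0).num σ := by
      rcases η 0 with _ | ⟨τ, θ⟩
      · simp [Site.num]
      · by_cases h : τ = σ <;> simp [Site.num, h]
    simp only [occ]
    linear_combination (-(1 - occTot (e i) η) *
      (affineAng ω c d σ i (η 0).angle + tgrad i h η) ^ 2) * h3
  change ∑ σ, α.E (fun η => occ σ 0 η * (1 - occTot (e i) η) *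
      (affineAng ω c d σ i (η 0).angle + tgrad i h η) ^ 2) = _
  rw [← E_sum α Finset.univ fun σ _ => hn σ]
  congr 1
  funext η
  have hv := vac_mul_self (e i) η
  simp only [sum_species, jumpGrad, affSite, siteAff, affineAng, occ]
  rcases h0 : η 0 with _ | ⟨τ, θ⟩
  · simp [Site.num, occTot_eq, h0]
  · cases τ
    · simp [Site.num, occTot_eq 0, h0, Site.angle]
      linear_combination (-(c .active i + d .active i * ω θ + tgrad i h η) ^ 2) * hv
    · simp [Site.num, occTot_eq 0, h0, Site.angle]
      linear_combination (-(c .passive i + d .passive i * ω θ + tgrad i h η) ^ 2) * hv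

lemma pairing_eq {φ h : Config → ℝ} {c d : Species → Fin 2 → ℝ} {r : ℝ} {s : Fin 2 → ℝ}
    (h1 : PairSum α φ (fun x => shift x h) r)
    (h2 : ∀ k, PairSum α φ (fun x η => (x k : ℝ) * affSite ω c d k (η x)) (s k)) :
    pairing α φ (affineAng ω c d) h = -(r + ∑ k, s k) := by
  rw [pairing, h1.2]
  congr 2
  refine Finset.sum_congr rfl fun k _ => ?_
  rw [← (h2 k).2]
  refine finsum_congr fun x => ?_
  rw [← E_const_mul]
  congr 1
  funext η
  rw [sum_occAng_affineAng]; ring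

/-- The current and the generator term assemble into the energy form with the field of `(Φ, g)`.
Local gradients pair to zero with the translates of `h`, and only their static covariances with
`Ψ_i` remain; for the occupation number this is `(1 - total) * mean Ψ_i`. -/
lemma pairing_curr_gen (hω : IsC2 ω) {Φ v : Site → ℝ} (hΦ : SiteFn Φ) (hv : SiteFn v) (i : Fin 2)
    (p q : ℝ) {g h : Config → ℝ} (hg : Nice g) (hh : Nice h) (c d : Species → Fin 2 → ℝ) :
    pairing α (fun η => (curr Φ i η + p * lgrad v i η + q * lgrad Site.tot i η) + gen g η)
        (affineAng ω c d) h
      = energyForm α (fun k s => (Pi.single i 1 : Fin 2 → ℝ) k * Φ s) g (affSite ω c d) h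
        - p * (α.mean (fun s => v s * affSite ω c d i s) - α.mean v * α.mean (affSite ω c d i))
        - q * ((1 - α.total) * α.mean (affSite ω c d i)) := by
  have hΨ : ∀ k, SiteFn (affSite ω c d k) := fun k => siteFn_siteAff hω _ _ _ _
  set Ψ := affSite ω c d
  have nc := nice_curr hΦ i
  have nv := (nice_lgrad hv i).const_mul p
  have nt := (nice_lgrad siteFn_tot i).const_mul q
  have F1 := gradFamily_shift hh
  have F2 := fun k => gradFamily_linear (hΨ k) k
  have P1 := (((pairSum_curr (α := α) hΦ i F1).add nc nv F1.nice
    ((pairSum_lgrad_shift hv i hh).const_mul p)).add (nc.add nv) nt F1.nice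
    ((pairSum_lgrad_shift siteFn_tot i hh).const_mul q)).add ((nc.add nv).add nt) hg.gen F1.nice
    (pairSum_gen hg F1)
  have P2 := fun k => (((pairSum_curr (α := α) hΦ i (F2 k)).add nc nv (F2 k).nice
    ((pairSum_lgrad_linear hv (hΨ k) i k).const_mul p)).add (nc.add nv) nt (F2 k).nice
    ((pairSum_lgrad_linear siteFn_tot (hΨ k) i k).const_mul q)).add ((nc.add nv).add nt) hg.gen
    (F2 k).nice (pairSum_gen hg (F2 k))
  rw [pairing_eq P1 P2]
  have htot : α.mean (fun s => s.tot * Ψ i s) = α.mean (Ψ i) := by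
    congr 1; funext s; rw [mul_comm, (hΨ i).mul_tot]
  -- The gradients of the two families, translates of `h` and linear sums, add up to the full jump
  -- gradient of the trial field.
  have hU : ∀ k η, occTot 0 η * (1 - occTot (e k) η) * tgrad k h η
      + Ψ k (η 0) * (1 - occTot (e k) η) = jumpGrad k (Ψ k) h η := by
    intro k η
    have := (hΨ k).mul_tot (η 0)
    simp only [jumpGrad, occTot_eq 0]
    linear_combination (-(1 - occTot (e k) η)) * this
  have hE1 : ∀ {K : Config → ℝ}, Nice K → ∀ k,
      α.E (fun η => K η * jumpGrad k (Ψ k) h η)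
        = α.E (fun η => K η * (occTot 0 η * (1 - occTot (e k) η) * tgrad k h η))
          + α.E (fun η => K η * (Ψ k (η 0) * (1 - occTot (e k) η))) := by
    intro K hK k
    rw [← E_add α (hK.mul (F1.niceU k)) (hK.mul (((hΨ k).nice 0).mul (nice_vac (e k))))]
    congr 1; funext η; rw [← hU]; ring
  have hlhs : energyForm α (fun k s => (Pi.single i 1 : Fin 2 → ℝ) k * Φ s) g Ψ h
      = α.E (fun η => Φ (η 0) * jumpGrad i (Ψ i) h η)
        + ∑ k, α.E (fun η => tgrad k g η * jumpGrad k (Ψ k) h η) := by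
    have h1 : ∀ k, α.E (fun η => jumpGrad k (fun s => (Pi.single i 1 : Fin 2 → ℝ) k * Φ s) g η
        * jumpGrad k (Ψ k) h η)
        = (Pi.single i 1 : Fin 2 → ℝ) k * α.E (fun η => Φ (η 0) * jumpGrad k (Ψ k) h η)
          + α.E (fun η => tgrad k g η * jumpGrad k (Ψ k) h η) := by
      intro k
      have nJ := nice_jumpGrad (hΨ k) hh k
      rw [← E_const_mul, ← E_add α (((hΦ.nice 0).mul nJ).const_mul _) ((hg.tgrad k).mul nJ)]
      congr 1
      funext η
      have := mul_jumpGrad k (Ψ k) h η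
      conv_lhs => rw [jumpGrad.eq_1 k (fun s => (Pi.single i 1 : Fin 2 → ℝ) k * Φ s) g]
      linear_combination ((Pi.single i 1 : Fin 2 → ℝ) k * Φ (η 0) + tgrad k g η) * this
    simp only [energyForm, h1, Finset.sum_add_distrib]
    congr 1
    simp [Pi.single_apply]
  rw [hlhs, hE1 (hΦ.nice 0)]
  simp only [fun k => hE1 (hg.tgrad k) k, mean_tot]
  fin_cases i <;> simp [Fin.sum_univ_two, E_const, htot] at htot ⊢ <;> ring

lemma mean_eq_zero_of_total {v : Site → ℝ} (hv : SiteFn v) (h : α.mean Site.tot = 0) :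
    α.mean v = 0 := by
  obtain ⟨C, hC⟩ := hv.bdd
  have h1 : α.mean v ≤ α.mean (fun s => C * s.tot) :=
    E_mono α (hv.nice 0) ((siteFn_tot.const_mul C).nice 0) fun η => by
      rw [← hv.mul_tot]
      exact mul_le_mul_of_nonneg_right ((le_abs_self _).trans (hC _)) (occTot_nonneg 0 η)
  have h2 : α.mean (fun s => -C * s.tot) ≤ α.mean v :=
    E_mono α ((siteFn_tot.const_mul (-C)).nice 0) (hv.nice 0) fun η => by
      rw [← hv.mul_tot (η 0)]
      exact mul_le_mul_of_nonneg_right (abs_le.1 (hC _)).1 (occTot_nonneg 0 η)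
  rw [mean_const_mul, h] at h1 h2
  linarith

/-- Regularity is already part of `HasComponent`; the weight `Φ = 0` and an arbitrary density give
access to it. -/
lemma nice_of_mem_classT (hω : IsC2 ω) {h : Config → ℝ} (hh : h ∈ classT ω) : Nice h :=
  (hasComponent_of_mem_classT (α := GCParam.ofDensity 0) hω siteFn_zero (E_const _ 0) hh).1

/-! ### From approximate correctors to the semi-norm -/

lemma seminormSq_nonneg (φ : Config → ℝ) : 0 ≤ seminormSq α ω φ := by
  refine le_iSup_of_le 0 (le_iSup_of_le 0 (le_iSup_of_le 0 ?_))
  have h1 : pairing α φ (affineAng ω 0 0) ((0 : classT0 ω) : Config → ℝ) = 0 := by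
    simp [pairing, affineAng, occAng, shift, E_const]
  have h2 : energy α (affineAng ω 0 0) ((0 : classT0 ω) : Config → ℝ) = 0 := by
    simp [energy, affineAng, shift, ugrad, E_const]
  rw [h1, h2]
  simp

/-- The current of a site function, corrected by gradients. -/
def corrected (α : GCParam) (v : Site → ℝ) (i : Fin 2) : Config → ℝ := fun η =>
  curr v i η + ds α.total * lgrad v i η + (α.mean v * crossD α.total) * lgrad Site.tot i η

/-- The corrector for the mean-zero part of the site function also corrects the whole current,
because the remaining part is a multiple of the total current, which is already a gradient. -/
lemma exists_seminormSq_le (hω : IsC2 ω) (a b c d : ℝ) (i : Fin 2) {δ : ℝ} (hδ : 0 < δ) :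
    ∃ g : classT0 ω,
      seminormSq α ω (corrected α (siteAff ω a b c d) i + gen g) ≤ (δ : EReal) := by
  set v := siteAff ω a b c d with hvdef
  have hv : SiteFn v := siteFn_siteAff hω a b c d
  -- At zero density `mean v` vanishes and `m = 0`, so both identities below persist and the value
  -- of `crossD` at zero plays no role.
  set m := α.mean v / α.total with hm
  have hmean : α.mean v = m * α.total := by
    by_cases h : α.total = 0
    · rw [h, mul_zero]
      exact mean_eq_zero_of_total hv (by rw [mean_tot, h])
    · rw [hm]; field_simp
  have hcross : α.mean v * crossD α.total = m * (1 - ds α.total) := by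
    by_cases h : α.total = 0
    · have hv0 := mean_eq_zero_of_total hv (by rw [mean_tot, h])
      rw [hm, hv0]; simp
    · rw [crossD, if_neg h, hm]; field_simp
  set Φ := siteAff ω (a - m) (b - m) c d with hΦdef
  have hΦ : SiteFn Φ := siteFn_siteAff hω _ _ _ _
  have hΦv : ∀ s, Φ s = v s - m * s.tot := by
    intro s
    simp only [Φ, v, siteAff, Site.tot, sum_species]; ring
  have hΦ0 : α.mean Φ = 0 := by
    rw [funext hΦv, mean_sub α hv (siteFn_tot.const_mul m), mean_const_mul, mean_tot, hmean,
      sub_self]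
  obtain ⟨g, hg, ng, hbound⟩ := exists_corrector (α := α) hω hΦ0 i hδ
  refine ⟨⟨g, hg⟩, iSup_le fun c' => iSup_le fun d' => iSup_le fun h => ?_⟩
  have nh : Nice (h : Config → ℝ) := nice_of_mem_classT hω h.2.2
  have hΨ : ∀ k, SiteFn (affSite ω c' d' k) := fun k => siteFn_siteAff hω _ _ _ _
  have hb := hbound (affSite ω c' d') hΨ h h.2.2
  -- The last `- m` comes from the total current, `curr tot = -lgrad tot`. The coefficient
  -- simplifies to `-m * ds`, which turns `ds * lgrad v` into `ds * lgrad Φ`.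
  have hφ : corrected α v i + gen g = fun η => (curr Φ i η + ds α.total * lgrad v i η
      + (m * (1 - ds α.total) - m) * lgrad Site.tot i η) + gen g η := by
    funext η
    simp only [Pi.add_apply, corrected, hcross, curr, lgrad, hΦv, occTot_eq]
    ring
  have hmΦ : α.mean (fun s => v s * affSite ω c' d' i s)
      = α.mean (fun s => Φ s * affSite ω c' d' i s) + m * α.mean (affSite ω c' d' i) := by
    rw [← mean_const_mul, ← mean_add α (hΦ.mul (hΨ i)) ((hΨ i).const_mul m)]
    congr 1
    funext s
    rw [hΦv]
    linear_combination m * (hΨ i).mul_tot s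
  have hpair : pairing α (corrected α v i + gen g) (affineAng ω c' d') h
      = energyForm α (fun k s => (Pi.single i 1 : Fin 2 → ℝ) k * Φ s) g (affSite ω c' d') h
        - ds α.total * α.mean (fun s => Φ s * affSite ω c' d' i s) := by
    rw [hφ, pairing_curr_gen hω hΦ hv i _ _ ng nh, hmΦ, hmean]
    ring
  rw [← hpair, ← energy_eq hω c' d' nh] at hb
  refine EReal.coe_le_coe_iff.2 ?_
  set P := pairing α (corrected α v i + gen g) (affineAng ω c' d') h
  set En := energy α (affineAng ω c' d') h
  have hEn : 0 ≤ En := by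
    simp only [En, energy_eq hω c' d' nh]
    exact energyForm_self_nonneg _ _
  -- From `P ^ 2 ≤ δ * En` and the arithmetic–geometric inequality `4 * δ * En ≤ (δ + En) ^ 2`.
  have h2 : |2 * P| ≤ δ + En := abs_le_of_sq_le_sq (by nlinarith [sq_nonneg (δ - En)]) (by linarith)
  linarith [le_abs_self (2 * P)]

lemma gen_neg (g : Config → ℝ) : gen (-g) = -gen g := by
  funext η
  simp only [gen, Pi.neg_apply]
  rw [← finsum_neg_distrib]
  refine finsum_congr fun x => ?_
  rw [← Finset.sum_neg_distrib]
  refine Finset.sum_congr rfl fun i _ => ?_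
  simp only [dgrad, ugrad, Pi.neg_apply]
  ring

lemma corrected_mem_classT0 (hω : IsC2 ω) (a b c d : ℝ) (i : Fin 2) :
    corrected α (siteAff ω a b c d) i ∈ classT0 ω := by
  have h1 : Site.tot = siteAff ω 1 1 0 0 := by
    funext s; simp [siteAff, Site.tot, sum_species]
  have h2 := (classT0 ω).add_mem ((classT0 ω).add_mem (curr_mem_classT0 hω a b c d i)
    ((classT0 ω).smul_mem (ds α.total) (lgrad_mem_classT0 hω a b c d i)))
    ((classT0 ω).smul_mem (α.mean (siteAff ω a b c d) * crossD α.total)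
      (lgrad_mem_classT0 hω 1 1 0 0 i))
  rw [← h1] at h2
  exact h2

theorem vanishesModGen_corrected (hω : IsC2 ω) (a b c d : ℝ) (i : Fin 2) :
    VanishesModGen α ω (corrected α (siteAff ω a b c d) i) := by
  refine ⟨le_antisymm ?_ (le_iInf fun g => seminormSq_nonneg _),
    corrected_mem_classT0 hω a b c d i, ?_⟩
  · by_contra hlt
    rw [not_le] at hlt
    obtain ⟨δ, h1, h2⟩ := EReal.lt_iff_exists_real_btwn.1 hlt
    obtain ⟨g, hg⟩ := exists_seminormSq_le (α := α) hω a b c d i (EReal.coe_pos.1 h1)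
    exact absurd ((iInf_le _ g).trans hg) (not_le.2 h2)
  · have hpos : ∀ n : ℕ, (0 : ℝ) < 1 / ((n : ℝ) + 1) := fun n => by positivity
    choose g hg using fun n : ℕ => exists_seminormSq_le (α := α) hω a b c d i (hpos n)
    -- The closure is phrased with `f - gen g`, the infimum with `f + gen g`; the class is stable
    -- under negation.
    refine ⟨fun n => -g n, ?_⟩
    have hlim : Tendsto (fun n : ℕ => ((1 / ((n : ℝ) + 1) : ℝ) : EReal)) atTop (𝓝 0) :=
      (continuous_coe_real_ereal.tendsto 0).comp tendsto_one_div_add_atTop_nhds_zero_nat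
    refine tendsto_of_tendsto_of_tendsto_of_le_of_le tendsto_const_nhds hlim
      (fun n => seminormSq_nonneg _) fun n => ?_
    have := hg n
    simpa [gen_neg] using this

/-- The coefficient of `τ` in the site function of the species `σ`. -/
def pick (σ τ : Species) : ℝ := if σ = τ then 1 else 0

/-! ### Specialization to a single species -/

lemma siteAff_pick (ω : Angle → ℝ) (σ : Species) (a c : ℝ) (s : Site) :
    siteAff ω (a * pick σ .active) (a * pick σ .passive) (c * pick σ .active) (c * pick σ .passive) s
      = (a + c * ω s.angle) * s.num σ := by
  cases σ <;> simp [siteAff, pick] <;> ring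

/-- The current of `(a + c ω) 1_σ`, corrected by gradients, vanishes modulo `𝓛 T_0^ω`. -/
lemma vanishesModGen_species (hω : IsC2 ω) (σ : Species) (a c : ℝ) (i : Fin 2) {κ : ℝ}
    (hκ : (a * α.density σ + c * α.E (occAng σ ω 0)) * crossD α.total = κ) :
    VanishesModGen α ω ((a • current1 σ i + c • current σ ω i)
      + ds α.total • (a • locGrad σ i + c • locGradAng σ ω i) + κ • locGradTot i) := by
  have h := vanishesModGen_corrected (α := α) hω (a * pick σ .active) (a * pick σ .passive)
    (c * pick σ .active) (c * pick σ .passive) i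
  rw [funext (siteAff_pick ω σ a c)] at h
  have hm : α.mean (fun s => (a + c * ω s.angle) * s.num σ)
      = a * α.density σ + c * α.E (occAng σ ω 0) := by
    have h1 := mean_add α ((siteFn_num σ).const_mul a) ((siteFn_angle_mul hω σ).const_mul c)
    rw [mean_const_mul, mean_const_mul, mean_num] at h1
    refine Eq.trans ?_ h1
    congr 1; funext s; ring
  convert h using 1
  funext η
  simp only [corrected, hm, hκ, curr, lgrad, Pi.add_apply, Pi.smul_apply, smul_eq_mul, current1,
    current, locGrad, locGradAng, locGradTot, occAng, occ, occTot_eq]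
  ring

/-- If the species is absent, boundedness of `ω` forces the left side to vanish too, so the default
value of the conditional mean does no harm. -/
lemma E_occAng_eq (hω : IsC2 ω) (σ : Species) :
    α.E (occAng σ ω 0) = α.angMean σ ω * α.density σ := by
  have h1 : α.E (occ σ 0) = α.density σ := mean_num α σ
  rw [GCParam.angMean, h1]
  by_cases h : α.density σ = 0
  · rw [h, mul_zero]
    obtain ⟨C, hC⟩ := hω.bdd
    have hnum : ∀ s : Site, 0 ≤ s.num σ := by
      rintro (_ | ⟨τ, θ⟩)
      · simp [Site.num]
      · by_cases h : τ = σ <;> simp [Site.num, h]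
    have hs := siteFn_angle_mul hω σ
    have h2 : α.mean (fun s => ω s.angle * s.num σ) ≤ α.mean (fun s => C * s.num σ) :=
      E_mono α (hs.nice 0) (((siteFn_num σ).const_mul C).nice 0) fun η =>
        mul_le_mul_of_nonneg_right ((le_abs_self _).trans (hC _)) (hnum _)
    have h3 : α.mean (fun s => -C * s.num σ) ≤ α.mean (fun s => ω s.angle * s.num σ) :=
      E_mono α (((siteFn_num σ).const_mul (-C)).nice 0) (hs.nice 0) fun η =>
        mul_le_mul_of_nonneg_right (abs_le.1 (hC _)).1 (hnum _)
    rw [mean_const_mul, mean_num, h] at h2 h3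
    change α.mean (fun s => ω s.angle * s.num σ) = 0
    linarith
  · field_simp

end

end APLG

end

theorem proposition4p5 (ω : APLG.Angle → ℝ) (hω : APLG.IsC2 ω) (α : APLG.GCParam) (i : Fin 2) :
    (∀ σ : APLG.Species,
      APLG.VanishesModGen α ω (APLG.current1 σ i + APLG.ds α.total • APLG.locGrad σ i
        + (α.density σ * APLG.crossD α.total) • APLG.locGradTot i)) ∧
    (∀ σ : APLG.Species,
      APLG.VanishesModGen α ω (APLG.centeredCurrent α σ ω i
        + APLG.ds α.total • APLG.centeredLocGrad α σ ω i)) ∧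
    APLG.VanishesModGen α ω (APLG.current .active ω i
      + APLG.ds α.total • APLG.locGradAng .active ω i
      + APLG.frakD α ω • APLG.locGradTot i) := by
  refine ⟨fun σ => ?_, fun σ => ?_, ?_⟩
  · have h := APLG.vanishesModGen_species (α := α) hω σ 1 0 i rfl
    simpa only [one_mul, zero_mul, add_zero, one_smul, zero_smul] using h
  -- Centering makes the mean of the site function zero, so the gradient of the total density
  -- disappears.
  · have h := APLG.vanishesModGen_species (α := α) hω σ (-α.angMean σ ω) 1 i (κ := 0)
      (by rw [APLG.E_occAng_eq hω]; ring)
    convert h using 1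
    simp only [APLG.centeredCurrent, APLG.centeredLocGrad]
    module
  · have h := APLG.vanishesModGen_species (α := α) hω .active 0 1 i (κ := APLG.frakD α ω)
      (by rw [APLG.frakD]; ring)
    simpa only [one_smul, zero_smul, zero_add] using h
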